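/- Let $\tau=(1\;n{+}1)(2\;n{+}2)\cdots(n\;2n)\in\mathbb S_{2n}$. For partitions $\mu,\nu$ of a positive integer $n$ with $\ell(\mu),\ell(\nu)$ parts and for $g\ge 0$ put $b=g-1+\ell(\mu)+\ell(\nu)$, and let $C_g(\mu,\nu)$ be the set of tuples $(\sigma_1,\eta_1,\dots,\eta_b,\sigma_2)$ in $\mathbb S_{2n}$ such that: $\tau\sigma_1\tau=\sigma_1^{-1}$, no cycle $c$ of $\sigma_1$ is self-symmetric (that is, $\tau$ maps the support of no cycle, fixed points being cycles of length one, to itself), and the cycle type of $\sigma_1$ is $2\mu$ (every part of $\mu$ taken twice); the cycle type of $\sigma_2$ is $2\nu$; every $\eta_i$ is a transposition with $\eta_i\ne\tau\eta_i\tau$; $\eta_b\cdots\eta_1\sigma_1(\tau\eta_1\tau)\cdots(\tau\eta_b\tau)=\sigma_2$; and the subgroup generated by $\sigma_1,\sigma_2$ and all $\eta_i,\tau\eta_i\tau$ acts transitively on $\{1,\dots,2n\}$. The twisted double Hurwitz number is $\tilde h_g(\mu,\nu)=\frac{1}{(2n)!!}|C_g(\mu,\nu)|$. Fix $k,l\ge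 1$. The chambers are the connected components of the set of real points $(\mu,\nu)\in\mathbb R_{>0}^k\times\mathbb R_{>0}^l$ with $\sum_i\mu_i=\sum_j\nu_j$ that lie on none of the walls $\sum_{i\in I}\mu_i=\sum_{j\in J}\nu_j$, where $I\subset\{1,\dots,k\}$ and $J\subset\{1,\dots,l\}$ are nonempty proper subsets. For a tuple $\mu$ let $\mathrm{Aut}(\mu)$ be the group of permutations of its entries that leave it unchanged. A twisted monodromy graph of type $(g,\mu,\nu)$ is a finite connected directed multigraph $\Gamma$ of first Betti number $g$, with inward and outward ends, whose inner vertices are all 3-valent or 4-valent and none of which is a source or a sink, with positive integer weights on its edges, with a weight-preserving involution (an automorphism of the directed graph) whose fixed points are exactly the 4-valent vertices (no edge or end is fixed), and with an ordering of the inner vertices, compatible with the edge directions, in which exactly the vertices exchanged by the involution share a position, such that: $\Gamma$ has $2\ell(\mu)$ inward ends, two of weight $\mu_i$ for each $i$, and $2\ell(\nu)$ outward ends, two of weight $\nu_j$ for each $j$; at each inner vertex the sum of the incoming weights equals the sum of the outgoing weights; and the four edges at a 4-valent vertex all have the same weight. **Proposition.** (a) For every chamber $C$ there is a polynomial $P\in\mathbb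 Q[\mu_1,\dots,\mu_k,\nu_1,\dots,\nu_l]$ such that $|\mathrm{Aut}(\mu)|\,|\mathrm{Aut}(\nu)|\,\tilde h_0(\mu,\nu)=P(\mu,\nu)$ for all $(\mu,\nu)\in C$ with integer entries. For every such $P$, the homogeneous component of degree $d$ of $P$ is not identically zero on the hyperplane $\sum_i\mu_i=\sum_j\nu_j$ if and only if $d=k+l-1$ or $d=k+l-2$. In other words, on each chamber the polynomial $\tilde h_0(\mu,\nu)$ has exactly two homogeneous components, of degrees $\ell(\mu)+\ell(\nu)-1$ and $\ell(\mu)+\ell(\nu)-2$. (b) For all partitions $\mu,\nu$ of a positive integer, every twisted monodromy graph of type $(0,\mu,\nu)$ has exactly one 4-valent vertex. -/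

import Mathlib

open scoped BigOperators

/-! ## Twisted double Hurwitz numbers -/

/-- The fixed-point-free involution `τ = (1 n+1)(2 n+2)⋯(n 2n)` of `{1, …, 2n}`, where `{1, …, 2n}`
is written as the disjoint union of two copies of `{1, …, n}`: it exchanges the two copies. -/
def tauPerm (n : ℕ) : Equiv.Perm (Fin n ⊕ Fin n) := Equiv.sumComm (Fin n) (Fin n)

/-- The set of the permutations `σ` with `τ σ τ = σ⁻¹` that have no self-symmetric cycle. For such a
`σ` conjugation by `τ` followed by inversion permutes the cycles of `σ`, and sends the cycle through
`x` to the cycle through `τ x`; hence the cycle through `x` is self-symmetric exactly if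
`x` and `τ x` lie on the same cycle. -/
def BTilde (n : ℕ) : Set (Equiv.Perm (Fin n ⊕ Fin n)) :=
  {σ | tauPerm n * σ * tauPerm n = σ⁻¹ ∧ ∀ x, ¬ σ.SameCycle x (tauPerm n x)}

/-- The permutations in `BTilde n` whose cycle lengths, fixed points included, are the parts of `μ`,
each of them repeated once (two cycles for every part of `μ`). -/
def BTildeOf {n : ℕ} (μ : n.Partition) : Set (Equiv.Perm (Fin n ⊕ Fin n)) :=
  {σ | σ ∈ BTilde n ∧ σ.partition.parts = μ.parts + μ.parts}

/-- The number `b = (2g - 2 + 2ℓ(μ) + 2ℓ(ν)) / 2` of transpositions; for partitions of a positive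
integer the subtraction is not truncated and `b > 0`. -/
def branchNumber (g : ℕ) {n : ℕ} (μ ν : n.Partition) : ℕ :=
  g + μ.parts.card + ν.parts.card - 1

/-- The set of the twisted factorisations `(σ₁, η₁, …, η_b, σ₂)` of type `(g, μ, ν)`. -/
def twistedFactorisations (g : ℕ) {n : ℕ} (μ ν : n.Partition) :
    Set (Equiv.Perm (Fin n ⊕ Fin n) ×
      (Fin (branchNumber g μ ν) → Equiv.Perm (Fin n ⊕ Fin n)) ×
      Equiv.Perm (Fin n ⊕ Fin n)) :=
  {t | t.1 ∈ BTildeOf μ ∧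
    t.2.2.partition.parts = ν.parts + ν.parts ∧
    (∀ i, (t.2.1 i).IsSwap ∧ t.2.1 i ≠ tauPerm n * t.2.1 i * tauPerm n) ∧
    (List.ofFn t.2.1).reverse.prod * t.1 *
      (List.ofFn fun i => tauPerm n * t.2.1 i * tauPerm n).prod = t.2.2 ∧
    MulAction.IsPretransitive
      (Subgroup.closure (({t.1, t.2.2} : Set (Equiv.Perm (Fin n ⊕ Fin n))) ∪
        Set.range t.2.1 ∪ Set.range fun i => tauPerm n * t.2.1 i * tauPerm n))
      (Fin n ⊕ Fin n)}

/-- The twisted double Hurwitz number of type `(g, μ, ν)`. -/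
noncomputable def twistedHurwitz (g : ℕ) {n : ℕ} (μ ν : n.Partition) : ℚ :=
  ((twistedFactorisations g μ ν).ncard : ℚ) / (Nat.doubleFactorial (2 * n) : ℚ)

/-! ## Chambers of polynomiality -/

/-- The real points `(μ, ν)` with positive entries and `∑ μᵢ = ∑ νⱼ` that lie on none of the walls
`∑_{i ∈ I} μᵢ = ∑_{j ∈ J} νⱼ`, where `I` and `J` are nonempty proper subsets of the index sets.
The coordinates `Sum.inl i` are the `μᵢ`, the coordinates `Sum.inr j` are the `νⱼ`. -/
def resonanceComplement (k l : ℕ) : Set (Fin k ⊕ Fin l → ℝ) :=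
  {z | (∀ s, 0 < z s) ∧
    ∑ i, z (Sum.inl i) = ∑ j, z (Sum.inr j) ∧
    ∀ (I : Finset (Fin k)) (J : Finset (Fin l)),
      I.Nonempty → I ≠ Finset.univ → J.Nonempty → J ≠ Finset.univ →
      ∑ i ∈ I, z (Sum.inl i) ≠ ∑ j ∈ J, z (Sum.inr j)}

/-- A chamber is a connected component of the complement of the walls. -/
def IsChamber {k l : ℕ} (C : Set (Fin k ⊕ Fin l → ℝ)) : Prop :=
  ∃ p ∈ resonanceComplement k l, C = connectedComponentIn (resonanceComplement k l) p

/-- The number of automorphisms of a tuple, i.e. of the permutations of its entries that leave the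
tuple unchanged. -/
noncomputable def autCard {k : ℕ} (x : Fin k → ℕ) : ℕ :=
  Nat.card {π : Equiv.Perm (Fin k) // x ∘ π = x}

/-- The polynomial `P` in the entries of `μ` and `ν` computes the twisted double Hurwitz numbers of
genus `g` on the chamber `C`: for all partitions `μ`, `ν` of the same integer whose entries,
listed as `x` and `y`, form a point of `C`, one has
`|Aut(μ)| |Aut(ν)| h̃_g(μ, ν) = P(x, y)`. -/
def ComputesOn (g : ℕ) {k l : ℕ} (C : Set (Fin k ⊕ Fin l → ℝ))
    (P : MvPolynomial (Fin k ⊕ Fin l) ℚ) : Prop :=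
  ∀ (n : ℕ) (μ ν : n.Partition) (x : Fin k → ℕ) (y : Fin l → ℕ),
    μ.parts = Finset.univ.val.map x → ν.parts = Finset.univ.val.map y →
    (fun s => ((Sum.elim x y s : ℕ) : ℝ)) ∈ C →
    (autCard x : ℚ) * (autCard y : ℚ) * twistedHurwitz g μ ν =
      MvPolynomial.eval (fun s => ((Sum.elim x y s : ℕ) : ℚ)) P

/-- The polynomial `P` is zero as a function on the hyperplane `∑ μᵢ = ∑ νⱼ`. -/
def ZeroOnHyperplane {k l : ℕ} (P : MvPolynomial (Fin k ⊕ Fin l) ℚ) : Prop :=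
  ∀ z : Fin k ⊕ Fin l → ℚ, ∑ i, z (Sum.inl i) = ∑ j, z (Sum.inr j) →
    MvPolynomial.eval z P = 0

/-! ## Twisted monodromy graphs -/

/-- A finite directed multigraph with inward and outward ends and with weights on all edges. The
leaves at infinity are left out: `V` is the set of inner vertices, `E` the set of bounded edges,
an inward end only has a head and an outward end only has a tail. -/
structure EndedDigraph where
  /-- inner vertices -/
  V : Type
  /-- bounded edges -/
  E : Type
  /-- inward ends -/
  A : Type
  /-- outward ends -/
  B : Type
  [fintypeV : Fintype V]
  [fintypeE : Fintype E]
  [fintypeA : Fintype A]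
  [fintypeB : Fintype B]
  [decEqV : DecidableEq V]
  /-- the vertex where a bounded edge starts -/
  tail : E → V
  /-- the vertex where a bounded edge stops -/
  head : E → V
  /-- the vertex where an inward end stops -/
  headA : A → V
  /-- the vertex where an outward end starts -/
  tailB : B → V
  /-- weights of the bounded edges -/
  wE : E → ℕ
  /-- weights of the inward ends -/
  wA : A → ℕ
  /-- weights of the outward ends -/
  wB : B → ℕ

attribute [instance] EndedDigraph.fintypeV EndedDigraph.fintypeE EndedDigraph.fintypeA
  EndedDigraph.fintypeB EndedDigraph.decEqV

namespace EndedDigraph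

variable (Γ : EndedDigraph)

/-- The number of incoming edges and ends at a vertex. -/
def inDegree (v : Γ.V) : ℕ :=
  (Finset.univ.filter fun e => Γ.head e = v).card + (Finset.univ.filter fun a => Γ.headA a = v).card

/-- The number of outgoing edges and ends at a vertex. -/
def outDegree (v : Γ.V) : ℕ :=
  (Finset.univ.filter fun e => Γ.tail e = v).card + (Finset.univ.filter fun b => Γ.tailB b = v).card

/-- The valence of a vertex. -/
def valence (v : Γ.V) : ℕ := Γ.inDegree v + Γ.outDegree v

/-- The set of the 4-valent vertices. -/
def fourValent : Finset Γ.V := Finset.univ.filter fun v => Γ.valence v = 4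

/-- The underlying simple graph on the inner vertices (used for connectedness). -/
def skeleton : SimpleGraph Γ.V :=
  SimpleGraph.fromRel fun v w => ∃ e, Γ.tail e = v ∧ Γ.head e = w

end EndedDigraph

/-- Twisted monodromy graphs of type `(g, μ, ν)`, with their involution and vertex ordering. -/
structure TwistedMonodromyGraph (g : ℕ) {n : ℕ} (μ ν : n.Partition) extends EndedDigraph where
  /-- the graph is connected -/
  connected : toEndedDigraph.skeleton.Connected
  /-- the first Betti number `1 - #V + #E` is `g` -/
  genus : (1 : ℤ) - Fintype.card V + Fintype.card E = g
  /-- all inner vertices are 3-valent or 4-valent -/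
  valence_eq : ∀ v, toEndedDigraph.valence v = 3 ∨ toEndedDigraph.valence v = 4
  /-- the involution on vertices -/
  iotaV : V → V
  /-- the involution on bounded edges -/
  iotaE : E → E
  /-- the involution on inward ends -/
  iotaA : A → A
  /-- the involution on outward ends -/
  iotaB : B → B
  iotaV_invol : Function.Involutive iotaV
  iotaE_invol : Function.Involutive iotaE
  iotaA_invol : Function.Involutive iotaA
  iotaB_invol : Function.Involutive iotaB
  /-- the involution is an automorphism of the directed graph -/
  tail_iota : ∀ e, tail (iotaE e) = iotaV (tail e)
  head_iota : ∀ e, head (iotaE e) = iotaV (head e)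
  headA_iota : ∀ a, headA (iotaA a) = iotaV (headA a)
  tailB_iota : ∀ c, tailB (iotaB c) = iotaV (tailB c)
  /-- the fixed points of the involution are the 4-valent vertices -/
  iotaV_fixed : ∀ v, iotaV v = v ↔ toEndedDigraph.valence v = 4
  iotaE_ne : ∀ e, iotaE e ≠ e
  iotaA_ne : ∀ a, iotaA a ≠ a
  iotaB_ne : ∀ c, iotaB c ≠ c
  /-- the involution is compatible with the weights -/
  wE_iota : ∀ e, wE (iotaE e) = wE e
  wA_iota : ∀ a, wA (iotaA a) = wA a
  wB_iota : ∀ c, wB (iotaB c) = wB c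
  /-- there are `2ℓ(μ)` inward ends, two of weight `μᵢ` for every part of `μ` -/
  wA_parts : Finset.univ.val.map wA = μ.parts + μ.parts
  /-- there are `2ℓ(ν)` outward ends, two of weight `νⱼ` for every part of `ν` -/
  wB_parts : Finset.univ.val.map wB = ν.parts + ν.parts
  /-- there are no sources -/
  no_source : ∀ v, 0 < toEndedDigraph.inDegree v
  /-- there are no sinks -/
  no_sink : ∀ v, 0 < toEndedDigraph.outDegree v
  /-- the position of a vertex in the vertex ordering, counted from 0 -/
  level : V → ℕ
  /-- exactly the vertices that the involution exchanges share a position -/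
  level_eq : ∀ v w, level v = level w ↔ w = v ∨ w = iotaV v
  /-- the positions are consecutive, starting with 0 -/
  level_consecutive : ∀ v, ∀ i < level v, ∃ w, level w = i
  /-- the ordering is compatible with the directions of the edges -/
  level_lt : ∀ e, level (tail e) < level (head e)
  /-- the weights of the bounded edges are positive -/
  wE_pos : ∀ e, 0 < wE e
  /-- the balancing condition -/
  balanced : ∀ v,
    (∑ e ∈ Finset.univ.filter (fun e => head e = v), wE e) +
      (∑ a ∈ Finset.univ.filter (fun a => headA a = v), wA a) =
    (∑ e ∈ Finset.univ.filter (fun e => tail e = v), wE e) +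
      (∑ c ∈ Finset.univ.filter (fun c => tailB c = v), wB c)
  /-- the four edges at a 4-valent vertex have the same weight -/
  fourValent_weight : ∀ v, toEndedDigraph.valence v = 4 → ∃ m : ℕ,
    (∀ e, head e = v → wE e = m) ∧ (∀ e, tail e = v → wE e = m) ∧
    (∀ a, headA a = v → wA a = m) ∧ (∀ c, tailB c = v → wB c = m)

namespace TwistedHurwitz

section MultisetSums

variable {α β γ : Type*}

open Classical in
/-- The sum of `g a (s - a)` over the elements `a` of the multiset `s`. -/
noncomputable def pickSum (g : α → Multiset α → ℚ) (s : Multiset α) : ℚ :=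
  (s.map fun a => g a (s.erase a)).sum

@[simp]
theorem pickSum_zero (g : α → Multiset α → ℚ) : pickSum g 0 = 0 := by simp [pickSum]

theorem pickSum_cons (g : α → Multiset α → ℚ) (a : α) (s : Multiset α) :
    pickSum g (a ::ₘ s) = g a s + pickSum (fun b r => g b (a ::ₘ r)) s := by
  classical
  simp only [pickSum, Multiset.map_cons, Multiset.sum_cons, Multiset.erase_cons_head]
  congr 2
  refine Multiset.map_congr rfl fun b hb => ?_
  by_cases h : b = a
  · subst h
    rw [Multiset.erase_cons_head, Multiset.cons_erase hb]
  · rw [Multiset.erase_cons_tail _ (Ne.symm h)]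

theorem pickSum_congr {g h : α → Multiset α → ℚ} {s : Multiset α}
    (H : ∀ a r, s = a ::ₘ r → g a r = h a r) : pickSum g s = pickSum h s := by
  classical
  simp only [pickSum]
  congr 1
  exact Multiset.map_congr rfl fun a ha => H _ _ (Multiset.cons_erase ha).symm

theorem pickSum_add (g h : α → Multiset α → ℚ) (s : Multiset α) :
    pickSum (fun a r => g a r + h a r) s = pickSum g s + pickSum h s := by
  classical
  simp [pickSum, Multiset.sum_map_add]

theorem pickSum_mul_left (c : ℚ) (g : α → Multiset α → ℚ) (s : Multiset α) :
    pickSum (fun a r => c * g a r) s = c * pickSum g s := by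
  classical
  simp [pickSum, Multiset.sum_map_mul_left]

theorem pickSum_multiset_sum (m : Multiset β) (g : β → α → Multiset α → ℚ) (s : Multiset α) :
    pickSum (fun a r => (m.map fun b => g b a r).sum) s = (m.map fun b => pickSum (g b) s).sum := by
  induction m using Multiset.induction_on with
  | empty => simp [pickSum]
  | cons b m ih => simp [pickSum_add, ih]

theorem pickSum_sum {ι : Type*} (t : Finset ι) (g : ι → α → Multiset α → ℚ) (s : Multiset α) :
    pickSum (fun a r => ∑ i ∈ t, g i a r) s = ∑ i ∈ t, pickSum (g i) s :=
  pickSum_multiset_sum t.val g s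

theorem pickSum_zero_fun {g : α → Multiset α → ℚ} {s : Multiset α}
    (H : ∀ a r, s = a ::ₘ r → g a r = 0) : pickSum g s = 0 := by
  rw [pickSum_congr H]
  classical
  simp [pickSum]

theorem exists_of_pickSum_ne_zero {g : α → Multiset α → ℚ} {s : Multiset α}
    (H : pickSum g s ≠ 0) : ∃ a r, s = a ::ₘ r ∧ g a r ≠ 0 := by
  by_contra! h
  exact H (pickSum_zero_fun h)

theorem pickSum_map (f : α → β) (g : β → Multiset β → ℚ) (s : Multiset α) :
    pickSum g (s.map f) = pickSum (fun a r => g (f a) (r.map f)) s := by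
  induction s using Multiset.induction_on generalizing g with
  | empty => simp
  | cons a s ih => simp [pickSum_cons, ih]

/-- The sum of `g w` over all multisets `w` that arise from `s` by replacing every element `a` by an
element of `φ a`. -/
noncomputable def colSum (φ : α → Multiset β) (g : Multiset β → ℚ) (s : Multiset α) : ℚ :=
  ((Multiset.Sections (s.map φ)).map g).sum

@[simp]
theorem colSum_zero (φ : α → Multiset β) (g : Multiset β → ℚ) : colSum φ g 0 = g 0 := by
  simp [colSum]

theorem colSum_cons (φ : α → Multiset β) (g : Multiset β → ℚ) (a : α) (s : Multiset α) :
    colSum φ g (a ::ₘ s) = ((φ a).map fun b => colSum φ (fun w => g (b ::ₘ w)) s).sum := by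
  simp [colSum, Multiset.map_bind, Multiset.sum_bind]

theorem colSum_add (φ : α → Multiset β) (g h : Multiset β → ℚ) (s : Multiset α) :
    colSum φ (fun w => g w + h w) s = colSum φ g s + colSum φ h s := by
  simp [colSum, Multiset.sum_map_add]

theorem colSum_mul_left (φ : α → Multiset β) (c : ℚ) (g : Multiset β → ℚ) (s : Multiset α) :
    colSum φ (fun w => c * g w) s = c * colSum φ g s := by
  simp [colSum, Multiset.sum_map_mul_left]

theorem colSum_multiset_sum (φ : α → Multiset β) (m : Multiset γ) (g : γ → Multiset β → ℚ)
    (s : Multiset α) :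
    colSum φ (fun w => (m.map fun b => g b w).sum) s = (m.map fun b => colSum φ (g b) s).sum := by
  induction m using Multiset.induction_on with
  | empty => simp [colSum]
  | cons b m ih => simp [colSum_add, ih]

theorem colSum_sum {ι : Type*} (φ : α → Multiset β) (t : Finset ι) (g : ι → Multiset β → ℚ)
    (s : Multiset α) :
    colSum φ (fun w => ∑ i ∈ t, g i w) s = ∑ i ∈ t, colSum φ (g i) s :=
  colSum_multiset_sum φ t.val g s

theorem colSum_congr {φ : α → Multiset β} {g h : Multiset β → ℚ} {s : Multiset α}
    (H : ∀ w ∈ Multiset.Sections (s.map φ), g w = h w) : colSum φ g s = colSum φ h s := by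
  rw [colSum, colSum, Multiset.map_congr rfl H]

theorem exists_of_colSum_ne_zero {φ : α → Multiset β} {g : Multiset β → ℚ} {s : Multiset α}
    (H : colSum φ g s ≠ 0) : ∃ w ∈ Multiset.Sections (s.map φ), g w ≠ 0 := by
  by_contra! h
  refine H ?_
  rw [colSum_congr h]
  simp [colSum]

theorem colSum_map (f : α → γ) (f' : β → γ) {φ : α → Multiset β} {ψ : γ → Multiset γ}
    (h : ∀ a, ψ (f a) = (φ a).map f') (g : Multiset γ → ℚ) (s : Multiset α) :
    colSum ψ g (s.map f) = colSum φ (fun w => g (w.map f')) s := by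
  induction s using Multiset.induction_on generalizing g with
  | empty => simp
  | cons a s ih => simp [colSum_cons, ih, h]

theorem colSum_colSum (φ : α → Multiset β) (ψ : β → Multiset γ) (g : Multiset γ → ℚ)
    (s : Multiset α) :
    colSum φ (colSum ψ g) s = colSum (fun a => (φ a).bind ψ) g s := by
  induction s using Multiset.induction_on generalizing g with
  | empty => simp
  | cons a s ih =>
    simp only [colSum_cons, colSum_multiset_sum, ih, Multiset.map_bind, Multiset.sum_bind]

/-- Picking an element and then replacing all elements is the same as replacing all elements and
then picking one. -/
theorem pickSum_colSum (φ : α → Multiset β) (g : β → Multiset β → ℚ) (s : Multiset α) :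
    pickSum (fun a r => ((φ a).map fun b => colSum φ (g b) r).sum) s =
      colSum φ (pickSum g) s := by
  induction s using Multiset.induction_on generalizing g with
  | empty => simp
  | cons a s ih =>
    have key : ∀ b, colSum φ (fun w => pickSum g (b ::ₘ w)) s =
        colSum φ (g b) s +
          pickSum (fun a' r => ((φ a').map fun b' => colSum φ (fun w => g b' (b ::ₘ w)) r).sum)
            s := by
      intro b
      simp only [pickSum_cons, colSum_add]
      rw [ih]
    rw [pickSum_cons, colSum_cons]
    simp only [key, Multiset.sum_map_add]
    congr 1
    rw [← pickSum_multiset_sum]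
    refine pickSum_congr fun a' r _ => ?_
    simp only [colSum_cons]
    rw [Multiset.sum_map_sum_map]

/-- Replacing by elements that map back to the original ones. -/
theorem map_of_mem_sections {φ : α → Multiset β} {f : β → α} (h : ∀ a, ∀ b ∈ φ a, f b = a)
    {s : Multiset α} {w : Multiset β} (hw : w ∈ Multiset.Sections (s.map φ)) : w.map f = s := by
  induction s using Multiset.induction_on generalizing w with
  | empty => simpa using hw
  | cons a s ih =>
    simp only [Multiset.map_cons, Multiset.sections_cons, Multiset.mem_bind,
      Multiset.mem_map] at hw
    obtain ⟨b, hb, w', hw', rfl⟩ := hw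
    rw [Multiset.map_cons, h a b hb, ih hw']

end MultisetSums

end TwistedHurwitz

namespace TwistedHurwitz

/-- The twisted cut-and-join operator on functions of partitions. -/
noncomputable def cutJoin (f : Multiset ℕ → ℚ) : Multiset ℕ → ℚ :=
  pickSum fun i r => i * (pickSum (fun j r' => 2 * j * f ((i + j) ::ₘ r')) r +
    ∑ p ∈ Finset.Ioo 0 i, f (p ::ₘ (i - p) ::ₘ r) + ((i : ℚ) - 1) * f (i ::ₘ r))

section Coloured

variable {ι : Type*} [DecidableEq ι]

/-- The elements of colour `J` get one of the colours `K` and `J \ K`, while these colours must not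
occur before. -/
def recolour {α : Type*} (J K : Finset ι) (a : α × Finset ι) : Multiset (α × Finset ι) :=
  if a.2 = J then {(a.1, K), (a.1, J \ K)} else if a.2 = K ∨ a.2 = J \ K then 0 else {a}

/-- The cut-and-join operator on functions of coloured partitions. Parts of different colours cannot
be joined, and a cut may split the colour. -/
noncomputable def colCutJoin (g : Multiset (ℕ × Finset ι) → ℚ) : Multiset (ℕ × Finset ι) → ℚ :=
  pickSum fun a r => a.1 *
    (pickSum (fun b r' => if b.2 = a.2 then 2 * b.1 * g ((a.1 + b.1, a.2) ::ₘ r') else 0) r +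
    ∑ p ∈ Finset.Ioo 0 a.1, g ((p, a.2) ::ₘ (a.1 - p, a.2) ::ₘ r) +
    ∑ K ∈ a.2.ssubsets.erase ∅, ∑ p ∈ Finset.Ioo 0 a.1,
      colSum (recolour a.2 K) (fun r' => g ((p, K) ::ₘ (a.1 - p, a.2 \ K) ::ₘ r')) r +
    ((a.1 : ℚ) - 1) * g (a ::ₘ r))

/-- The colours that occur are nonempty and pairwise equal or disjoint. -/
def Admissible {α : Type*} (w : Multiset (α × Finset ι)) : Prop :=
  (∀ a ∈ w, a.2.Nonempty) ∧ ∀ a ∈ w, ∀ b ∈ w, a.2 = b.2 ∨ Disjoint a.2 b.2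

variable [Fintype ι]

/-- All colourings of a part. -/
def colourings (i : ℕ) : Multiset (ℕ × Finset ι) := Finset.univ.val.map fun J => (i, J)

omit [DecidableEq ι] in
theorem colourings_sum (i : ℕ) (h : ℕ × Finset ι → ℚ) :
    ((colourings i).map h).sum = ∑ J, h (i, J) := by
  simp [colourings]

theorem colourings_bind_recolour {J K : Finset ι} (hK : K ⊂ J) (hK0 : K.Nonempty) (i : ℕ) :
    (colourings i).bind (recolour J K) =
      (Finset.univ.erase J).val.map fun L => ((i, L) : ℕ × Finset ι) := by
  have hKJ : K ≠ J := hK.ne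
  have hd0 : (J \ K).Nonempty := Finset.sdiff_nonempty.2 hK.2
  have hKd : K ≠ J \ K := by
    intro h
    have : Disjoint K K := by
      nth_rewrite 2 [h]
      exact Finset.disjoint_sdiff
    exact hK0.ne_empty (Finset.disjoint_self_iff_empty _ |>.1 this)
  have hdJ : J \ K ≠ J := by
    intro h
    rw [Finset.sdiff_eq_self_iff_disjoint] at h
    exact hK0.ne_empty (Finset.disjoint_self_iff_empty _ |>.1 (h.mono_left hK.1))
  obtain ⟨T, hT1, hT2, hT⟩ : ∃ T : Multiset (Finset ι),
      (Finset.univ : Finset (Finset ι)).val = J ::ₘ K ::ₘ (J \ K) ::ₘ T ∧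
      (Finset.univ.erase J : Finset (Finset ι)).val = K ::ₘ (J \ K) ::ₘ T ∧
      ∀ L ∈ T, L ≠ J \ K ∧ L ≠ K ∧ L ≠ J := by
    have h1 : K ∈ Finset.univ.erase J := by simp [hKJ]
    have h2 : J \ K ∈ (Finset.univ.erase J).erase K := by simp only [Finset.mem_erase]; simp [hKd.symm, hdJ]
    have ev : ∀ (A : Finset (Finset ι)) (x), x ∈ A → A.val = x ::ₘ (A.erase x).val := by
      intro A x hx
      rw [Finset.erase_val, Multiset.cons_erase hx]
    refine ⟨(((Finset.univ.erase J).erase K).erase (J \ K)).val, ?_, ?_, ?_⟩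
    · rw [ev _ J (Finset.mem_univ J), ev _ K h1, ev _ _ h2]
    · rw [ev _ K h1, ev _ _ h2]
    · intro L hL
      rw [Finset.mem_val, Finset.mem_erase, Finset.mem_erase, Finset.mem_erase] at hL
      exact ⟨hL.1, hL.2.1, hL.2.2.1⟩
  rw [colourings, hT1, hT2]
  simp only [Multiset.map_cons, Multiset.cons_bind]
  have e1 : recolour J K ((i, J) : ℕ × Finset ι) = {(i, K), (i, J \ K)} := by simp [recolour]
  have e2 : recolour J K ((i, K) : ℕ × Finset ι) = 0 := by simp [recolour, hKJ]
  have e3 : recolour J K ((i, J \ K) : ℕ × Finset ι) = 0 := by simp [recolour, hdJ]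
  rw [e1, e2, e3, Multiset.bind_map]
  have e4 : T.bind (fun L => recolour J K ((i, L) : ℕ × Finset ι)) =
      T.bind (fun L => {((i, L) : ℕ × Finset ι)}) := by
    refine Multiset.bind_congr fun L hL => ?_
    simp [recolour, hT L hL]
  rw [e4, Multiset.bind_singleton, zero_add, zero_add]
  simp [Multiset.insert_eq_cons]

theorem colSum_erase {J : Finset ι} {g : Multiset (ℕ × Finset ι) → ℚ}
    (hg : ∀ w, (∃ a ∈ w, a.2 = J) → g w = 0) (s : Multiset ℕ) :
    colSum (fun i => (Finset.univ.erase J).val.map fun L => ((i, L) : ℕ × Finset ι)) g s =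
      colSum colourings g s := by
  induction s using Multiset.induction_on generalizing g with
  | empty => simp
  | cons i s ih =>
    rw [colSum_cons, colSum_cons, colourings_sum]
    rw [← Finset.add_sum_erase _ _ (Finset.mem_univ J)]
    have h0 : colSum colourings (fun w => g ((i, J) ::ₘ w)) s = 0 := by
      rw [colSum_congr (h := fun _ => 0) fun w _ => hg _ ⟨(i, J), by simp, rfl⟩]
      simp [colSum]
    rw [h0, zero_add, Multiset.map_map]
    refine Finset.sum_congr rfl fun L _ => ?_
    exact ih fun w ⟨a, ha, h⟩ => hg _ ⟨a, by simp [ha], h⟩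

/-- A sum over ordered pairs of colours, for a function that vanishes unless the colours are nonempty
and equal or disjoint. -/
theorem sum_pairs_eq {F : Finset ι → Finset ι → ℚ}
    (hF : ∀ K L, F K L ≠ 0 → K.Nonempty ∧ L.Nonempty ∧ (K = L ∨ Disjoint K L)) :
    ∑ K, ∑ L, F K L = ∑ J, (F J J + ∑ K ∈ J.ssubsets.erase ∅, F K (J \ K)) := by
  have h1 : ∀ K, ∑ L, F K L = F K K + ∑ L ∈ Finset.univ.erase K, F K L := fun K =>
    (Finset.add_sum_erase _ _ (Finset.mem_univ K)).symm
  simp only [h1, Finset.sum_add_distrib]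
  congr 1
  rw [Finset.sum_sigma', Finset.sum_sigma']
  symm
  refine Finset.sum_bij_ne_zero (fun p _ _ => ⟨p.2, p.1 \ p.2⟩) ?_ ?_ ?_ ?_
  · rintro ⟨J, K⟩ h h0
    simp only [Finset.mem_sigma, Finset.mem_univ, true_and, Finset.mem_erase, ne_eq, and_true]
    intro h'
    have := hF _ _ h0
    have hd : Disjoint K (J \ K) := Finset.disjoint_sdiff
    rw [h'] at hd
    exact this.1.ne_empty (Finset.disjoint_self_iff_empty _ |>.1 hd)
  · rintro ⟨J, K⟩ h h0 ⟨J', K'⟩ h' h0' he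
    simp only [Finset.mem_sigma, Finset.mem_univ, true_and, Finset.mem_erase,
      Finset.mem_ssubsets] at h h'
    simp only [Sigma.mk.injEq, heq_eq_eq] at he
    obtain ⟨rfl, h2⟩ := he
    have : J = J' := by
      rw [← Finset.union_sdiff_of_subset h.2.1, h2, Finset.union_sdiff_of_subset h'.2.1]
    subst this
    rfl
  · rintro ⟨K, L⟩ h h0
    have hn := hF _ _ h0
    have hd : Disjoint K L := hn.2.2.resolve_left (by
      simp at h; exact fun e => h e.symm)
    refine ⟨⟨K ∪ L, K⟩, ?_, ?_, ?_⟩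
    · simp only [Finset.mem_sigma, Finset.mem_univ, true_and, Finset.mem_erase,
        Finset.mem_ssubsets]
      refine ⟨hn.1.ne_empty, Finset.subset_union_left, fun hs => ?_⟩
      have hLK : L ⊆ K := Finset.subset_union_right.trans hs
      exact hn.2.1.ne_empty (Finset.disjoint_self_iff_empty _ |>.1 (hd.mono_left hLK))
    · simpa [Finset.union_sdiff_cancel_left hd] using h0
    · simp [Finset.union_sdiff_cancel_left hd]
  · rintro ⟨J, K⟩ h h0
    rfl

/-- The cut-and-join operator is compatible with summing over all colourings. -/
theorem cutJoin_colSum {g : Multiset (ℕ × Finset ι) → ℚ} (hg : ∀ w, g w ≠ 0 → Admissible w) :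
    cutJoin (colSum colourings g) = colSum colourings (colCutJoin g) := by
  funext s
  rw [cutJoin, colCutJoin, ← pickSum_colSum]
  refine pickSum_congr fun i r _ => ?_
  rw [colourings_sum]
  simp only [colSum_mul_left, colSum_add, ← Finset.mul_sum, Finset.sum_add_distrib]
  congr 1
  rw [add_assoc (∑ J, _)]
  congr 1
  · congr 1
    · simp only [← pickSum_colSum]
      rw [← pickSum_sum]
      refine pickSum_congr fun j r' _ => ?_
      simp only [colourings_sum, colSum_cons]
      rw [Finset.mul_sum]
      refine Finset.sum_congr rfl fun J _ => ?_
      rw [Finset.sum_eq_single J]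
      · simp [colSum_mul_left]
      · intro J' _ h
        simp [h, colSum]
      · simp
    · rw [← Finset.sum_add_distrib]
      simp only [colSum_sum]
      have hJ : ∀ J : Finset ι, (∑ p ∈ Finset.Ioo 0 i,
            colSum colourings (fun w => g ((p, J) ::ₘ (i - p, J) ::ₘ w)) r) +
          ∑ K ∈ J.ssubsets.erase ∅, ∑ p ∈ Finset.Ioo 0 i, colSum colourings (fun w =>
            colSum (recolour J K) (fun r' => g ((p, K) ::ₘ (i - p, J \ K) ::ₘ r')) w) r =
          ∑ p ∈ Finset.Ioo 0 i, (colSum colourings (fun w => g ((p, J) ::ₘ (i - p, J) ::ₘ w)) r +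
            ∑ K ∈ J.ssubsets.erase ∅,
              colSum colourings (fun w => g ((p, K) ::ₘ (i - p, J \ K) ::ₘ w)) r) := by
        intro J
        rw [Finset.sum_add_distrib]
        congr 1
        rw [Finset.sum_comm]
        refine Finset.sum_congr rfl fun p _ => Finset.sum_congr rfl fun K hK => ?_
        rw [Finset.mem_erase, Finset.mem_ssubsets] at hK
        have hK0 := Finset.nonempty_iff_ne_empty.2 hK.1
        have h1 := colSum_colSum colourings (recolour J K)
          (fun r' => g ((p, K) ::ₘ (i - p, J \ K) ::ₘ r')) r
        rw [h1]
        simp only [colourings_bind_recolour hK.2 hK0]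
        refine colSum_erase ?_ r
        rintro w ⟨a, ha, rfl⟩
        by_contra h
        have h2 := (hg _ h).2 (p, K) (by simp) a (by simp [ha])
        rcases h2 with h2 | h2
        · exact hK.2.ne h2
        · exact hK.1 (Finset.disjoint_self_iff_empty _ |>.1 (h2.mono_right hK.2.1))
      simp only [hJ]
      rw [Finset.sum_comm]
      refine Finset.sum_congr rfl fun p _ => ?_
      rw [← sum_pairs_eq (F := fun K L =>
        colSum colourings (fun w => g ((p, K) ::ₘ (i - p, L) ::ₘ w)) r)]
      · simp only [colSum_cons, colourings_sum]
      · intro K L h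
        obtain ⟨w, -, hw⟩ := exists_of_colSum_ne_zero h
        have h1 := hg _ hw
        exact ⟨h1.1 (p, K) (by simp), h1.1 (i - p, L) (by simp),
          h1.2 (p, K) (by simp) (i - p, L) (by simp)⟩
  · simp only [colSum_cons, colourings_sum, Finset.mul_sum]

end Coloured

end TwistedHurwitz

namespace TwistedHurwitz

section Support

variable {ι : Type*} [DecidableEq ι] {α : Type*}

/-- The parts of colour `J`. -/
def items (J : Finset ι) (w : Multiset (α × Finset ι)) : Multiset α :=
  (w.filter fun a => a.2 = J).map Prod.fst

@[simp]
theorem items_cons (J : Finset ι) (a : α × Finset ι) (w : Multiset (α × Finset ι)) :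
    items J (a ::ₘ w) = if a.2 = J then a.1 ::ₘ items J w else items J w := by
  unfold items
  split_ifs with h <;> simp [h]

theorem mem_items {J : Finset ι} {w : Multiset (α × Finset ι)} {x : α} :
    x ∈ items J w ↔ (x, J) ∈ w := by
  simp only [items, Multiset.mem_map, Multiset.mem_filter]
  constructor
  · rintro ⟨⟨a, b⟩, ⟨h, rfl⟩, rfl⟩
    exact h
  · intro h
    exact ⟨_, ⟨h, rfl⟩, rfl⟩

/-- The colours that occur. -/
def colours (w : Multiset (α × Finset ι)) : Finset (Finset ι) := (w.map Prod.snd).toFinset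

theorem mem_colours {J : Finset ι} {w : Multiset (α × Finset ι)} :
    J ∈ colours w ↔ ∃ a ∈ w, a.2 = J := by
  simp [colours]

@[simp]
theorem colours_cons (a : α × Finset ι) (w : Multiset (α × Finset ι)) :
    colours (a ::ₘ w) = insert a.2 (colours w) := by
  simp [colours]

theorem recolour_induction {J K : Finset ι}
    {P : Multiset (α × Finset ι) → Multiset (α × Finset ι) → Prop} (h0 : P 0 0)
    (h1 : ∀ x r r', P r r' → P ((x, J) ::ₘ r) ((x, K) ::ₘ r'))
    (h2 : ∀ x r r', P r r' → P ((x, J) ::ₘ r) ((x, J \ K) ::ₘ r'))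
    (h3 : ∀ a r r', a.2 ≠ J → a.2 ≠ K → a.2 ≠ J \ K → P r r' → P (a ::ₘ r) (a ::ₘ r'))
    {r r' : Multiset (α × Finset ι)} (h : r' ∈ Multiset.Sections (r.map (recolour J K))) :
    P r r' := by
  induction r using Multiset.induction_on generalizing r' with
  | empty =>
    rw [Multiset.map_zero, Multiset.sections_zero, Multiset.mem_singleton] at h
    rwa [h]
  | cons a r ih =>
    rw [Multiset.map_cons, Multiset.sections_cons, Multiset.mem_bind] at h
    obtain ⟨b, hb, h⟩ := h
    obtain ⟨r'', hr, rfl⟩ := Multiset.mem_map.1 h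
    obtain ⟨x, L⟩ := a
    unfold recolour at hb
    split_ifs at hb with c1 c2
    · simp only at c1
      subst c1
      simp only [Multiset.insert_eq_cons, Multiset.mem_cons, Multiset.mem_singleton] at hb
      rcases hb with rfl | rfl
      · exact h1 _ _ _ (ih hr)
      · exact h2 _ _ _ (ih hr)
    · simp at hb
    · rw [Multiset.mem_singleton] at hb
      subst hb
      rw [not_or] at c2
      exact h3 _ _ _ c1 c2.1 c2.2 (ih hr)

section Recoloured

variable {J K : Finset ι} {r r' : Multiset (α × Finset ι)}

theorem card_of_recoloured (h : r' ∈ Multiset.Sections (r.map (recolour J K))) :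
    r'.card = r.card := by
  refine recolour_induction (P := fun r r' => r'.card = r.card) rfl ?_ ?_ ?_ h <;>
    simp +contextual

theorem map_fst_of_recoloured (h : r' ∈ Multiset.Sections (r.map (recolour J K))) :
    r'.map Prod.fst = r.map Prod.fst := by
  refine recolour_induction (P := fun r r' => r'.map Prod.fst = r.map Prod.fst) rfl ?_ ?_ ?_ h <;>
    simp +contextual

theorem ne_of_proper (hK : K ⊂ J) (hK0 : K.Nonempty) : K ≠ J ∧ J \ K ≠ J ∧ K ≠ J \ K := by
  refine ⟨hK.ne, fun h => ?_, fun h => ?_⟩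
  · rw [Finset.sdiff_eq_self_iff_disjoint] at h
    exact hK0.ne_empty (Finset.disjoint_self_iff_empty _ |>.1 (h.mono_left hK.1))
  · have : Disjoint K K := by
      nth_rewrite 2 [h]
      exact Finset.disjoint_sdiff
    exact hK0.ne_empty (Finset.disjoint_self_iff_empty _ |>.1 this)

theorem items_of_recoloured (hK : K ⊂ J) (hK0 : K.Nonempty)
    (h : r' ∈ Multiset.Sections (r.map (recolour J K))) :
    items J r = items K r' + items (J \ K) r' := by
  obtain ⟨e1, e2, e3⟩ := ne_of_proper hK hK0
  refine recolour_induction (P := fun r r' => items J r = items K r' + items (J \ K) r')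
    rfl ?_ ?_ ?_ h
  · intro x r r' h; simp [e3, h]
  · intro x r r' h; simp [e3.symm, h]
  · intro x r r' a1 a2 a3 h; simp [a1, a2, a3, h]

theorem items_of_recoloured_of_ne {L : Finset ι} (h1 : L ≠ J) (h2 : L ≠ K) (h3 : L ≠ J \ K)
    (h : r' ∈ Multiset.Sections (r.map (recolour J K))) : items L r = items L r' := by
  refine recolour_induction (P := fun r r' => items L r = items L r')
    rfl ?_ ?_ ?_ h
  · intro x r r' h; simp [h1.symm, h2.symm, h]
  · intro x r r' h; simp [h1.symm, h3.symm, h]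
  · intro x r r' a1 a2 a3 h; simp [h]

theorem colour_of_mem_recoloured (hK : K ⊂ J) (hK0 : K.Nonempty)
    (h : r' ∈ Multiset.Sections (r.map (recolour J K))) :
    ∀ b ∈ r', b.2 = K ∨ b.2 = J \ K ∨ b.2 ≠ J ∧ b ∈ r := by
  obtain ⟨e1, e2, e3⟩ := ne_of_proper hK hK0
  refine recolour_induction
    (P := fun r r' => ∀ b ∈ r', b.2 = K ∨ b.2 = J \ K ∨ b.2 ≠ J ∧ b ∈ r) (by simp) ?_ ?_ ?_ h
  all_goals
    intros
    simp only [Multiset.mem_cons] at *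
    grind

theorem exists_mem_recoloured (h : r' ∈ Multiset.Sections (r.map (recolour J K))) :
    ∀ a ∈ r, a.2 = J ∨ a.2 ≠ K ∧ a.2 ≠ J \ K ∧ a ∈ r' := by
  refine recolour_induction
    (P := fun r r' => ∀ a ∈ r, a.2 = J ∨ a.2 ≠ K ∧ a.2 ≠ J \ K ∧ a ∈ r') (by simp) ?_ ?_ ?_ h
  all_goals
    intros
    simp only [Multiset.mem_cons] at *
    grind

end Recoloured

/-- One step of a coloured cut-and-join process. -/
inductive Step : Multiset (ℕ × Finset ι) → Multiset (ℕ × Finset ι) → Prop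
  | join (i j : ℕ) (J : Finset ι) (r : Multiset (ℕ × Finset ι)) :
      Step ((i, J) ::ₘ (j, J) ::ₘ r) ((i + j, J) ::ₘ r)
  | cut (i p : ℕ) (J : Finset ι) (r : Multiset (ℕ × Finset ι)) : 0 < p → p < i →
      Step ((i, J) ::ₘ r) ((p, J) ::ₘ (i - p, J) ::ₘ r)
  | split (i p : ℕ) (J K : Finset ι) (r r' : Multiset (ℕ × Finset ι)) : 0 < p → p < i →
      K ⊂ J → K.Nonempty → r' ∈ Multiset.Sections (r.map (recolour J K)) →
      Step ((i, J) ::ₘ r) ((p, K) ::ₘ (i - p, J \ K) ::ₘ r')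
  | stay (w : Multiset (ℕ × Finset ι)) : Step w w

theorem exists_step {g : Multiset (ℕ × Finset ι) → ℚ} {w : Multiset (ℕ × Finset ι)}
    (h : colCutJoin g w ≠ 0) : ∃ w', Step w w' ∧ g w' ≠ 0 := by
  obtain ⟨⟨i, J⟩, r, rfl, h0⟩ := exists_of_pickSum_ne_zero h
  replace h := right_ne_zero_of_mul h0
  by_contra! hw
  refine h ?_
  rw [pickSum_zero_fun, Finset.sum_eq_zero, Finset.sum_eq_zero, hw _ (Step.stay _)]
  · simp
  · intro K hK
    rw [Finset.mem_erase, Finset.mem_ssubsets] at hK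
    refine Finset.sum_eq_zero fun p hp => ?_
    rw [Finset.mem_Ioo] at hp
    by_contra h0
    obtain ⟨r', hr', h0⟩ := exists_of_colSum_ne_zero h0
    exact h0 (hw _ (Step.split i p J K r r' hp.1 hp.2 hK.2 (Finset.nonempty_iff_ne_empty.2 hK.1)
      hr'))
  · intro p hp
    rw [Finset.mem_Ioo] at hp
    exact hw _ (Step.cut i p J r hp.1 hp.2)
  · rintro ⟨j, L⟩ r' rfl
    split_ifs with hL
    · simp only at hL
      subst hL
      rw [hw _ (Step.join i j L r'), mul_zero]
    · rfl

/-- An admissible coloured partition is balanced if the parts of every colour `J` that occurs add up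
to the sum of the `y j` for `j` in `J`. -/
def Balanced (y : ι → ℕ) (w : Multiset (ℕ × Finset ι)) : Prop :=
  Admissible w ∧ ∀ a ∈ w, (items a.2 w).sum = ∑ j ∈ a.2, y j

theorem Balanced.of_step {y : ι → ℕ} {w w' : Multiset (ℕ × Finset ι)} (hs : Step w w')
    (h : Balanced y w') : Balanced y w := by
  obtain ⟨⟨hn, hd⟩, hb⟩ := h
  cases hs with
  | stay => exact ⟨⟨hn, hd⟩, hb⟩
  | join i j J r =>
    simp only [Multiset.mem_cons, forall_eq_or_imp, items_cons, if_true] at hn hd hb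
    refine ⟨⟨?_, ?_⟩, ?_⟩
    · simp only [Multiset.mem_cons, forall_eq_or_imp]
      exact ⟨hn.1, hn.1, hn.2⟩
    · simp only [Multiset.mem_cons, forall_eq_or_imp]
      exact ⟨⟨by simp, by simp, hd.1.2⟩, ⟨by simp, by simp, hd.1.2⟩,
        fun a ha => ⟨(hd.2 a ha).1, (hd.2 a ha).1, (hd.2 a ha).2⟩⟩
    · simp only [Multiset.mem_cons, forall_eq_or_imp, items_cons, if_true, Multiset.sum_cons]
      rw [Multiset.sum_cons, add_assoc] at hb
      refine ⟨hb.1, hb.1, fun a ha => ?_⟩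
      have := hb.2 a ha
      split_ifs at this ⊢ <;> simp_all [add_assoc]
  | cut i p J r hp hpi =>
    simp only [Multiset.mem_cons, forall_eq_or_imp, items_cons, if_true] at hn hd hb
    refine ⟨⟨?_, ?_⟩, ?_⟩
    · simp only [Multiset.mem_cons, forall_eq_or_imp]
      exact ⟨hn.1, hn.2.2⟩
    · simp only [Multiset.mem_cons, forall_eq_or_imp]
      exact ⟨⟨by simp, hd.1.2.2⟩, fun a ha => ⟨(hd.2.2 a ha).1, (hd.2.2 a ha).2.2⟩⟩
    · simp only [Multiset.mem_cons, forall_eq_or_imp, items_cons, if_true, Multiset.sum_cons]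
      refine ⟨?_, fun a ha => ?_⟩
      · have := hb.1
        simp only [Multiset.sum_cons] at this
        omega
      · have := hb.2.2 a ha
        split_ifs at this ⊢
        · simp only [Multiset.sum_cons] at this ⊢
          omega
        · exact this
  | split i p J K r r' hp hpi hK hK0 hr' =>
    obtain ⟨e1, e2, e3⟩ := ne_of_proper hK hK0
    have hr := exists_mem_recoloured hr'
    have hU : K ∪ (J \ K) = J := Finset.union_sdiff_of_subset hK.1
    simp only [Multiset.mem_cons, forall_eq_or_imp, items_cons, if_true] at hn hd hb
    have hdJ : ∀ a ∈ r, J = a.2 ∨ Disjoint J a.2 := by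
      intro a ha
      rcases hr a ha with h | ⟨h1, h2, h3⟩
      · exact .inl h.symm
      · right
        rw [← hU, Finset.disjoint_union_left]
        exact ⟨(hd.1.2.2 a h3).resolve_left (Ne.symm h1),
          (hd.2.1.2.2 a h3).resolve_left (Ne.symm h2)⟩
    refine ⟨⟨?_, ?_⟩, ?_⟩
    · simp only [Multiset.mem_cons, forall_eq_or_imp]
      refine ⟨hK0.mono hK.1, fun a ha => ?_⟩
      rcases hr a ha with h | h
      · rw [h]; exact hK0.mono hK.1
      · exact hn.2.2 a h.2.2
    · simp only [Multiset.mem_cons, forall_eq_or_imp]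
      refine ⟨⟨by simp, hdJ⟩, fun a ha => ⟨?_, fun b hb => ?_⟩⟩
      · rcases hdJ a ha with h | h
        · exact .inl h.symm
        · exact .inr h.symm
      · rcases hr a ha with h | h
        · rw [h]; exact hdJ b hb
        · rcases hr b hb with h' | h'
          · rw [h']
            rcases hdJ a ha with h | h
            · exact .inl h.symm
            · exact .inr h.symm
          · exact (hd.2.2 a h.2.2).2.2 b h'.2.2
    · have hJ : i + (items J r).sum = ∑ j ∈ J, y j := by
        have h1 := hb.1
        have h2 := hb.2.1
        rw [if_neg e3.symm, Multiset.sum_cons] at h1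
        rw [if_neg e3, Multiset.sum_cons] at h2
        rw [items_of_recoloured hK hK0 hr', Multiset.sum_add, ← Finset.sum_sdiff hK.1]
        omega
      simp only [Multiset.mem_cons, forall_eq_or_imp, items_cons, if_true, Multiset.sum_cons]
      refine ⟨hJ, fun a ha => ?_⟩
      rcases hr a ha with h | ⟨h1, h2, h3⟩
      · rw [h, if_pos rfl, Multiset.sum_cons, hJ]
      · have := hb.2.2 a h3
        rw [if_neg h1.symm, if_neg h2.symm] at this
        by_cases h : a.2 = J
        · rw [h, if_pos rfl, Multiset.sum_cons, hJ]
        · rw [if_neg (Ne.symm h), items_of_recoloured_of_ne h h1 h2 hr', this]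

theorem Step.card_le {w w' : Multiset (ℕ × Finset ι)} (hs : Step w w') :
    w.card + 2 * (colours w').card ≤ w'.card + 1 + 2 * (colours w).card := by
  cases hs with
  | stay => omega
  | join i j J r => simp
  | cut i p J r hp hpi => simp
  | split i p J K r r' hp hpi hK hK0 hr' =>
    have h1 := card_of_recoloured hr'
    have h2 : colours ((p, K) ::ₘ (i - p, J \ K) ::ₘ r') ⊆
        insert K (insert (J \ K) ((colours ((i, J) ::ₘ r)).erase J)) := by
      intro L hL
      obtain ⟨a, ha, rfl⟩ := mem_colours.1 hL
      simp only [Multiset.mem_cons] at ha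
      rcases ha with rfl | rfl | ha
      · simp
      · simp
      · rcases colour_of_mem_recoloured hK hK0 hr' a ha with h | h | ⟨h, h'⟩
        · simp [h]
        · simp [h]
        · have : a.2 ∈ colours r := mem_colours.2 ⟨a, h', rfl⟩
          simp [h, this]
    have h3 := (Finset.card_le_card h2).trans ((Finset.card_insert_le _ _).trans
      (Nat.succ_le_succ (Finset.card_insert_le _ _)))
    have h4 : ((colours ((i, J) ::ₘ r)).erase J).card + 1 = (colours ((i, J) ::ₘ r)).card :=
      Finset.card_erase_add_one (by simp)
    simp only [Multiset.card_cons] at *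
    omega

variable [Fintype ι]

/-- The coloured partition with parts `y j`, all of them with different colours `{j}`. -/
def target (y : ι → ℕ) : Multiset (ℕ × Finset ι) := Finset.univ.val.map fun j => (y j, {j})

open Classical in
/-- The weighted number of coloured cut-and-join processes with `m` steps that end at `target y`. -/
noncomputable def colCount (y : ι → ℕ) : ℕ → Multiset (ℕ × Finset ι) → ℚ
  | 0 => fun w => if w = target y then 1 else 0
  | m + 1 => colCutJoin (colCount y m)

theorem balanced_target (y : ι → ℕ) : Balanced y (target y) := by
  refine ⟨⟨?_, ?_⟩, ?_⟩
  · simp [target]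
  · simp [target]
    intro i j
    tauto
  · intro a ha
    obtain ⟨j, -, rfl⟩ := Multiset.mem_map.1 ha
    have : items {j} (target y) = {y j} := by
      rw [items, target, Multiset.filter_map, Multiset.map_map]
      have : Finset.univ.val.filter ((fun a : ℕ × Finset ι => a.2 = {j}) ∘ fun j => (y j, {j})) =
          {j} := by
        simp only [Function.comp_def, Finset.singleton_inj]
        rw [← Finset.filter_val, Finset.filter_eq']
        simp
      rw [this]
      simp
    simp [this]

theorem balanced_of_colCount_ne_zero {y : ι → ℕ} {m : ℕ} {w : Multiset (ℕ × Finset ι)}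
    (h : colCount y m w ≠ 0) : Balanced y w := by
  induction m generalizing w with
  | zero =>
    simp only [colCount, ne_eq, ite_eq_right_iff, one_ne_zero, imp_false, not_not] at h
    rw [h]
    exact balanced_target y
  | succ m ih =>
    obtain ⟨w', hs, h⟩ := exists_step h
    exact (ih h).of_step hs

theorem card_le_of_colCount_ne_zero {y : ι → ℕ} {m : ℕ} {w : Multiset (ℕ × Finset ι)}
    (h : colCount y m w ≠ 0) : w.card + Fintype.card ι ≤ m + 2 * (colours w).card := by
  induction m generalizing w with
  | zero =>
    simp only [colCount, ne_eq, ite_eq_right_iff, one_ne_zero, imp_false, not_not] at h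
    rw [h]
    have : (colours (target y)).card = Fintype.card ι := by
      rw [colours, target, Multiset.map_map]
      have : (Multiset.map (Prod.snd ∘ fun j => (y j, ({j} : Finset ι))) Finset.univ.val).toFinset
          = Finset.univ.image fun j => ({j} : Finset ι) := rfl
      rw [this, Finset.card_image_of_injective _ Finset.singleton_injective, Finset.card_univ]
    rw [this, target, Multiset.card_map, Finset.card_val, Finset.card_univ]
    omega
  | succ m ih =>
    obtain ⟨w', hs, h⟩ := exists_step h
    have := ih h
    have := hs.card_le
    omega

theorem cutJoin_iterate_colSum (y : ι → ℕ) (m : ℕ) :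
    cutJoin^[m] (colSum colourings (colCount y 0)) = colSum colourings (colCount y m) := by
  induction m with
  | zero => rfl
  | succ m ih =>
    rw [Function.iterate_succ_apply', ih, cutJoin_colSum]
    · rfl
    · exact fun w h => (balanced_of_colCount_ne_zero h).1

end Support

end TwistedHurwitz

namespace TwistedHurwitz

theorem map_univ_succ {α : Type*} {k : ℕ} (f : Fin (k + 1) → α) :
    (Finset.univ : Finset (Fin (k + 1))).val.map f =
      f 0 ::ₘ (Finset.univ : Finset (Fin k)).val.map fun i => f i.succ := by
  rw [Fin.univ_val_map, Fin.univ_val_map, List.ofFn_succ]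
  rfl

theorem sum_fin_succ_fun {α M : Type*} [Fintype α] [AddCommMonoid M] {k : ℕ}
    (F : (Fin (k + 1) → α) → M) : ∑ χ, F χ = ∑ a, ∑ χ : Fin k → α, F (Fin.cons a χ) := by
  rw [← Fintype.sum_prod_type']
  exact (Equiv.sum_comp (Fin.consEquiv fun _ => α) F).symm

theorem colSum_colourings_map {ι : Type*} [DecidableEq ι] [Fintype ι] {k : ℕ} (x : Fin k → ℕ)
    (g : Multiset (ℕ × Finset ι) → ℚ) :
    colSum colourings g (Finset.univ.val.map x) =
      ∑ χ : Fin k → Finset ι, g (Finset.univ.val.map fun i => (x i, χ i)) := by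
  induction k generalizing g with
  | zero => simp
  | succ k ih =>
    rw [map_univ_succ, colSum_cons, colourings_sum, sum_fin_succ_fun]
    refine Finset.sum_congr rfl fun J _ => ?_
    rw [ih]
    refine Finset.sum_congr rfl fun χ _ => ?_
    rw [map_univ_succ]
    simp

theorem colSum_colCount_zero {l : ℕ} (y : Fin l → ℕ) (s : Multiset ℕ) :
    colSum colourings (colCount y 0) s =
      if s = Finset.univ.val.map y then (autCard y : ℚ) else 0 := by
  classical
  split_ifs with hs
  · subst hs
    rw [colSum_colourings_map]
    simp only [colCount]
    rw [Finset.sum_boole, autCard, Nat.card_eq_fintype_card, Fintype.card_subtype]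
    congr 1
    have hnd : (target y).Nodup := by
      refine Multiset.Nodup.map ?_ Finset.univ.nodup
      intro i j h
      simpa using congrArg Prod.snd h
    symm
    refine Finset.card_bij (fun π _ j => {π j}) ?_ ?_ ?_
    · intro π hπ
      rw [Finset.mem_filter] at hπ ⊢
      refine ⟨Finset.mem_univ _, ?_⟩
      rw [target]
      have h1 : (fun i => (y i, ({π i} : Finset (Fin l)))) =
          (fun i => (y i, ({i} : Finset (Fin l)))) ∘ π := by
        funext i
        simp [← congrFun hπ.2 i]
      rw [h1, ← Multiset.map_map]
      congr 1
      simp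
    · intro π _ π' _ h
      ext j
      have := congrFun h j
      simp only [Finset.singleton_inj] at this
      rw [this]
    · intro χ hχ
      rw [Finset.mem_filter] at hχ
      have hmem : ∀ j, ∃ i, (y i, ({i} : Finset (Fin l))) = (y j, χ j) := by
        intro j
        have : (y j, χ j) ∈ target y := by
          rw [← hχ.2]
          exact Multiset.mem_map.2 ⟨j, Finset.mem_univ_val _, rfl⟩
        obtain ⟨i, -, h⟩ := Multiset.mem_map.1 this
        exact ⟨i, h⟩
      choose f hf using hmem
      have hinj : Function.Injective f := by
        have h1 : (Finset.univ.val.map fun i => (y i, χ i)).Nodup := by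
          rw [hχ.2]; exact hnd
        intro i j h
        refine Multiset.inj_on_of_nodup_map h1 i (Finset.mem_univ_val _) j (Finset.mem_univ_val _) ?_
        rw [← hf i, ← hf j, h]
      refine ⟨Equiv.ofBijective f (Finite.injective_iff_bijective.1 hinj), ?_, ?_⟩
      · rw [Finset.mem_filter]
        refine ⟨Finset.mem_univ _, ?_⟩
        funext j
        exact (Prod.ext_iff.1 (hf j)).1
      · funext j
        exact (Prod.ext_iff.1 (hf j)).2
  · by_contra h
    obtain ⟨w, hw, h0⟩ := exists_of_colSum_ne_zero h
    simp only [colCount, ne_eq, ite_eq_right_iff, one_ne_zero, imp_false, not_not] at h0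
    have h1 := map_of_mem_sections (f := Prod.fst) (by
      intro a b hb
      obtain ⟨J, -, rfl⟩ := Multiset.mem_map.1 hb
      rfl) hw
    apply hs
    rw [← h1, h0, target, Multiset.map_map]
    rfl

/-- The point `(x, y)` lies on the hyperplane, has positive entries, and lies on no wall. -/
def NonResonant {k l : ℕ} (x : Fin k → ℕ) (y : Fin l → ℕ) : Prop :=
  (∀ i, 0 < x i) ∧ (∀ j, 0 < y j) ∧ ∑ i, x i = ∑ j, y j ∧
    ∀ (I : Finset (Fin k)) (J : Finset (Fin l)),
      I.Nonempty → I ≠ Finset.univ → J.Nonempty → J ≠ Finset.univ → ∑ i ∈ I, x i ≠ ∑ j ∈ J, y j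

theorem eq_univ_of_sum_eq {k : ℕ} {x : Fin k → ℕ} (hx : ∀ i, 0 < x i) {I : Finset (Fin k)}
    (h : ∑ i ∈ I, x i = ∑ i, x i) : I = Finset.univ := by
  by_contra hI
  obtain ⟨i, hi⟩ : ∃ i, i ∉ I := by
    by_contra! h'
    exact hI (Finset.eq_univ_iff_forall.2 h')
  have := Finset.sum_lt_sum_of_subset (f := x) (Finset.subset_univ I) (Finset.mem_univ i) hi (hx i)
    (fun _ _ _ => Nat.zero_le _)
  omega

theorem NonResonant.eq_univ {k l : ℕ} {x : Fin k → ℕ} {y : Fin l → ℕ} (h : NonResonant x y)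
    {I : Finset (Fin k)} {J : Finset (Fin l)} (hI : I.Nonempty) (hJ : J.Nonempty)
    (hIJ : ∑ i ∈ I, x i = ∑ j ∈ J, y j) : I = Finset.univ ∧ J = Finset.univ := by
  by_cases h1 : I = Finset.univ
  · subst h1
    exact ⟨rfl, eq_univ_of_sum_eq h.2.1 (by rw [← hIJ, h.2.2.1])⟩
  · by_cases h2 : J = Finset.univ
    · subst h2
      exact ⟨eq_univ_of_sum_eq h.1 (by rw [hIJ, h.2.2.1]), rfl⟩
    · exact absurd hIJ (h.2.2.2 I J hI h1 hJ h2)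

theorem items_map {ι α : Type*} [DecidableEq ι] {k : ℕ} (x : Fin k → α) (χ : Fin k → Finset ι)
    (J : Finset ι) : items J (Finset.univ.val.map fun i => (x i, χ i)) =
      (Finset.univ.filter fun i => χ i = J).val.map x := by
  rw [items, Multiset.filter_map, Multiset.map_map]
  rfl

theorem colSum_colCount_of_nonResonant {k l : ℕ} {x : Fin k → ℕ} {y : Fin l → ℕ}
    (h : NonResonant x y) (m : ℕ) :
    colSum colourings (colCount y m) (Finset.univ.val.map x) =
      colCount y m (Finset.univ.val.map fun i => (x i, Finset.univ)) := by
  rw [colSum_colourings_map]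
  refine Finset.sum_eq_single (fun _ => Finset.univ) ?_ (by simp)
  intro χ _ hχ
  by_contra h0
  have hb := balanced_of_colCount_ne_zero h0
  apply hχ
  funext i
  have hi : (x i, χ i) ∈ Finset.univ.val.map fun i => (x i, χ i) :=
    Multiset.mem_map.2 ⟨i, Finset.mem_univ_val _, rfl⟩
  have h1 := hb.2 _ hi
  rw [items_map] at h1
  exact (h.eq_univ (I := Finset.univ.filter fun i' => χ i' = χ i) ⟨i, by simp⟩ (hb.1.1 _ hi) h1).2

/-- The iterated cut-and-join operator, in terms of coloured processes. -/
theorem autCard_mul_cutJoin_iterate {k l : ℕ} {x : Fin k → ℕ} {y : Fin l → ℕ}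
    (h : NonResonant x y) (m : ℕ) :
    (cutJoin^[m] fun s => if s = Finset.univ.val.map y then (autCard y : ℚ) else 0)
      (Finset.univ.val.map x) = colCount y m (Finset.univ.val.map fun i => (x i, Finset.univ)) := by
  rw [← colSum_colCount_of_nonResonant h, ← cutJoin_iterate_colSum]
  have : (fun s => if s = Finset.univ.val.map y then (autCard y : ℚ) else 0) =
      colSum colourings (colCount y 0) := by
    funext s
    exact (colSum_colCount_zero y s).symm
  rw [this]

end TwistedHurwitz

namespace TwistedHurwitz

section Symbolic

variable {T σ : Type*}

/-- On the points `ev t`, the function `F` is given by a homogeneous polynomial of degree `d` (by the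
zero polynomial if `d` is negative). -/
def IsHom (ev : T → σ → ℚ) (d : ℤ) (F : T → ℚ) : Prop :=
  F = 0 ∨ ∃ e : ℕ, (e : ℤ) = d ∧ ∃ Q : MvPolynomial σ ℚ, Q.IsHomogeneous e ∧
    ∀ t, F t = MvPolynomial.eval (ev t) Q

variable {ev : T → σ → ℚ}

theorem IsHom.zero (d : ℤ) : IsHom ev d 0 := .inl rfl

theorem IsHom.add {d : ℤ} {F G : T → ℚ} (hF : IsHom ev d F) (hG : IsHom ev d G) :
    IsHom ev d (F + G) := by
  rcases hF with rfl | ⟨e, he, Q, hQ, hF⟩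
  · simpa using hG
  rcases hG with rfl | ⟨e', he', Q', hQ', hG⟩
  · rw [add_zero]
    exact .inr ⟨e, he, Q, hQ, hF⟩
  obtain rfl : e = e' := by omega
  exact .inr ⟨e, he, Q + Q', hQ.add hQ', fun t => by simp [hF, hG]⟩

theorem IsHom.mul {d d' : ℤ} {F G : T → ℚ} (hF : IsHom ev d F) (hG : IsHom ev d' G) :
    IsHom ev (d + d') (F * G) := by
  rcases hF with rfl | ⟨e, he, Q, hQ, hF⟩
  · exact .inl (zero_mul _)
  rcases hG with rfl | ⟨e', he', Q', hQ', hG⟩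
  · exact .inl (mul_zero _)
  exact .inr ⟨e + e', by omega, Q * Q', hQ.mul hQ', fun t => by simp [hF, hG]⟩

theorem IsHom.const (c : ℚ) : IsHom ev 0 fun _ => c :=
  .inr ⟨0, rfl, MvPolynomial.C c, MvPolynomial.isHomogeneous_C _ _, fun t => by simp⟩

theorem IsHom.of_eq {d d' : ℤ} {F G : T → ℚ} (hF : IsHom ev d F) (hd : d = d') (h : F = G) :
    IsHom ev d' G := by
  subst hd h
  exact hF

theorem IsHom.neg {d : ℤ} {F : T → ℚ} (hF : IsHom ev d F) : IsHom ev d (-F) := by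
  refine ((IsHom.const (-1)).mul hF).of_eq (by ring) ?_
  funext t
  simp

theorem IsHom.sum {d : ℤ} {κ : Type*} (s : Finset κ) {F : κ → T → ℚ}
    (hF : ∀ i ∈ s, IsHom ev d (F i)) : IsHom ev d fun t => ∑ i ∈ s, F i t := by
  classical
  induction s using Finset.induction_on with
  | empty => exact .inl (by funext t; simp)
  | insert i s hi ih =>
    refine ((hF i (by simp)).add (ih fun j hj => hF j (by simp [hj]))).of_eq rfl ?_
    funext t
    simp [hi]

theorem IsHom.multiset_sum {d : ℤ} (Z : Multiset (T → ℕ))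
    (hZ : ∀ f ∈ Z, IsHom ev d fun t => (f t : ℚ)) :
    IsHom ev d fun t => (((Z.map fun f => f t).sum : ℕ) : ℚ) := by
  induction Z using Multiset.induction_on with
  | empty => exact .inl (by funext t; simp)
  | cons f Z ih =>
    refine ((hZ f (by simp)).add (ih fun g hg => hZ g (by simp [hg]))).of_eq rfl ?_
    funext t
    simp

/-- The nonnegative functions that are given by a homogeneous polynomial, times a factor. -/
def homSubmonoid (ev : T → σ → ℚ) (d : ℤ) (M : T → ℚ) : AddSubmonoid (T → ℚ) where
  carrier := {f | ∃ F, IsHom ev d F ∧ (∀ t, 0 ≤ F t) ∧ f = F * M}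
  zero_mem' := ⟨0, IsHom.zero _, fun _ => le_rfl, by simp⟩
  add_mem' := by
    rintro _ _ ⟨F, hF, hF0, rfl⟩ ⟨G, hG, hG0, rfl⟩
    exact ⟨F + G, hF.add hG, fun t => add_nonneg (hF0 t) (hG0 t), by rw [add_mul]⟩

/-- The functions that are given by a positive homogeneous polynomial, times a factor. -/
def homPos (ev : T → σ → ℚ) (d : ℤ) (M : T → ℚ) : Set (T → ℚ) :=
  {f | ∃ F, IsHom ev d F ∧ (∀ t, 0 < F t) ∧ f = F * M}

theorem homPos_add {d : ℤ} {M f g : T → ℚ} (hf : f ∈ homPos ev d M)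
    (hg : g ∈ homSubmonoid ev d M) : f + g ∈ homPos ev d M := by
  obtain ⟨F, hF, hF0, rfl⟩ := hf
  obtain ⟨G, hG, hG0, rfl⟩ := hg
  exact ⟨F + G, hF.add hG, fun t => add_pos_of_pos_of_nonneg (hF0 t) (hG0 t), by rw [add_mul]⟩

theorem homPos_subset {d : ℤ} {M f : T → ℚ} (hf : f ∈ homPos ev d M) :
    f ∈ homSubmonoid ev d M := by
  obtain ⟨F, hF, hF0, rfl⟩ := hf
  exact ⟨F, hF, fun t => (hF0 t).le, rfl⟩

/-- The differences of nonnegative functions given by homogeneous polynomials of degrees `d + 1` and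
`d`, times a factor. -/
def twoSubmonoid (ev : T → σ → ℚ) (d : ℤ) (M : T → ℚ) : AddSubmonoid (T → ℚ) where
  carrier := {f | ∃ a ∈ homSubmonoid ev (d + 1) M, ∃ b ∈ homSubmonoid ev d M, f = a - b}
  zero_mem' := ⟨0, zero_mem _, 0, zero_mem _, by simp⟩
  add_mem' := by
    rintro _ _ ⟨a, ha, b, hb, rfl⟩ ⟨a', ha', b', hb', rfl⟩
    exact ⟨a + a', add_mem ha ha', b + b', add_mem hb hb', by abel⟩

/-- The differences of positive functions given by homogeneous polynomials of degrees `d + 1` and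
`d`, times a factor. -/
def twoPos (ev : T → σ → ℚ) (d : ℤ) (M : T → ℚ) : Set (T → ℚ) :=
  {f | ∃ a ∈ homPos ev (d + 1) M, ∃ b ∈ homPos ev d M, f = a - b}

theorem twoPos_add {d : ℤ} {M f g : T → ℚ} (hf : f ∈ twoPos ev d M)
    (hg : g ∈ twoSubmonoid ev d M) : f + g ∈ twoPos ev d M := by
  obtain ⟨a, ha, b, hb, rfl⟩ := hf
  obtain ⟨a', ha', b', hb', rfl⟩ := hg
  exact ⟨a + a', homPos_add ha ha', b + b', homPos_add hb hb', by abel⟩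

theorem twoPos_subset {d : ℤ} {M f : T → ℚ} (hf : f ∈ twoPos ev d M) :
    f ∈ twoSubmonoid ev d M := by
  obtain ⟨a, ha, b, hb, rfl⟩ := hf
  exact ⟨a, homPos_subset ha, b, homPos_subset hb, rfl⟩

section Mul

variable {d e : ℤ} {M N u f : T → ℚ}

theorem homSubmonoid_mul (hu : IsHom ev e u) (hu0 : ∀ t, 0 ≤ u t)
    (hf : f ∈ homSubmonoid ev d M) : u * N * f ∈ homSubmonoid ev (e + d) (N * M) := by
  obtain ⟨F, hF, hF0, rfl⟩ := hf
  exact ⟨u * F, hu.mul hF, fun t => mul_nonneg (hu0 t) (hF0 t), by ring⟩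

theorem homPos_mul (hu : IsHom ev e u) (hu0 : ∀ t, 0 < u t)
    (hf : f ∈ homPos ev d M) : u * N * f ∈ homPos ev (e + d) (N * M) := by
  obtain ⟨F, hF, hF0, rfl⟩ := hf
  exact ⟨u * F, hu.mul hF, fun t => mul_pos (hu0 t) (hF0 t), by ring⟩

theorem twoSubmonoid_mul (hu : IsHom ev e u) (hu0 : ∀ t, 0 ≤ u t)
    (hf : f ∈ twoSubmonoid ev d M) : u * N * f ∈ twoSubmonoid ev (e + d) (N * M) := by
  obtain ⟨a, ha, b, hb, rfl⟩ := hf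
  refine ⟨u * N * a, ?_, u * N * b, homSubmonoid_mul hu hu0 hb, by ring⟩
  rw [add_assoc]
  exact homSubmonoid_mul hu hu0 ha

end Mul

theorem pickSum_mem {α : Type*} (R : AddSubmonoid (T → ℚ)) {g : T → α → Multiset α → ℚ}
    {w : Multiset α} (H : ∀ a r, w = a ::ₘ r → (fun t => g t a r) ∈ R) :
    (fun t => pickSum (g t) w) ∈ R := by
  induction w using Multiset.induction_on generalizing g with
  | empty =>
    simp only [pickSum_zero]
    exact R.zero_mem
  | cons a w ih =>
    simp only [pickSum_cons]
    refine R.add_mem (H a w rfl) (ih fun b r h => H b (a ::ₘ r) ?_)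
    rw [h, Multiset.cons_swap]

theorem pickSum_mem_of_exists {α : Type*} {R : AddSubmonoid (T → ℚ)} {S : Set (T → ℚ)}
    (hS : ∀ f ∈ S, ∀ g ∈ R, f + g ∈ S) {g : T → α → Multiset α → ℚ}
    {w : Multiset α} (H : ∀ a r, w = a ::ₘ r → (fun t => g t a r) ∈ R)
    (h : ∃ a r, w = a ::ₘ r ∧ (fun t => g t a r) ∈ S) :
    (fun t => pickSum (g t) w) ∈ S := by
  obtain ⟨a, r, rfl, h⟩ := h
  simp only [pickSum_cons]
  refine hS _ h _ (pickSum_mem R fun b r' h' => H b (a ::ₘ r') ?_)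
  rw [h', Multiset.cons_swap]

theorem colSum_mem {α β : Type*} (R : AddSubmonoid (T → ℚ)) {φ : α → Multiset β}
    {g : T → Multiset β → ℚ} {w : Multiset α}
    (H : ∀ w' ∈ Multiset.Sections (w.map φ), (fun t => g t w') ∈ R) :
    (fun t => colSum φ (g t) w) ∈ R := by
  unfold colSum
  generalize Multiset.Sections (w.map φ) = m at H
  induction m using Multiset.induction_on with
  | empty =>
    simp only [Multiset.map_zero, Multiset.sum_zero]
    exact R.zero_mem
  | cons a m ih =>
    simp only [Multiset.map_cons, Multiset.sum_cons]
    exact R.add_mem (H a (by simp)) (ih fun b hb => H b (by simp [hb]))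

theorem colSum_mem_of_exists {α β : Type*} {R : AddSubmonoid (T → ℚ)} {S : Set (T → ℚ)}
    (hS : ∀ f ∈ S, ∀ g ∈ R, f + g ∈ S) {φ : α → Multiset β}
    {g : T → Multiset β → ℚ} {w : Multiset α}
    (H : ∀ w' ∈ Multiset.Sections (w.map φ), (fun t => g t w') ∈ R)
    (h : ∃ w' ∈ Multiset.Sections (w.map φ), (fun t => g t w') ∈ S) :
    (fun t => colSum φ (g t) w) ∈ S := by
  unfold colSum
  obtain ⟨w', hw', h⟩ := h
  obtain ⟨m, hm⟩ := Multiset.exists_cons_of_mem hw'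
  rw [hm] at H
  rw [hm]
  simp only [Multiset.map_cons, Multiset.sum_cons]
  refine hS _ h _ ?_
  replace H : ∀ w' ∈ m, (fun t => g t w') ∈ R := fun w' hw' => H w' (by simp [hw'])
  clear hm hw' h
  induction m using Multiset.induction_on with
  | empty =>
    simp only [Multiset.map_zero, Multiset.sum_zero]
    exact R.zero_mem
  | cons a m ih =>
    simp only [Multiset.map_cons, Multiset.sum_cons]
    exact R.add_mem (H a (by simp)) (ih fun b hb => H b (by simp [hb]))

variable {ι : Type*} [DecidableEq ι]

/-- The value at `t` of a sum of forms. -/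
def formSum (Z : Multiset (T → ℕ)) (t : T) : ℕ := (Z.map fun f => f t).sum

@[simp]
theorem formSum_zero (t : T) : formSum (0 : Multiset (T → ℕ)) t = 0 := rfl

@[simp]
theorem formSum_cons (f : T → ℕ) (Z : Multiset (T → ℕ)) (t : T) :
    formSum (f ::ₘ Z) t = f t + formSum Z t := by
  simp [formSum]

theorem formSum_add (Z Z' : Multiset (T → ℕ)) (t : T) :
    formSum (Z + Z') t = formSum Z t + formSum Z' t := by
  simp [formSum]

/-- The forms `Z₀` and `y j`, `j ∈ J`, are nowhere resonant: for no proper subfamilies does the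
difference of the sums change its sign. -/
def NoResonance (y : ι → T → ℕ) (Z₀ : Multiset (T → ℕ)) (J : Finset ι) : Prop :=
  ∀ Z ≤ Z₀, ∀ K ⊆ J, (Z ≠ 0 ∨ K ≠ ∅) → (Z ≠ Z₀ ∨ K ≠ J) →
    (∀ t, formSum Z t < ∑ j ∈ K, y j t) ∨ ∀ t, ∑ j ∈ K, y j t < formSum Z t

omit [DecidableEq ι] in
theorem NoResonance.join {y : ι → T → ℕ} {f g : T → ℕ} {Z₀ : Multiset (T → ℕ)} {J : Finset ι}
    (h : NoResonance y (f ::ₘ g ::ₘ Z₀) J) : NoResonance y ((f + g) ::ₘ Z₀) J := by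
  intro Z hZ K hK h1 h2
  by_cases hfg : f + g ∈ Z
  · obtain ⟨Z', rfl⟩ := Multiset.exists_cons_of_mem hfg
    rw [Multiset.cons_le_cons_iff] at hZ
    have := h (f ::ₘ g ::ₘ Z') (by simpa using hZ) K hK (by simp) (by simpa using h2)
    simpa [add_assoc] using this
  · have hZ' := (Multiset.le_cons_of_notMem hfg).1 hZ
    refine h Z ((hZ'.trans (Multiset.le_cons_self _ _)).trans (Multiset.le_cons_self _ _)) K hK h1
      (.inl ?_)
    rintro rfl
    have := Multiset.card_le_card hZ'
    simp at this

theorem NoResonance.split {y : ι → T → ℕ} {p : T → ℕ} {Z₀ Z₁ : Multiset (T → ℕ)} {J K : Finset ι}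
    (h : NoResonance y Z₀ J) (hZ₁ : Z₁ ≤ Z₀) (hK : K ⊂ J)
    (hp : ∀ t, p t + formSum Z₁ t = ∑ j ∈ K, y j t) : NoResonance y (p ::ₘ Z₁) K := by
  classical
  intro Z hZ L hL h1 h2
  by_cases hpZ : p ∈ Z
  · obtain ⟨Z', rfl⟩ := Multiset.exists_cons_of_mem hpZ
    rw [Multiset.cons_le_cons_iff] at hZ
    obtain ⟨Z'', rfl⟩ := Multiset.le_iff_exists_add.1 hZ
    have h3 := h Z'' ((Multiset.le_add_left _ _).trans hZ₁) (K \ L)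
      (Finset.sdiff_subset.trans hK.1) ?_ (.inr ?_)
    · have e1 : ∀ t, ∑ j ∈ K, y j t = ∑ j ∈ K \ L, y j t + ∑ j ∈ L, y j t := fun t =>
        (Finset.sum_sdiff hL).symm
      simp only [formSum_add, e1] at hp
      simp only [formSum_cons]
      rcases h3 with h3 | h3
      · right; intro t; have := h3 t; have := hp t; omega
      · left; intro t; have := h3 t; have := hp t; omega
    · by_contra! h4
      rw [Finset.sdiff_eq_empty_iff_subset] at h4
      rcases h2 with h2 | h2
      · simp [h4.1] at h2
      · exact h2 (subset_antisymm hL h4.2)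
    · intro h4
      exact hK.2 (h4 ▸ Finset.sdiff_subset)
  · refine h Z (((Multiset.le_cons_of_notMem hpZ).1 hZ).trans hZ₁) L (hL.trans hK.1) h1 (.inr ?_)
    rintro rfl
    exact hK.2 hL

/-- A symbolic part: a form, a mark, and a colour. -/
abbrev Part (T : Type*) (ι : Type*) := ((T → ℕ) × Bool) × Finset ι

/-- The forms of colour `J`. -/
def forms (J : Finset ι) (w : Multiset (Part T ι)) : Multiset (T → ℕ) := (items J w).map Prod.fst

/-- The value of a symbolic coloured partition at `t`. -/
def evalAt (t : T) (w : Multiset (Part T ι)) : Multiset (ℕ × Finset ι) :=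
  w.map fun a => (a.1.1 t, a.2)

/-- The product of the marked parts. -/
def markProd (w : Multiset (Part T ι)) (t : T) : ℚ :=
  (w.map fun a => if a.1.2 then (a.1.1 t : ℚ) else 1).prod

/-- The number of marked parts. -/
def markCard (w : Multiset (Part T ι)) : ℤ := (w.map fun a => if a.1.2 then (1 : ℤ) else 0).sum

/-- The value of an unmarked part. -/
def unmarked (a : Part T ι) (t : T) : ℚ := if a.1.2 then 1 else (a.1.1 t : ℚ)

/-- The value of a marked part. -/
def marked (a : Part T ι) (t : T) : ℚ := if a.1.2 then (a.1.1 t : ℚ) else 1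

omit [DecidableEq ι] in
theorem unmarked_mul_marked (a : Part T ι) (t : T) :
    unmarked a t * marked a t = a.1.1 t := by
  unfold unmarked marked
  split_ifs <;> simp

omit [DecidableEq ι] in
theorem markProd_cons (a : Part T ι) (w : Multiset (Part T ι)) :
    markProd (a ::ₘ w) = marked a * markProd w := by
  funext t
  simp [markProd, marked]

omit [DecidableEq ι] in
theorem markCard_cons (a : Part T ι) (w : Multiset (Part T ι)) :
    markCard (a ::ₘ w) = (if a.1.2 then 1 else 0) + markCard w := by
  simp [markCard]

omit [DecidableEq ι] in
theorem markProd_eq_of_map_fst {w w' : Multiset (Part T ι)}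
    (h : w.map Prod.fst = w'.map Prod.fst) : markProd w = markProd w' := by
  funext t
  have := congrArg (fun m => (m.map fun a : (T → ℕ) × Bool => if a.2 then (a.1 t : ℚ) else 1).prod) h
  simpa [Multiset.map_map, markProd, Function.comp_def] using this

omit [DecidableEq ι] in
theorem markCard_eq_of_map_fst {w w' : Multiset (Part T ι)}
    (h : w.map Prod.fst = w'.map Prod.fst) : markCard w = markCard w' := by
  have := congrArg (fun m => (m.map fun a : (T → ℕ) × Bool => if a.2 then (1 : ℤ) else 0).sum) h
  simpa [Multiset.map_map, markCard, Function.comp_def] using this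

omit [DecidableEq ι] in
theorem evalAt_cons (t : T) (a : Part T ι) (w : Multiset (Part T ι)) :
    evalAt t (a ::ₘ w) = (a.1.1 t, a.2) ::ₘ evalAt t w := by
  simp [evalAt]

theorem colours_evalAt (t : T) (w : Multiset (Part T ι)) : colours (evalAt t w) = colours w := by
  simp [colours, evalAt, Multiset.map_map]

theorem sum_items_evalAt (t : T) (w : Multiset (Part T ι)) (J : Finset ι) :
    (items J (evalAt t w)).sum = formSum (forms J w) t := by
  induction w using Multiset.induction_on with
  | empty => rfl
  | cons a w ih =>
    rw [evalAt_cons, items_cons, forms, items_cons]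
    split_ifs with h
    · rw [Multiset.sum_cons, ih, Multiset.map_cons, formSum_cons]
      rfl
    · exact ih

theorem forms_cons (J : Finset ι) (a : Part T ι) (w : Multiset (Part T ι)) :
    forms J (a ::ₘ w) = if a.2 = J then a.1.1 ::ₘ forms J w else forms J w := by
  unfold forms
  rw [items_cons]
  split_ifs <;> simp

end Symbolic

end TwistedHurwitz

namespace TwistedHurwitz

section Good

variable {T σ ι : Type*} [DecidableEq ι]

/-- The symbolic coloured partitions for which the coloured counts are polynomial. -/
structure Good (ev : T → σ → ℚ) (y : ι → T → ℕ) (w : Multiset (Part T ι)) : Prop where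
  lin : ∀ a ∈ w, IsHom ev 1 fun t => (a.1.1 t : ℚ)
  adm : Admissible w
  cover : ∀ j, ∃ a ∈ w, j ∈ a.2
  bal : ∀ a ∈ w, ∀ t, formSum (forms a.2 w) t = ∑ j ∈ a.2, y j t
  nores : ∀ a ∈ w, NoResonance y (forms a.2 w) a.2
  mark : ∀ a ∈ w, a.1.2 = true → 2 ≤ a.2.card ∨ 2 ≤ (items a.2 w).card

variable {ev : T → σ → ℚ} {y : ι → T → ℕ} {w r r' : Multiset (Part T ι)} {a b : Part T ι}

theorem mem_forms_of_mem (ha : a ∈ w) : a.1.1 ∈ forms a.2 w :=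
  Multiset.mem_map.2 ⟨a.1, mem_items.2 ha, rfl⟩

theorem Good.pos (h : Good ev y w) (ha : a ∈ w) (t : T) : 0 < a.1.1 t := by
  have h1 := h.nores a ha {a.1.1} (Multiset.singleton_le.2 (mem_forms_of_mem ha)) ∅ (by simp)
    (by simp) (.inr (h.adm.1 a ha).ne_empty.symm)
  rcases h1 with h1 | h1
  · simpa [formSum] using h1 t
  · simpa [formSum] using h1 t

theorem Good.join (h : Good ev y (a ::ₘ b ::ₘ r)) (hab : b.2 = a.2) :
    Good ev y (((a.1.1 + b.1.1, false), a.2) ::ₘ r) := by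
  have hf : ∀ L, L ≠ a.2 → ∀ x, forms L ((x, a.2) ::ₘ r) = forms L (a ::ₘ b ::ₘ r) := by
    intro L hL x
    simp [forms_cons, hab, hL.symm]
  have ha : forms a.2 (a ::ₘ b ::ₘ r) = a.1.1 ::ₘ b.1.1 ::ₘ forms a.2 r := by
    simp [forms_cons, hab]
  have ha' : ∀ x, forms a.2 ((x, a.2) ::ₘ r) = x.1 ::ₘ forms a.2 r := by
    intro x
    simp [forms_cons]
  have hmem : ∀ c ∈ ((a.1.1 + b.1.1, false), a.2) ::ₘ r,
      ∃ c' ∈ a ::ₘ b ::ₘ r, c'.2 = c.2 := by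
    intro c hc
    rcases Multiset.mem_cons.1 hc with rfl | hc
    · exact ⟨a, by simp, rfl⟩
    · exact ⟨c, by simp [hc], rfl⟩
  refine ⟨?_, ⟨?_, ?_⟩, ?_, ?_, ?_, ?_⟩
  · intro c hc
    rcases Multiset.mem_cons.1 hc with rfl | hc
    · refine ((h.lin a (by simp)).add (h.lin b (by simp))).of_eq rfl ?_
      funext t
      simp
    · exact h.lin c (by simp [hc])
  · intro c hc
    obtain ⟨c', hc', e⟩ := hmem c hc
    exact e ▸ h.adm.1 c' hc'
  · intro c hc d hd
    obtain ⟨c', hc', e⟩ := hmem c hc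
    obtain ⟨d', hd', e'⟩ := hmem d hd
    rw [← e, ← e']
    exact h.adm.2 c' hc' d' hd'
  · intro j
    obtain ⟨c, hc, hj⟩ := h.cover j
    simp only [Multiset.mem_cons] at hc
    rcases hc with rfl | rfl | hc
    · exact ⟨_, Multiset.mem_cons_self _ _, hj⟩
    · exact ⟨_, Multiset.mem_cons_self _ _, hab ▸ hj⟩
    · exact ⟨c, by simp [hc], hj⟩
  · intro c hc t
    obtain ⟨c', hc', e⟩ := hmem c hc
    rw [← e, ← h.bal c' hc' t]
    by_cases hca : c'.2 = a.2
    · rw [hca, ha, ha']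
      simp [add_assoc]
    · rw [hf _ hca]
  · intro c hc
    obtain ⟨c', hc', e⟩ := hmem c hc
    rw [← e]
    by_cases hca : c'.2 = a.2
    · rw [hca, ha']
      have := h.nores a (by simp)
      rw [ha] at this
      exact this.join
    · rw [hf _ hca]
      exact h.nores c' hc'
  · intro c hc hm
    rcases Multiset.mem_cons.1 hc with rfl | hc
    · simp at hm
    · by_cases hca : c.2 = a.2
      · right
        rw [hca, items_cons, if_pos rfl, Multiset.card_cons]
        have : 0 < (items a.2 r).card :=
          Multiset.card_pos_iff_exists_mem.2 ⟨c.1, mem_items.2 (hca ▸ hc)⟩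
        omega
      · have := h.mark c (by simp [hc]) hm
        rw [items_cons, items_cons, if_neg (Ne.symm hca), if_neg (hab ▸ Ne.symm hca)] at this
        rwa [items_cons, if_neg (Ne.symm hca)]

theorem Good.unmark (h : Good ev y (a ::ₘ r)) : Good ev y (((a.1.1, false), a.2) ::ₘ r) := by
  have hf : ∀ L, forms L (((a.1.1, false), a.2) ::ₘ r) = forms L (a ::ₘ r) := by
    intro L
    simp [forms_cons]
  have hmem : ∀ c ∈ ((a.1.1, false), a.2) ::ₘ r, ∃ c' ∈ a ::ₘ r, c'.2 = c.2 ∧ c'.1.1 = c.1.1 := by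
    intro c hc
    rcases Multiset.mem_cons.1 hc with rfl | hc
    · exact ⟨a, by simp, rfl, rfl⟩
    · exact ⟨c, by simp [hc], rfl, rfl⟩
  refine ⟨?_, ⟨?_, ?_⟩, ?_, ?_, ?_, ?_⟩
  · intro c hc
    obtain ⟨c', hc', -, e⟩ := hmem c hc
    exact e ▸ h.lin c' hc'
  · intro c hc
    obtain ⟨c', hc', e, -⟩ := hmem c hc
    exact e ▸ h.adm.1 c' hc'
  · intro c hc d hd
    obtain ⟨c', hc', e, -⟩ := hmem c hc
    obtain ⟨d', hd', e', -⟩ := hmem d hd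
    rw [← e, ← e']
    exact h.adm.2 c' hc' d' hd'
  · intro j
    obtain ⟨c, hc, hj⟩ := h.cover j
    rcases Multiset.mem_cons.1 hc with rfl | hc
    · exact ⟨_, Multiset.mem_cons_self _ _, hj⟩
    · exact ⟨c, by simp [hc], hj⟩
  · intro c hc t
    obtain ⟨c', hc', e, -⟩ := hmem c hc
    rw [← e, hf, h.bal c' hc' t]
  · intro c hc
    obtain ⟨c', hc', e, -⟩ := hmem c hc
    rw [← e, hf]
    exact h.nores c' hc'
  · intro c hc hm
    rcases Multiset.mem_cons.1 hc with rfl | hc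
    · simp at hm
    · have := h.mark c (by simp [hc]) hm
      rw [items_cons] at this ⊢
      split_ifs at this ⊢ <;> simpa using this

theorem colour_ne_of_split (h : Admissible (a ::ₘ r)) {K : Finset ι} (hK : K ⊂ a.2)
    (hK0 : K.Nonempty) {c : Part T ι} (hc : c ∈ a ::ₘ r) : c.2 ≠ K ∧ c.2 ≠ a.2 \ K := by
  constructor
  · rintro rfl
    rcases h.2 c hc a (by simp) with h1 | h1
    · exact hK.ne h1
    · exact hK0.ne_empty (Finset.disjoint_self_iff_empty _ |>.1 (h1.mono_right hK.1))
  · intro h0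
    have hd0 : (a.2 \ K).Nonempty := Finset.sdiff_nonempty.2 hK.2
    rcases h.2 c hc a (by simp) with h1 | h1
    · rw [h0] at h1
      exact (ne_of_proper hK hK0).2.1 h1
    · rw [h0] at h1
      exact hd0.ne_empty (Finset.disjoint_self_iff_empty _ |>.1 (h1.mono_right Finset.sdiff_subset))

theorem forms_of_recoloured {J K : Finset ι} (hK : K ⊂ J) (hK0 : K.Nonempty)
    (hr' : r' ∈ Multiset.Sections (r.map (recolour J K))) :
    forms J r = forms K r' + forms (J \ K) r' := by
  rw [forms, items_of_recoloured hK hK0 hr', Multiset.map_add]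
  rfl

theorem Good.split (hy : ∀ j, IsHom ev 1 fun t => (y j t : ℚ)) (h : Good ev y (a ::ₘ r))
    {K : Finset ι} (hK : K ⊂ a.2)
    (hK0 : K.Nonempty) (hr' : r' ∈ Multiset.Sections (r.map (recolour a.2 K))) {p q : T → ℕ}
    (hp : ∀ t, p t + formSum (forms K r') t = ∑ j ∈ K, y j t)
    (hq : ∀ t, q t + formSum (forms (a.2 \ K) r') t = ∑ j ∈ a.2 \ K, y j t) :
    Good ev y (((p, false), K) ::ₘ ((q, false), a.2 \ K) ::ₘ r') := by
  obtain ⟨e1, e2, e3⟩ := ne_of_proper hK hK0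
  have hd0 : (a.2 \ K).Nonempty := Finset.sdiff_nonempty.2 hK.2
  have hforms := forms_of_recoloured hK hK0 hr'
  have hlin' : ∀ c ∈ r', IsHom ev 1 fun t => (c.1.1 t : ℚ) := by
    intro c hc
    have : c.1 ∈ r.map Prod.fst := by
      rw [← map_fst_of_recoloured hr']
      exact Multiset.mem_map_of_mem _ hc
    obtain ⟨c', hc', e⟩ := Multiset.mem_map.1 this
    rw [← e]
    exact h.lin c' (by simp [hc'])
  have hplin : ∀ (L : Finset ι) (x : T → ℕ),
      (∀ t, x t + formSum (forms L r') t = ∑ j ∈ L, y j t) → IsHom ev 1 fun t => (x t : ℚ) := by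
    intro L x hx
    have h1 : IsHom ev 1 fun t => ((formSum (forms L r') t : ℕ) : ℚ) := by
      refine IsHom.multiset_sum _ fun f hf => ?_
      obtain ⟨c, hc, rfl⟩ := Multiset.mem_map.1 hf
      exact hlin' (c, L) (mem_items.1 hc)
    refine ((IsHom.sum L fun j _ => hy j).add h1.neg).of_eq rfl ?_
    funext t
    have := hx t
    have h2 : (x t : ℚ) + formSum (forms L r') t = ∑ j ∈ L, (y j t : ℚ) := by exact_mod_cast this
    simp only [Pi.add_apply, Pi.neg_apply]
    linarith
  have hmem : ∀ c ∈ r', c.2 = K ∨ c.2 = a.2 \ K ∨ c.2 ≠ a.2 ∧ c ∈ r :=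
    colour_of_mem_recoloured hK hK0 hr'
  have hne : ∀ c ∈ r, c.2 ≠ K ∧ c.2 ≠ a.2 \ K := fun c hc =>
    colour_ne_of_split h.adm hK hK0 (by simp [hc])
  have hdisj : ∀ c ∈ r, c.2 ≠ a.2 → Disjoint a.2 c.2 := fun c hc hca =>
    (h.adm.2 a (by simp) c (by simp [hc])).resolve_left (Ne.symm hca)
  have hfK : forms K (((p, false), K) ::ₘ ((q, false), a.2 \ K) ::ₘ r') = p ::ₘ forms K r' := by
    simp [forms_cons, e3.symm]
  have hfd : forms (a.2 \ K) (((p, false), K) ::ₘ ((q, false), a.2 \ K) ::ₘ r') =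
      q ::ₘ forms (a.2 \ K) r' := by
    simp [forms_cons, e3]
  have hio : ∀ L, L ≠ a.2 → L ≠ K → L ≠ a.2 \ K →
      items L (((p, false), K) ::ₘ ((q, false), a.2 \ K) ::ₘ r') = items L (a ::ₘ r) := by
    intro L h1 h2 h3
    simp [h1.symm, h2.symm, h3.symm, items_of_recoloured_of_ne h1 h2 h3 hr']
  have hfo : ∀ L, L ≠ a.2 → L ≠ K → L ≠ a.2 \ K →
      forms L (((p, false), K) ::ₘ ((q, false), a.2 \ K) ::ₘ r') = forms L (a ::ₘ r) := by
    intro L h1 h2 h3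
    rw [forms, hio L h1 h2 h3, forms]
  have hcol : ∀ c ∈ ((p, false), K) ::ₘ ((q, false), a.2 \ K) ::ₘ r',
      c.2 = K ∨ c.2 = a.2 \ K ∨ c.2 ≠ a.2 ∧ c ∈ r := by
    intro c hc
    simp only [Multiset.mem_cons] at hc
    rcases hc with rfl | rfl | hc
    · exact .inl rfl
    · exact .inr (.inl rfl)
    · exact hmem c hc
  have hfa : forms a.2 (a ::ₘ r) = a.1.1 ::ₘ forms a.2 r := by simp [forms_cons]
  refine ⟨?_, ⟨?_, ?_⟩, ?_, ?_, ?_, ?_⟩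
  · intro c hc
    simp only [Multiset.mem_cons] at hc
    rcases hc with rfl | rfl | hc
    · exact hplin _ _ hp
    · exact hplin _ _ hq
    · exact hlin' c hc
  · intro c hc
    rcases hcol c hc with e | e | e
    · rwa [e]
    · rwa [e]
    · exact h.adm.1 c (by simp [e.2])
  · have hKd : Disjoint K (a.2 \ K) := Finset.disjoint_sdiff
    intro c hc d hd
    rcases hcol c hc with e | e | e <;> rcases hcol d hd with e' | e' | e'
    · left; rw [e, e']
    · right; rw [e, e']; exact hKd
    · right; rw [e]; exact (hdisj d e'.2 e'.1).mono_left hK.1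
    · right; rw [e, e']; exact hKd.symm
    · left; rw [e, e']
    · right; rw [e]; exact (hdisj d e'.2 e'.1).mono_left Finset.sdiff_subset
    · right; rw [e']; exact ((hdisj c e.2 e.1).mono_left hK.1).symm
    · right; rw [e']; exact ((hdisj c e.2 e.1).mono_left Finset.sdiff_subset).symm
    · exact h.adm.2 c (by simp [e.2]) d (by simp [e'.2])
  · intro j
    obtain ⟨c, hc, hj⟩ := h.cover j
    by_cases hca : c.2 = a.2
    · rw [hca] at hj
      by_cases hjK : j ∈ K
      · exact ⟨((p, false), K), by simp, hjK⟩
      · exact ⟨((q, false), a.2 \ K), by simp, Finset.mem_sdiff.2 ⟨hj, hjK⟩⟩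
    · rcases Multiset.mem_cons.1 hc with rfl | hc
      · exact absurd rfl hca
      · have := (exists_mem_recoloured hr' c hc).resolve_left hca
        exact ⟨c, by simp [this.2.2], hj⟩
  · intro c hc t
    rcases hcol c hc with e | e | e
    · rw [e, hfK, formSum_cons, hp]
    · rw [e, hfd, formSum_cons, hq]
    · rw [hfo c.2 e.1 (hne c e.2).1 (hne c e.2).2]
      exact h.bal c (by simp [e.2]) t
  · intro c hc
    have hna := h.nores a (by simp)
    rcases hcol c hc with e | e | e
    · rw [e, hfK]
      refine hna.split ?_ hK hp
      rw [hfa, hforms]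
      exact (Multiset.le_add_right _ _).trans (Multiset.le_cons_self _ _)
    · rw [e, hfd]
      refine hna.split ?_ ⟨Finset.sdiff_subset, fun hs => ?_⟩ hq
      · rw [hfa, hforms]
        exact (Multiset.le_add_left _ _).trans (Multiset.le_cons_self _ _)
      · exact e2 (subset_antisymm Finset.sdiff_subset hs)
    · rw [hfo c.2 e.1 (hne c e.2).1 (hne c e.2).2]
      exact h.nores c (by simp [e.2])
  · intro c hc hm
    simp only [Multiset.mem_cons] at hc
    rcases hc with rfl | rfl | hc
    · simp at hm
    · simp at hm
    · have hpos : 0 < (items c.2 r').card :=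
        Multiset.card_pos_iff_exists_mem.2 ⟨c.1, mem_items.2 hc⟩
      rcases hmem c hc with e | e | e
      · right
        rw [e] at hpos ⊢
        simp [e3.symm]
        omega
      · right
        rw [e] at hpos ⊢
        simp [e3]
        omega
      · have := h.mark c (by simp [e.2]) hm
        rwa [hio c.2 e.1 (hne c e.2).1 (hne c e.2).2]

theorem sum_card_colours [Fintype ι] (h : Admissible w) (hc : ∀ j, ∃ a ∈ w, j ∈ a.2) :
    ∑ J ∈ colours w, J.card = Fintype.card ι := by
  rw [← Finset.card_univ, ← Finset.card_biUnion (t := fun J => J)]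
  · congr 1
    ext j
    simp only [Finset.mem_biUnion, Finset.mem_univ, iff_true]
    obtain ⟨a, ha, hj⟩ := hc j
    exact ⟨a.2, mem_colours.2 ⟨a, ha, rfl⟩, hj⟩
  · intro J hJ K hK hJK
    obtain ⟨a, ha, rfl⟩ := mem_colours.1 hJ
    obtain ⟨b, hb, rfl⟩ := mem_colours.1 hK
    exact (h.2 a ha b hb).resolve_left hJK

theorem card_colours_le (w : Multiset (Part T ι)) : (colours w).card ≤ w.card := by
  rw [colours]
  exact (Multiset.toFinset_card_le _).trans (by simp)

theorem card_colours_le_card [Fintype ι] (h : Good ev y w) :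
    (colours w).card ≤ Fintype.card ι := by
  rw [← sum_card_colours h.adm h.cover, Finset.card_eq_sum_ones]
  refine Finset.sum_le_sum fun J hJ => ?_
  obtain ⟨a, ha, rfl⟩ := mem_colours.1 hJ
  exact (h.adm.1 a ha).card_pos

theorem card_eq_card_colours_iff : (colours w).card = w.card ↔ (w.map Prod.snd).Nodup := by
  rw [colours, ← Multiset.toFinset_card_eq_card_iff_nodup, Multiset.card_map]

theorem exists_same_colour {α : Type*} {w : Multiset (α × Finset ι)}
    (h : ¬ (w.map Prod.snd).Nodup) : ∃ a b r, w = a ::ₘ b ::ₘ r ∧ b.2 = a.2 := by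
  induction w using Multiset.induction_on with
  | empty => simp at h
  | cons a w ih =>
    by_cases h1 : (w.map Prod.snd).Nodup
    · rw [Multiset.map_cons, Multiset.nodup_cons] at h
      have : a.2 ∈ w.map Prod.snd := by
        by_contra h2
        exact h ⟨h2, h1⟩
      obtain ⟨b, hb, e⟩ := Multiset.mem_map.1 this
      obtain ⟨r, rfl⟩ := Multiset.exists_cons_of_mem hb
      exact ⟨a, b, r, rfl, e⟩
    · obtain ⟨b, c, r, rfl, e⟩ := ih h1
      exact ⟨b, c, a ::ₘ r, by rw [Multiset.cons_swap a b, Multiset.cons_swap a c], e⟩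

theorem self_mem_sections {α : Type*} {φ : α → Multiset α} {s : Multiset α}
    (h : ∀ a ∈ s, φ a = {a}) : s ∈ Multiset.Sections (s.map φ) := by
  induction s using Multiset.induction_on with
  | empty => simp
  | cons a s ih =>
    rw [Multiset.map_cons, Multiset.sections_cons, h a (by simp)]
    simpa using ih fun b hb => h b (by simp [hb])

theorem items_eq_zero {α : Type*} {w : Multiset (α × Finset ι)} {J : Finset ι}
    (h : J ∉ w.map Prod.snd) : items J w = 0 := by
  refine Multiset.eq_zero_of_forall_notMem fun x hx => h ?_
  exact Multiset.mem_map.2 ⟨_, mem_items.1 hx, rfl⟩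

end Good

end TwistedHurwitz

namespace TwistedHurwitz

section Polynomiality

variable {T σ ι : Type*} [DecidableEq ι]
variable {ev : T → σ → ℚ} {y : ι → T → ℕ} {w r r' : Multiset (Part T ι)} {a b : Part T ι}
  {J K : Finset ι}

theorem Good.card_colours_split (h : Good ev y (a ::ₘ r)) {K : Finset ι} (hK : K ⊂ a.2)
    (hK0 : K.Nonempty) (hr' : r' ∈ Multiset.Sections (r.map (recolour a.2 K)))
    (p q : (T → ℕ) × Bool) :
    (colours ((p, K) ::ₘ (q, a.2 \ K) ::ₘ r')).card = (colours (a ::ₘ r)).card + 1 := by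
  obtain ⟨e1, e2, e3⟩ := ne_of_proper hK hK0
  have hne : ∀ c ∈ a ::ₘ r, c.2 ≠ K ∧ c.2 ≠ a.2 \ K := fun c hc =>
    colour_ne_of_split h.adm hK hK0 hc
  have h1 : colours ((p, K) ::ₘ (q, a.2 \ K) ::ₘ r') =
      insert K (insert (a.2 \ K) ((colours (a ::ₘ r)).erase a.2)) := by
    ext L
    simp only [mem_colours, Finset.mem_insert, Finset.mem_erase, Multiset.mem_cons]
    constructor
    · rintro ⟨c, rfl | rfl | hc, rfl⟩
      · simp
      · simp
      · rcases colour_of_mem_recoloured hK hK0 hr' c hc with e | e | e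
        · exact .inl e
        · exact .inr (.inl e)
        · exact .inr (.inr ⟨e.1, c, .inr e.2, rfl⟩)
    · rintro (rfl | rfl | ⟨hL, c, rfl | hc, rfl⟩)
      · exact ⟨_, .inl rfl, rfl⟩
      · exact ⟨_, .inr (.inl rfl), rfl⟩
      · exact absurd rfl hL
      · have := (exists_mem_recoloured hr' c hc).resolve_left hL
        exact ⟨c, .inr (.inr this.2.2), rfl⟩
  have h2 : K ∉ colours (a ::ₘ r) := by
    rw [mem_colours]
    rintro ⟨c, hc, e⟩
    exact (hne c hc).1 e
  have h3 : a.2 \ K ∉ colours (a ::ₘ r) := by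
    rw [mem_colours]
    rintro ⟨c, hc, e⟩
    exact (hne c hc).2 e
  have h4 : a.2 ∈ colours (a ::ₘ r) := mem_colours.2 ⟨a, by simp, rfl⟩
  rw [h1, Finset.card_insert_of_notMem, Finset.card_insert_of_notMem]
  · have := Finset.card_erase_add_one h4
    omega
  · exact fun h => h3 (Finset.mem_of_mem_erase h)
  · rw [Finset.mem_insert, not_or]
    exact ⟨e3, fun h => h2 (Finset.mem_of_mem_erase h)⟩

omit [DecidableEq ι] in
theorem IsHom.unmarked (ha : IsHom ev 1 fun t => (a.1.1 t : ℚ)) :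
    IsHom ev (1 - if a.1.2 then 1 else 0) (unmarked a) := by
  obtain ⟨⟨f, b⟩, J⟩ := a
  cases b
  · exact ha.of_eq (by simp) rfl
  · exact (IsHom.const 1).of_eq (by simp) rfl

theorem Good.unmarked_pos (h : Good ev y w) (ha : a ∈ w) (t : T) : 0 < unmarked a t := by
  unfold TwistedHurwitz.unmarked
  split_ifs
  · exact one_pos
  · exact_mod_cast h.pos ha t

variable [Fintype ι]

/-- The degree of the polynomial that gives the coloured counts without stationary step. -/
def degree (w : Multiset (Part T ι)) : ℤ :=
  2 * w.card + Fintype.card ι - 3 * (colours w).card - markCard w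

section Terms

variable {S : ℤ → (T → ℚ) → Set (T → ℚ)}
  (hS : ∀ (d e : ℤ) (M N u f : T → ℚ), IsHom ev e u → (∀ t, 0 < u t) → f ∈ S d M →
    u * N * f ∈ S (e + d) (N * M))

include hS

theorem join_term_mem (h : Good ev y (a ::ₘ b ::ₘ r)) (hab : b.2 = a.2) {δ : ℤ} {V : T → ℚ}
    (hV : V ∈ S (degree (((a.1.1 + b.1.1, false), a.2) ::ₘ r) + δ)
      (markProd (((a.1.1 + b.1.1, false), a.2) ::ₘ r))) :
    (fun t => (a.1.1 t : ℚ) * (2 * b.1.1 t * V t)) ∈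
      S (degree (a ::ₘ b ::ₘ r) + δ) (markProd (a ::ₘ b ::ₘ r)) := by
  have h1 := hS _ _ _ (marked a * marked b) _ _
    (((IsHom.const 2).mul (IsHom.unmarked (h.lin a (by simp)))).mul
      (IsHom.unmarked (h.lin b (by simp))))
    (fun t => mul_pos (mul_pos two_pos (h.unmarked_pos (a := a) (by simp) t))
      (h.unmarked_pos (a := b) (by simp) t)) hV
  convert h1 using 1
  · congr 1
    · simp only [degree, markCard_cons, colours_cons, Multiset.card_cons, hab, Finset.insert_idem]
      push_cast
      simp
      ring
    · simp only [markProd_cons]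
      funext t
      simp [marked]
      ring_nf
  · funext t
    have := unmarked_mul_marked a t
    have := unmarked_mul_marked b t
    simp only [Pi.mul_apply]
    rw [← unmarked_mul_marked a t, ← unmarked_mul_marked b t]
    ring

theorem split_term_mem (h : Good ev y (a ::ₘ r)) {K : Finset ι} (hK : K ⊂ a.2)
    (hK0 : K.Nonempty) (hr' : r' ∈ Multiset.Sections (r.map (recolour a.2 K))) {p q : T → ℕ}
    {δ : ℤ} {V : T → ℚ}
    (hV : V ∈ S (degree (((p, false), K) ::ₘ ((q, false), a.2 \ K) ::ₘ r') + δ)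
      (markProd (((p, false), K) ::ₘ ((q, false), a.2 \ K) ::ₘ r'))) :
    (fun t => (a.1.1 t : ℚ) * V t) ∈ S (degree (a ::ₘ r) + δ) (markProd (a ::ₘ r)) := by
  have h1 := hS _ _ _ (marked a) _ _ (IsHom.unmarked (h.lin a (by simp)))
    (fun t => h.unmarked_pos (a := a) (by simp) t) hV
  have h2 := h.card_colours_split hK hK0 hr' (p, false) (q, false)
  have h3 := card_of_recoloured hr'
  have h4 := markCard_eq_of_map_fst (map_fst_of_recoloured hr')
  have h5 := markProd_eq_of_map_fst (map_fst_of_recoloured hr')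
  convert h1 using 1
  · congr 1
    · simp only [degree, h2]
      simp only [markCard_cons, Multiset.card_cons, h3, h4]
      push_cast
      simp
      ring
    · simp only [markProd_cons, h5]
      funext t
      simp [marked]
  · funext t
    simp only [Pi.mul_apply]
    rw [unmarked_mul_marked a t]

end Terms

theorem colCount_eq_zero_of_card_lt {y' : ι → ℕ} {m : ℕ} {v : Multiset (ℕ × Finset ι)}
    (h : m + 2 * (colours v).card < v.card + Fintype.card ι) : colCount y' m v = 0 := by
  by_contra h0
  have := card_le_of_colCount_ne_zero h0
  omega

omit [DecidableEq ι] [Fintype ι] in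
theorem card_evalAt (t : T) (w : Multiset (Part T ι)) : (evalAt t w).card = w.card := by
  simp [evalAt]

theorem balanced_split (hK : K ⊂ J) (hK0 : K.Nonempty) {y' : ι → ℕ} {m p q : ℕ} {t : T}
    (h0 : colCount y' m ((p, K) ::ₘ (q, J \ K) ::ₘ evalAt t r') ≠ 0) :
    p + formSum (forms K r') t = ∑ j ∈ K, y' j ∧
      q + formSum (forms (J \ K) r') t = ∑ j ∈ J \ K, y' j := by
  obtain ⟨e1, e2, e3⟩ := ne_of_proper hK hK0
  have hb := balanced_of_colCount_ne_zero h0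
  have h1 := hb.2 (p, K) (by simp)
  have h2 := hb.2 (q, J \ K) (by simp)
  simp only [items_cons, if_neg e3, if_neg e3.symm, if_true, Multiset.sum_cons,
    sum_items_evalAt] at h1 h2
  exact ⟨h1, h2⟩

omit [Fintype ι] in
theorem Good.forms_balanced (h : Good ev y (a ::ₘ r)) (hK : K ⊂ a.2)
    (hK0 : K.Nonempty) (hr' : r' ∈ Multiset.Sections (r.map (recolour a.2 K))) (t : T) :
    a.1.1 t + (formSum (forms K r') t + formSum (forms (a.2 \ K) r') t) =
      ∑ j ∈ a.2 \ K, y j t + ∑ j ∈ K, y j t := by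
  have hbal := h.bal a (by simp) t
  have hfa : forms a.2 (a ::ₘ r) = a.1.1 ::ₘ forms a.2 r := by simp [forms_cons]
  rwa [hfa, forms_of_recoloured hK hK0 hr', formSum_cons, formSum_add,
    ← Finset.sum_sdiff hK.1] at hbal

theorem Good.sum_split_eq (hy : ∀ j, IsHom ev 1 fun t => (y j t : ℚ)) (h : Good ev y (a ::ₘ r))
    (hK : K ⊂ a.2) (hK0 : K.Nonempty) (hr' : r' ∈ Multiset.Sections (r.map (recolour a.2 K)))
    (m : ℕ) {p q : T → ℕ} (hp : ∀ t, p t + formSum (forms K r') t = ∑ j ∈ K, y j t)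
    (hq : ∀ t, q t + formSum (forms (a.2 \ K) r') t = ∑ j ∈ a.2 \ K, y j t) (t : T) :
    ∑ p ∈ Finset.Ioo 0 (a.1.1 t), colCount (fun j => y j t) m
        ((p, K) ::ₘ (a.1.1 t - p, a.2 \ K) ::ₘ evalAt t r') = colCount (fun j => y j t) m
        (evalAt t (((p, false), K) ::ₘ ((q, false), a.2 \ K) ::ₘ r')) := by
  have hg := h.split hy hK hK0 hr' hp hq
  have hp0 := hg.pos (a := ((p, false), K)) (by simp) t
  have hq0 := hg.pos (a := ((q, false), a.2 \ K)) (by simp) t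
  have hb := h.forms_balanced hK hK0 hr' t
  have hpt := hp t
  have hqt := hq t
  rw [Finset.sum_eq_single (p t)]
  · rw [evalAt_cons, evalAt_cons]
    simp only
    congr 4
    omega
  · intro p' _ hp'
    by_contra h0
    have := (balanced_split hK hK0 h0).1
    omega
  · intro hp'
    rw [Finset.mem_Ioo] at hp'
    simp only at hp0 hq0
    omega

theorem Good.sum_split (h : Good ev y (a ::ₘ r))
    (hK : K ⊂ a.2) (hK0 : K.Nonempty) (hr' : r' ∈ Multiset.Sections (r.map (recolour a.2 K)))
    (m : ℕ) :
    (∀ t, ∑ p ∈ Finset.Ioo 0 (a.1.1 t), colCount (fun j => y j t) m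
      ((p, K) ::ₘ (a.1.1 t - p, a.2 \ K) ::ₘ evalAt t r') = 0) ∨
    ∃ p q : T → ℕ, (∀ t, p t + formSum (forms K r') t = ∑ j ∈ K, y j t) ∧
      ∀ t, q t + formSum (forms (a.2 \ K) r') t = ∑ j ∈ a.2 \ K, y j t := by
  obtain ⟨e1, e2, e3⟩ := ne_of_proper hK hK0
  have hna := h.nores a (by simp)
  have hfa : forms a.2 (a ::ₘ r) = a.1.1 ::ₘ forms a.2 r := by simp [forms_cons]
  rw [hfa, forms_of_recoloured hK hK0 hr'] at hna
  rcases hna (forms K r') ((Multiset.le_add_right _ _).trans (Multiset.le_cons_self _ _)) K hK.1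
    (.inr hK0.ne_empty) (.inr e1) with hlt | hlt
  swap
  · left
    intro t
    refine Finset.sum_eq_zero fun p _ => ?_
    by_contra h0
    have := (balanced_split hK hK0 h0).1
    have := hlt t
    omega
  rcases hna (forms (a.2 \ K) r') ((Multiset.le_add_left _ _).trans (Multiset.le_cons_self _ _))
    (a.2 \ K) Finset.sdiff_subset (.inr (Finset.sdiff_nonempty.2 hK.2).ne_empty) (.inr e2) with
    hlt' | hlt'
  swap
  · left
    intro t
    refine Finset.sum_eq_zero fun p _ => ?_
    by_contra h0
    have := (balanced_split hK hK0 h0).2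
    have := hlt' t
    omega
  exact .inr ⟨fun t => ∑ j ∈ K, y j t - formSum (forms K r') t,
    fun t => ∑ j ∈ a.2 \ K, y j t - formSum (forms (a.2 \ K) r') t,
    fun t => Nat.sub_add_cancel (hlt t).le, fun t => Nat.sub_add_cancel (hlt' t).le⟩

/-- The terms of `colCutJoin` that join the element `a` with another one. -/
noncomputable def joinTerms (g : Multiset (ℕ × Finset ι) → ℚ) (t : T) (a : Part T ι)
    (r : Multiset (Part T ι)) : ℚ :=
  pickSum (fun b r' => if b.2 = a.2 then
    (a.1.1 t : ℚ) * (2 * b.1.1 t * g (evalAt t (((a.1.1 + b.1.1, false), a.2) ::ₘ r'))) else 0) r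

/-- The terms of `colCutJoin` that cut the element `a` into parts of colours `K` and `a.2 \ K`. -/
noncomputable def splitTerm (g : Multiset (ℕ × Finset ι) → ℚ) (t : T) (a : Part T ι)
    (r : Multiset (Part T ι)) (K : Finset ι) : ℚ :=
  colSum (recolour a.2 K) (fun r' => (a.1.1 t : ℚ) *
    ∑ p ∈ Finset.Ioo 0 (a.1.1 t), g ((p, K) ::ₘ (a.1.1 t - p, a.2 \ K) ::ₘ evalAt t r')) r

/-- The part of `colCutJoin` that belongs to the element `a` and that joins or splits. -/
noncomputable def joinSplit (g : Multiset (ℕ × Finset ι) → ℚ) (t : T) (a : Part T ι)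
    (r : Multiset (Part T ι)) : ℚ :=
  joinTerms g t a r + ∑ K ∈ a.2.ssubsets.erase ∅, splitTerm g t a r K

theorem colCount_succ_evalAt (y' : ι → ℕ) (m : ℕ) (t : T) (w : Multiset (Part T ι))
    (h : m + 2 * (colours w).card < w.card + 1 + Fintype.card ι) :
    colCount y' (m + 1) (evalAt t w) = pickSum (fun a r => joinSplit (colCount y' m) t a r +
      (a.1.1 t : ℚ) * ((a.1.1 t : ℚ) - 1) * colCount y' m (evalAt t (a ::ₘ r))) w := by
  rw [colCount, colCutJoin, evalAt, pickSum_map]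
  refine pickSum_congr ?_
  rintro a r rfl
  have h0 : ∀ p, colCount y' m ((p, a.2) ::ₘ (a.1.1 t - p, a.2) ::ₘ
      Multiset.map (fun a => (a.1.1 t, a.2)) r) = 0 := by
    intro p
    apply colCount_eq_zero_of_card_lt
    have := colours_evalAt t r
    rw [evalAt] at this
    simp only [colours_cons, Finset.insert_idem, Multiset.card_cons, Multiset.card_map, this] at h ⊢
    omega
  simp only [h0, Finset.sum_const_zero, add_zero]
  rw [mul_add, mul_add, joinSplit, joinTerms, mul_assoc, evalAt_cons]
  congr 1
  congr 1
  · rw [pickSum_map, ← pickSum_mul_left]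
    refine pickSum_congr fun b r' _ => ?_
    simp only [mul_ite, mul_zero, evalAt_cons]
    rfl
  · rw [Finset.mul_sum]
    refine Finset.sum_congr rfl fun K _ => ?_
    rw [← colSum_sum, splitTerm, colSum_map (f' := fun a : Part T ι => (a.1.1 t, a.2))
      (φ := recolour a.2 K), ← colSum_mul_left]
    · rfl
    · intro b
      unfold recolour
      simp only
      split_ifs <;> simp [Multiset.insert_eq_cons]

section Membership

variable {S : ℤ → (T → ℚ) → AddSubmonoid (T → ℚ)}
  (hS : ∀ (d e : ℤ) (M N u f : T → ℚ), IsHom ev e u → (∀ t, 0 < u t) → f ∈ S d M →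
    u * N * f ∈ S (e + d) (N * M)) {m : ℕ} {δ : ℤ} (h : Good ev y (a ::ₘ r))
  (H : ∀ w', Good ev y w' →
    (w'.card : ℤ) - 2 * (colours w').card + 1 = (a ::ₘ r).card - 2 * (colours (a ::ₘ r)).card →
    (fun t => colCount (fun j => y j t) m (evalAt t w')) ∈ S (degree w' + δ) (markProd w'))

include hS

theorem joinTerm_mem (h : Good ev y (a ::ₘ b ::ₘ r))
    (H : ∀ w', Good ev y w' → (w'.card : ℤ) - 2 * (colours w').card + 1 =
      (a ::ₘ b ::ₘ r).card - 2 * (colours (a ::ₘ b ::ₘ r)).card →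
    (fun t => colCount (fun j => y j t) m (evalAt t w')) ∈ S (degree w' + δ) (markProd w')) :
    (fun t => if b.2 = a.2 then (a.1.1 t : ℚ) * (2 * b.1.1 t * colCount (fun j => y j t) m
      (evalAt t (((a.1.1 + b.1.1, false), a.2) ::ₘ r))) else 0) ∈
      S (degree (a ::ₘ b ::ₘ r) + δ) (markProd (a ::ₘ b ::ₘ r)) := by
  by_cases hab : b.2 = a.2
  · simp only [hab, if_true]
    refine join_term_mem (S := fun d M => (S d M : Set (T → ℚ))) hS h hab (H _ (h.join hab) ?_)
    simp only [colours_cons, hab, Finset.insert_idem, Multiset.card_cons]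
    push_cast
    ring
  · simp only [hab, if_false]
    exact zero_mem _

include h H

theorem joinSplit_join_mem :
    (fun t => joinTerms (colCount (fun j => y j t) m) t a r) ∈
      S (degree (a ::ₘ r) + δ) (markProd (a ::ₘ r)) := by
  refine pickSum_mem _ ?_
  rintro b r' rfl
  exact joinTerm_mem hS h H

theorem splitTerm_section_mem (hy : ∀ j, IsHom ev 1 fun t => (y j t : ℚ)) (hK : K ⊂ a.2)
    (hK0 : K.Nonempty) (hr' : r' ∈ Multiset.Sections (r.map (recolour a.2 K))) :
    (fun t => (a.1.1 t : ℚ) * ∑ p ∈ Finset.Ioo 0 (a.1.1 t), colCount (fun j => y j t) m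
      ((p, K) ::ₘ (a.1.1 t - p, a.2 \ K) ::ₘ evalAt t r')) ∈
      S (degree (a ::ₘ r) + δ) (markProd (a ::ₘ r)) := by
  rcases h.sum_split hK hK0 hr' m with h0 | ⟨p, q, hp, hq⟩
  · simp only [h0, mul_zero]
    exact zero_mem _
  · simp only [h.sum_split_eq hy hK hK0 hr' m hp hq]
    refine split_term_mem (S := fun d M => (S d M : Set (T → ℚ))) hS h hK hK0 hr'
      (H _ (h.split hy hK hK0 hr' hp hq) ?_)
    rw [h.card_colours_split hK hK0 hr']
    simp only [Multiset.card_cons, card_of_recoloured hr']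
    push_cast
    ring

theorem joinSplit_split_mem (hy : ∀ j, IsHom ev 1 fun t => (y j t : ℚ)) :
    ∀ K ∈ a.2.ssubsets.erase ∅, (fun t => splitTerm (colCount (fun j => y j t) m) t a r K) ∈
      S (degree (a ::ₘ r) + δ) (markProd (a ::ₘ r)) := by
  intro K hK
  rw [Finset.mem_erase, Finset.mem_ssubsets] at hK
  exact colSum_mem _ fun r' hr' => splitTerm_section_mem hS h H hy hK.2
    (Finset.nonempty_iff_ne_empty.2 hK.1) hr'

theorem joinSplit_mem (hy : ∀ j, IsHom ev 1 fun t => (y j t : ℚ)) :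
    (fun t => joinSplit (colCount (fun j => y j t) m) t a r) ∈
      S (degree (a ::ₘ r) + δ) (markProd (a ::ₘ r)) := by
  refine add_mem (joinSplit_join_mem hS h H) ?_
  have := sum_mem (joinSplit_split_mem hS h H hy)
  convert this using 1
  funext t
  rw [Finset.sum_apply]

end Membership

theorem Good.base (h : Good ev y w)
    (hc : w.card + Fintype.card ι = 2 * (colours w).card) :
    (∀ t, evalAt t w = target fun j => y j t) ∧ markProd w = 1 ∧ degree w = 0 := by
  have h1 := card_colours_le w
  have h2 := card_colours_le_card h
  have h3 : (w.map Prod.snd).Nodup := card_eq_card_colours_iff.1 (by omega)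
  have h4 : ∀ a ∈ w, a.2.card = 1 := by
    have hs := sum_card_colours h.adm h.cover
    have h5 : ∑ J ∈ colours w, 1 = ∑ J ∈ colours w, J.card := by
      rw [hs, ← Finset.card_eq_sum_ones]
      omega
    have h6 := (Finset.sum_eq_sum_iff_of_le (fun J hJ => by
      obtain ⟨a, ha, rfl⟩ := mem_colours.1 hJ
      exact (h.adm.1 a ha).card_pos)).1 h5
    exact fun a ha => (h6 a.2 (mem_colours.2 ⟨a, ha, rfl⟩)).symm
  have h5 : ∀ a r, w = a ::ₘ r → items a.2 w = {a.1} := by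
    rintro a r rfl
    rw [items_cons, if_pos rfl, items_eq_zero (w := r)]
    · rfl
    · rw [Multiset.map_cons, Multiset.nodup_cons] at h3
      exact h3.1
  have h6 : ∀ a ∈ w, a.1.2 = false := by
    intro a ha
    obtain ⟨r, hr⟩ := Multiset.exists_cons_of_mem ha
    by_contra hm
    have := h.mark a ha (by simpa using hm)
    rw [h4 a ha, h5 a r hr] at this
    simp at this
  have h7 : markProd w = 1 := by
    funext t
    rw [markProd, Multiset.prod_eq_one]
    · rfl
    · intro x hx
      obtain ⟨a, ha, rfl⟩ := Multiset.mem_map.1 hx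
      simp [h6 a ha]
  have h8 : markCard w = 0 := by
    rw [markCard, Multiset.sum_eq_zero]
    intro x hx
    obtain ⟨a, ha, rfl⟩ := Multiset.mem_map.1 hx
    simp [h6 a ha]
  refine ⟨fun t => ?_, h7, by rw [degree, h8]; omega⟩
  symm
  refine Multiset.eq_of_le_of_card_le ((Multiset.le_iff_subset ?_).2 ?_) ?_
  · refine Multiset.Nodup.map ?_ Finset.univ.nodup
    intro i j h
    simpa using congrArg Prod.snd h
  · intro x hx
    obtain ⟨j, -, rfl⟩ := Multiset.mem_map.1 hx
    obtain ⟨a, ha, hj⟩ := h.cover j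
    obtain ⟨r, hr⟩ := Multiset.exists_cons_of_mem ha
    obtain ⟨j', hj'⟩ := Finset.card_eq_one.1 (h4 a ha)
    have hjj : j = j' := by rw [hj'] at hj; simpa using hj
    subst hjj
    have hb := h.bal a ha t
    rw [forms, h5 a r hr, hj'] at hb
    refine Multiset.mem_map.2 ⟨a, ha, ?_⟩
    rw [hj']
    simpa [formSum] using hb
  · rw [card_evalAt, target, Multiset.card_map, Finset.card_val, Finset.card_univ]
    omega

/-- Without stationary step, the coloured counts are positive and given by a homogeneous
polynomial. -/
theorem colCount_mem_homPos (hy : ∀ j, IsHom ev 1 fun t => (y j t : ℚ)) (m : ℕ)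
    (h : Good ev y w) (hm : w.card + Fintype.card ι = m + 2 * (colours w).card) :
    (fun t => colCount (fun j => y j t) m (evalAt t w)) ∈ homPos ev (degree w) (markProd w) := by
  induction m generalizing w with
  | zero =>
    obtain ⟨h1, h2, h3⟩ := h.base (by omega)
    refine ⟨fun _ => 1, (IsHom.const 1).of_eq h3.symm rfl, fun _ => one_pos, ?_⟩
    funext t
    simp [h1, h2, colCount]
  | succ m ih =>
    have hstay : ∀ t, colCount (fun j => y j t) m (evalAt t w) = 0 := fun t =>
      colCount_eq_zero_of_card_lt (by rw [colours_evalAt, card_evalAt]; omega)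
    have hexp : (fun t => colCount (fun j => y j t) (m + 1) (evalAt t w)) = fun t =>
        pickSum (fun a r => joinSplit (colCount (fun j => y j t) m) t a r) w := by
      funext t
      rw [colCount_succ_evalAt _ _ _ _ (by omega)]
      refine pickSum_congr ?_
      rintro a r rfl
      rw [hstay, mul_zero, add_zero]
    have hmul := fun (d e : ℤ) (M N u f : T → ℚ) (hu : IsHom ev e u) (hu0 : ∀ t, 0 < u t)
      (hf : f ∈ homSubmonoid ev d M) => homSubmonoid_mul (N := N) hu (fun t => (hu0 t).le) hf
    have hmul' := fun (d e : ℤ) (M N u f : T → ℚ) (hu : IsHom ev e u) (hu0 : ∀ t, 0 < u t)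
      (hf : f ∈ homPos ev d M) => homPos_mul (N := N) hu hu0 hf
    have hmem : ∀ a r, w = a ::ₘ r → (fun t => joinSplit (colCount (fun j => y j t) m) t a r) ∈
        homSubmonoid ev (degree w) (markProd w) := by
      rintro a r rfl
      have := joinSplit_mem (S := homSubmonoid ev) (δ := 0) (m := m) hmul h (fun w' hw' hc => by
        rw [add_zero]
        exact homPos_subset (ih hw' (by omega))) hy
      simpa using this
    rw [hexp]
    refine pickSum_mem_of_exists (fun f hf g hg => homPos_add hf hg) hmem ?_
    by_cases hnd : (w.map Prod.snd).Nodup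
    · have hcw := card_eq_card_colours_iff.2 hnd
      obtain ⟨a, ha, ha2⟩ : ∃ a ∈ w, 2 ≤ a.2.card := by
        by_contra! hlt
        have hs := sum_card_colours h.adm h.cover
        have : ∑ J ∈ colours w, J.card ≤ ∑ J ∈ colours w, 1 := by
          refine Finset.sum_le_sum fun J hJ => ?_
          obtain ⟨a, ha, rfl⟩ := mem_colours.1 hJ
          have := hlt a ha
          omega
        rw [hs, ← Finset.card_eq_sum_ones] at this
        omega
      obtain ⟨r, rfl⟩ := Multiset.exists_cons_of_mem ha
      refine ⟨a, r, rfl, ?_⟩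
      obtain ⟨j, hj⟩ := h.adm.1 a ha
      have hKJ : ({j} : Finset ι) ⊂ a.2 := by
        refine ⟨by simpa using hj, fun hs => ?_⟩
        have := Finset.card_le_card hs
        simp at this
        omega
      have hK0 : ({j} : Finset ι).Nonempty := by simp
      have hd0 : (a.2 \ {j}).Nonempty := Finset.sdiff_nonempty.2 hKJ.2
      have hr : r ∈ Multiset.Sections (r.map (recolour a.2 {j})) := by
        refine self_mem_sections fun b hb => ?_
        have hb1 := colour_ne_of_split h.adm hKJ hK0 (c := b) (by simp [hb])
        have hb2 : b.2 ≠ a.2 := by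
          rw [Multiset.map_cons, Multiset.nodup_cons] at hnd
          exact fun e => hnd.1 (Multiset.mem_map.2 ⟨b, hb, e⟩)
        simp [recolour, hb1, hb2]
      have hf0 : ∀ L : Finset ι, L ∉ r.map Prod.snd → forms L r = 0 := by
        intro L hL
        rw [forms, items_eq_zero hL]
        rfl
      have hK1 : forms {j} r = 0 := hf0 _ fun hm => by
        obtain ⟨b, hb, e⟩ := Multiset.mem_map.1 hm
        exact (colour_ne_of_split h.adm hKJ hK0 (c := b) (by simp [hb])).1 e
      have hK2 : forms (a.2 \ {j}) r = 0 := hf0 _ fun hm => by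
        obtain ⟨b, hb, e⟩ := Multiset.mem_map.1 hm
        exact (colour_ne_of_split h.adm hKJ hK0 (c := b) (by simp [hb])).2 e
      have hp : ∀ t, y j t + formSum (forms {j} r) t = ∑ i ∈ ({j} : Finset ι), y i t := by
        simp [hK1]
      have hq : ∀ t, ∑ i ∈ a.2 \ {j}, y i t + formSum (forms (a.2 \ {j}) r) t =
          ∑ i ∈ a.2 \ {j}, y i t := by
        simp [hK2]
      have hfinal : (fun t => (a.1.1 t : ℚ) * ∑ p ∈ Finset.Ioo 0 (a.1.1 t),
          colCount (fun j => y j t) m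
          ((p, {j}) ::ₘ (a.1.1 t - p, a.2 \ {j}) ::ₘ evalAt t r)) ∈
          homPos ev (degree (a ::ₘ r)) (markProd (a ::ₘ r)) := by
        simp only [h.sum_split_eq hy hKJ hK0 hr m hp hq]
        have := split_term_mem (S := homPos ev) (δ := 0) hmul' h hKJ hK0 hr
          (by rw [add_zero]; exact ih (h.split hy hKJ hK0 hr hp hq) (by
            rw [h.card_colours_split hKJ hK0 hr]
            simp only [Multiset.card_cons] at hm ⊢
            omega))
        simpa using this
      have h1 := joinSplit_split_mem (δ := 0) (m := m) hmul h (fun w' hw' hc => by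
        rw [add_zero]
        exact homPos_subset (ih hw' (by omega))) hy
      have h2 := joinSplit_join_mem (δ := 0) (m := m) hmul h fun w' hw' hc => by
        rw [add_zero]
        exact homPos_subset (ih hw' (by omega))
      simp only [add_zero] at h1 h2
      have h3 : (fun t => ∑ K ∈ a.2.ssubsets.erase ∅, splitTerm (colCount (fun j => y j t) m) t a r K)
          ∈ homPos ev (degree (a ::ₘ r)) (markProd (a ::ₘ r)) := by
        have hj : ({j} : Finset ι) ∈ a.2.ssubsets.erase ∅ := by
          rw [Finset.mem_erase, Finset.mem_ssubsets]
          exact ⟨hK0.ne_empty, hKJ⟩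
        have : (fun t => ∑ K ∈ a.2.ssubsets.erase ∅,
            splitTerm (colCount (fun j => y j t) m) t a r K) =
            (fun t => splitTerm (colCount (fun j => y j t) m) t a r {j}) +
            ∑ K ∈ (a.2.ssubsets.erase ∅).erase {j},
              fun t => splitTerm (colCount (fun j => y j t) m) t a r K := by
          funext t
          rw [← Finset.add_sum_erase _ _ hj, Pi.add_apply, Finset.sum_apply]
        rw [this]
        refine homPos_add ?_ (sum_mem fun K hK => h1 K (Finset.mem_of_mem_erase hK))
        exact colSum_mem_of_exists (fun f hf g hg => homPos_add hf hg)
          (fun r' hr' => by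
            have := splitTerm_section_mem (δ := 0) (m := m) hmul h (fun w' hw' hc => by
              rw [add_zero]
              exact homPos_subset (ih hw' (by omega))) hy hKJ hK0 hr'
            rwa [add_zero] at this) ⟨r, hr, hfinal⟩
      have h4 := homPos_add h3 h2
      rw [add_comm] at h4
      exact h4
    · obtain ⟨a, b, r, rfl, hab⟩ := exists_same_colour hnd
      refine ⟨a, b ::ₘ r, rfl, ?_⟩
      have h1 := joinSplit_split_mem (δ := 0) (m := m) hmul h (fun w' hw' hc => by
        rw [add_zero]
        exact homPos_subset (ih hw' (by omega))) hy
      simp only [add_zero] at h1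
      have h2 : (fun t => joinTerms (colCount (fun j => y j t) m) t a (b ::ₘ r)) ∈
          homPos ev (degree (a ::ₘ b ::ₘ r)) (markProd (a ::ₘ b ::ₘ r)) := by
        refine pickSum_mem_of_exists (fun f hf g hg => homPos_add hf hg) (fun c r' hr' => by
          rw [hr'] at h hm ⊢
          have := joinTerm_mem (S := homSubmonoid ev) (m := m) (δ := 0) hmul h
            fun w' hw' hc => by
              rw [add_zero]
              exact homPos_subset (ih hw' (by omega))
          rwa [add_zero] at this) ⟨b, r, rfl, ?_⟩
        simp only [hab, if_true]
        have := join_term_mem (S := homPos ev) (δ := 0) hmul' h hab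
          (by rw [add_zero]; exact ih (h.join hab) (by
            simp only [colours_cons, hab, Finset.insert_idem, Multiset.card_cons] at hm ⊢
            omega))
        simpa using this
      exact homPos_add h2 (by
        have := sum_mem h1
        convert this using 1
        funext t
        rw [Finset.sum_apply])

/-- With one stationary step, the coloured counts are the difference of two positive homogeneous
polynomials. -/
theorem colCount_mem_twoPos (hι : Nonempty ι) (hy : ∀ j, IsHom ev 1 fun t => (y j t : ℚ)) (m : ℕ)
    (h : Good ev y w) (hm : w.card + Fintype.card ι + 1 = m + 2 * (colours w).card) :
    (fun t => colCount (fun j => y j t) m (evalAt t w)) ∈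
      twoPos ev (degree w + 1) (markProd w) := by
  induction m generalizing w with
  | zero =>
    have h1 := card_colours_le w
    have h2 := card_colours_le_card h
    omega
  | succ m ih =>
    have hexp : (fun t => colCount (fun j => y j t) (m + 1) (evalAt t w)) = fun t =>
        pickSum (fun a r => joinSplit (colCount (fun j => y j t) m) t a r +
          (a.1.1 t : ℚ) * ((a.1.1 t : ℚ) - 1) * colCount (fun j => y j t) m
            (evalAt t (a ::ₘ r))) w := by
      funext t
      rw [colCount_succ_evalAt _ _ _ _ (by omega)]
    have hmul := fun (d e : ℤ) (M N u f : T → ℚ) (hu : IsHom ev e u) (hu0 : ∀ t, 0 < u t)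
      (hf : f ∈ twoSubmonoid ev d M) => twoSubmonoid_mul (N := N) hu (fun t => (hu0 t).le) hf
    have hmem : ∀ a r, w = a ::ₘ r → (fun t => joinSplit (colCount (fun j => y j t) m) t a r +
          (a.1.1 t : ℚ) * ((a.1.1 t : ℚ) - 1) * colCount (fun j => y j t) m
            (evalAt t (a ::ₘ r))) ∈ twoPos ev (degree w + 1) (markProd w) := by
      rintro a r rfl
      have h1 := joinSplit_mem (S := twoSubmonoid ev) (δ := 1) (m := m) hmul h
        (fun w' hw' hc => twoPos_subset (ih hw' (by omega))) hy
      have h2 := colCount_mem_homPos hy m h.unmark (by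
        simp only [colours_cons, Multiset.card_cons] at hm ⊢
        omega)
      have h3 : (fun t => (a.1.1 t : ℚ) * ((a.1.1 t : ℚ) - 1) * colCount (fun j => y j t) m
            (evalAt t (a ::ₘ r))) ∈
          twoPos ev (degree (a ::ₘ r) + 1) (markProd (a ::ₘ r)) := by
        have hd : degree (((a.1.1, false), a.2) ::ₘ r) =
            degree (a ::ₘ r) + if a.1.2 then 1 else 0 := by
          simp only [degree, markCard_cons, colours_cons, Multiset.card_cons]
          simp
          ring
        have hM : marked a * markProd (((a.1.1, false), a.2) ::ₘ r) = markProd (a ::ₘ r) := by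
          simp only [markProd_cons]
          funext t
          simp [marked]
        have ha := h.lin a (by simp)
        have hu := IsHom.unmarked ha
        have hu0 := fun t => h.unmarked_pos (a := a) (by simp) t
        have ha0 : ∀ t, (0 : ℚ) < a.1.1 t := fun t => by
          exact_mod_cast h.pos (a := a) (by simp) t
        refine ⟨(unmarked a * fun t => (a.1.1 t : ℚ)) * marked a *
            fun t => colCount (fun j => y j t) m (evalAt t (((a.1.1, false), a.2) ::ₘ r)), ?_,
          unmarked a * marked a *
            fun t => colCount (fun j => y j t) m (evalAt t (((a.1.1, false), a.2) ::ₘ r)), ?_, ?_⟩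
        · have := homPos_mul (N := marked a) (hu.mul ha) (fun t => mul_pos (hu0 t) (ha0 t)) h2
          rw [hM, hd] at this
          convert this using 2
          ring
        · have := homPos_mul (N := marked a) hu hu0 h2
          rw [hM, hd] at this
          convert this using 2
          ring
        · funext t
          simp only [Pi.mul_apply, Pi.sub_apply, evalAt_cons]
          rw [← unmarked_mul_marked a t]
          ring
      convert twoPos_add h3 h1 using 1
      funext t
      exact add_comm _ _
    obtain ⟨a, ha, -⟩ := h.cover hι.some
    obtain ⟨r, hr⟩ := Multiset.exists_cons_of_mem ha
    rw [hexp]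
    exact pickSum_mem_of_exists (fun f hf g hg => twoPos_add hf hg)
      (fun a r hr => twoPos_subset (hmem a r hr)) ⟨a, r, hr, hmem a r hr⟩

end Polynomiality

end TwistedHurwitz

namespace TwistedHurwitz

section Chambers

variable {k l : ℕ}

/-- The linear form that vanishes on the wall of `I` and `J`. -/
noncomputable def wallForm (I : Finset (Fin k)) (J : Finset (Fin l)) (z : Fin k ⊕ Fin l → ℝ) : ℝ :=
  ∑ i ∈ I, z (Sum.inl i) - ∑ j ∈ J, z (Sum.inr j)

theorem wallForm_ne_zero {z : Fin k ⊕ Fin l → ℝ} (hz : z ∈ resonanceComplement k l)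
    {I : Finset (Fin k)} {J : Finset (Fin l)} (h0 : I.Nonempty ∨ J.Nonempty)
    (h1 : I ≠ Finset.univ ∨ J ≠ Finset.univ) : wallForm I J z ≠ 0 := by
  obtain ⟨hpos, hsum, hw⟩ := hz
  have hlt : ∀ {κ : Type} [Fintype κ] (f : κ → ℝ) (S : Finset κ), (∀ s, 0 < f s) →
      S ≠ Finset.univ → ∑ s ∈ S, f s < ∑ s, f s := by
    intro κ _ f S hf hS
    obtain ⟨s, hs⟩ : ∃ s, s ∉ S := by
      by_contra! h'
      exact hS (Finset.eq_univ_iff_forall.2 h')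
    exact Finset.sum_lt_sum_of_subset (Finset.subset_univ S) (Finset.mem_univ s) hs (hf s)
      (fun t _ _ => (hf t).le)
  unfold wallForm
  rw [sub_ne_zero]
  rcases Finset.eq_empty_or_nonempty I with rfl | hI
  · have := Finset.sum_pos (fun j _ => hpos (Sum.inr j)) (h0.resolve_left (by simp))
    rw [Finset.sum_empty]
    exact this.ne
  rcases Finset.eq_empty_or_nonempty J with rfl | hJ
  · have := Finset.sum_pos (fun i _ => hpos (Sum.inl i)) hI
    rw [Finset.sum_empty]
    exact this.ne'
  by_cases hI' : I = Finset.univ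
  · subst hI'
    have := hlt (fun j => z (Sum.inr j)) J (fun j => hpos _) (h1.resolve_left (by simp))
    rw [hsum]
    exact this.ne'
  by_cases hJ' : J = Finset.univ
  · subst hJ'
    have := hlt (fun i => z (Sum.inl i)) I (fun i => hpos _) hI'
    rw [← hsum]
    exact this.ne
  exact hw I J hI hI' hJ hJ'

theorem continuous_wallForm (I : Finset (Fin k)) (J : Finset (Fin l)) :
    Continuous (wallForm I J) := by
  unfold wallForm
  fun_prop

/-- A chamber consists of the points at which all wall forms have given signs. -/
theorem mem_chamber_iff {p z : Fin k ⊕ Fin l → ℝ} (hp : p ∈ resonanceComplement k l) :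
    z ∈ connectedComponentIn (resonanceComplement k l) p ↔
      (∀ s, 0 < z s) ∧ ∑ i, z (Sum.inl i) = ∑ j, z (Sum.inr j) ∧
      ∀ (I : Finset (Fin k)) (J : Finset (Fin l)), (I.Nonempty ∨ J.Nonempty) →
        (I ≠ Finset.univ ∨ J ≠ Finset.univ) → 0 < wallForm I J z * wallForm I J p := by
  constructor
  · intro hz
    have hzR := connectedComponentIn_subset _ _ hz
    refine ⟨hzR.1, hzR.2.1, fun I J h0 h1 => ?_⟩
    have hpre : IsPreconnected (wallForm I J '' connectedComponentIn (resonanceComplement k l) p) :=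
      isPreconnected_connectedComponentIn.image _ (continuous_wallForm I J).continuousOn
    have hord := hpre.ordConnected
    have hz' : wallForm I J z ∈ wallForm I J '' connectedComponentIn (resonanceComplement k l) p :=
      ⟨z, hz, rfl⟩
    have hp' : wallForm I J p ∈ wallForm I J '' connectedComponentIn (resonanceComplement k l) p :=
      ⟨p, mem_connectedComponentIn hp, rfl⟩
    have h0' : (0 : ℝ) ∉ wallForm I J '' connectedComponentIn (resonanceComplement k l) p := by
      rintro ⟨q, hq, h⟩
      exact wallForm_ne_zero (connectedComponentIn_subset _ _ hq) h0 h1 h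
    by_contra hle
    rcases mul_nonpos_iff.1 (not_lt.1 hle) with h | h
    · exact h0' (hord.out hp' hz' ⟨h.2, h.1⟩)
    · exact h0' (hord.out hz' hp' ⟨h.1, h.2⟩)
  · rintro ⟨hpos, hsum, hw⟩
    have hseg : segment ℝ p z ⊆ resonanceComplement k l := by
      rintro _ ⟨a, b, ha, hb, hab, rfl⟩
      have hcomb : ∀ I J, wallForm I J (a • p + b • z) =
          a * wallForm I J p + b * wallForm I J z := by
        intro I J
        simp only [wallForm, Pi.add_apply, Pi.smul_apply, smul_eq_mul, Finset.sum_add_distrib,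
          ← Finset.mul_sum]
        ring
      refine ⟨fun s => ?_, ?_, ?_⟩
      · simp only [Pi.add_apply, Pi.smul_apply, smul_eq_mul]
        rcases ha.eq_or_lt with h | h
        · have : b = 1 := by linarith
          simp [← h, this, hpos s]
        · have := mul_pos h (hp.1 s)
          have := mul_nonneg hb (hpos s).le
          linarith
      · have := hcomb Finset.univ Finset.univ
        have e1 : wallForm Finset.univ Finset.univ p = 0 := sub_eq_zero.2 hp.2.1
        have e2 : wallForm Finset.univ Finset.univ z = 0 := sub_eq_zero.2 hsum
        rw [e1, e2, mul_zero, mul_zero, add_zero] at this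
        exact sub_eq_zero.1 this
      · intro I J hI hI' hJ hJ'
        have hs := hw I J (.inl hI) (.inl hI')
        rw [← sub_ne_zero]
        change wallForm I J (a • p + b • z) ≠ 0
        rw [hcomb]
        intro h
        have h2 : (a * wallForm I J p + b * wallForm I J z) * wallForm I J p = 0 := by
          rw [h, zero_mul]
        have hpp : 0 < wallForm I J p * wallForm I J p := by
          have : wallForm I J p ≠ 0 := fun h0 => by simp [h0] at hs
          exact mul_self_pos.2 this
        rcases ha.eq_or_lt with h3 | h3
        · have : b = 1 := by linarith
          rw [← h3, this] at h2
          linarith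
        · have := mul_pos h3 hpp
          have := mul_nonneg hb hs.le
          nlinarith
    exact ((convex_segment p z).isPreconnected.subset_connectedComponentIn
      (left_mem_segment ℝ p z) hseg) (right_mem_segment ℝ p z)

/-- The point with given integral coordinates. -/
def toPoint (q : (Fin k → ℕ) × (Fin l → ℕ)) (s : Fin k ⊕ Fin l) : ℝ :=
  ((Sum.elim q.1 q.2 s : ℕ) : ℝ)

/-- The integral points of `C`. -/
abbrev IntegralPoint (C : Set (Fin k ⊕ Fin l → ℝ)) :=
  {q : (Fin k → ℕ) × (Fin l → ℕ) // toPoint q ∈ C}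

/-- The rational coordinates of an integral point. -/
def coords {C : Set (Fin k ⊕ Fin l → ℝ)} (t : IntegralPoint C) (s : Fin k ⊕ Fin l) : ℚ :=
  ((Sum.elim t.1.1 t.1.2 s : ℕ) : ℚ)

theorem wallForm_toPoint (I : Finset (Fin k)) (J : Finset (Fin l))
    (q : (Fin k → ℕ) × (Fin l → ℕ)) :
    wallForm I J (toPoint q) = ((∑ i ∈ I, q.1 i : ℕ) : ℝ) - ((∑ j ∈ J, q.2 j : ℕ) : ℝ) := by
  simp [wallForm, toPoint]

theorem nonResonant_of_mem {q : (Fin k → ℕ) × (Fin l → ℕ)}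
    (h : toPoint q ∈ resonanceComplement k l) : NonResonant q.1 q.2 := by
  obtain ⟨h1, h2, h3⟩ := h
  refine ⟨fun i => ?_, fun j => ?_, ?_, fun I J hI hI' hJ hJ' => ?_⟩
  · have := h1 (Sum.inl i)
    simpa [toPoint] using this
  · have := h1 (Sum.inr j)
    simpa [toPoint] using this
  · simp only [toPoint, Sum.elim_inl, Sum.elim_inr] at h2
    exact_mod_cast h2
  · have := h3 I J hI hI' hJ hJ'
    simp only [toPoint, Sum.elim_inl, Sum.elim_inr] at this
    exact_mod_cast this

theorem exists_finset_of_le_map {α β : Type*} [DecidableEq α] {f : α → β} {s : Multiset α}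
    {Z : Multiset β} (h : Z ≤ s.map f) : ∃ s' ≤ s, Z = s'.map f := by
  classical
  induction s using Multiset.induction_on generalizing Z with
  | empty => exact ⟨0, le_rfl, by simpa using h⟩
  | cons a s ih =>
    rw [Multiset.map_cons] at h
    by_cases ha : f a ∈ Z
    · obtain ⟨Z', rfl⟩ := Multiset.exists_cons_of_mem ha
      obtain ⟨s', hs', rfl⟩ := ih ((Multiset.cons_le_cons_iff _).1 h)
      exact ⟨a ::ₘ s', (Multiset.cons_le_cons_iff _).2 hs', by simp⟩
    · obtain ⟨s', hs', rfl⟩ := ih ((Multiset.le_cons_of_notMem ha).1 h)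
      exact ⟨s', hs'.trans (Multiset.le_cons_self _ _), rfl⟩

variable {C : Set (Fin k ⊕ Fin l → ℝ)}

/-- The symbolic partition whose parts are the first coordinates. -/
def initial (C : Set (Fin k ⊕ Fin l → ℝ)) (mark : Bool) :
    Multiset (Part (IntegralPoint C) (Fin l)) :=
  Finset.univ.val.map fun i => ((fun t => t.1.1 i, mark), Finset.univ)

/-- The second coordinates. -/
def outputs (C : Set (Fin k ⊕ Fin l → ℝ)) (j : Fin l) (t : IntegralPoint C) : ℕ := t.1.2 j

theorem isHom_coord (s : Fin k ⊕ Fin l) :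
    IsHom (coords (C := C)) 1 fun t => ((Sum.elim t.1.1 t.1.2 s : ℕ) : ℚ) :=
  .inr ⟨1, rfl, MvPolynomial.X s, MvPolynomial.isHomogeneous_X _ _, fun t => by
    simp [coords]⟩

theorem forms_initial (mark : Bool) :
    forms Finset.univ (initial C mark) = Finset.univ.val.map fun i t => t.1.1 i := by
  rw [forms, initial, items_map, Multiset.map_map]
  simp

theorem good_initial (hk : 1 ≤ k) (hl : 1 ≤ l) (hC : IsChamber C) {mark : Bool}
    (hm : mark = true → 2 ≤ l ∨ 2 ≤ k) : Good coords (outputs C) (initial C mark) := by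
  obtain ⟨p, hp, rfl⟩ := hC
  have hmem : ∀ a ∈ initial (connectedComponentIn (resonanceComplement k l) p) mark,
      a.2 = Finset.univ ∧ a.1.2 = mark := by
    intro a ha
    obtain ⟨i, -, rfl⟩ := Multiset.mem_map.1 ha
    exact ⟨rfl, rfl⟩
  have hne : (Finset.univ : Finset (Fin l)).Nonempty := ⟨⟨0, hl⟩, Finset.mem_univ _⟩
  refine ⟨?_, ⟨?_, ?_⟩, ?_, ?_, ?_, ?_⟩
  · intro a ha
    obtain ⟨i, -, rfl⟩ := Multiset.mem_map.1 ha
    exact isHom_coord (Sum.inl i)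
  · intro a ha
    rw [(hmem a ha).1]
    exact hne
  · intro a ha b hb
    rw [(hmem a ha).1, (hmem b hb).1]
    exact .inl rfl
  · intro j
    exact ⟨_, Multiset.mem_map.2 ⟨⟨0, hk⟩, Finset.mem_univ_val _, rfl⟩, Finset.mem_univ _⟩
  · intro a ha t
    rw [(hmem a ha).1, forms_initial]
    have := (nonResonant_of_mem (connectedComponentIn_subset _ _ t.2)).2.2.1
    rw [formSum, Multiset.map_map]
    exact this
  · intro a ha
    rw [(hmem a ha).1, forms_initial]
    intro Z hZ K hK h0 h1
    obtain ⟨s, hs, rfl⟩ := exists_finset_of_le_map hZ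
    have hnd : s.Nodup := Multiset.nodup_of_le hs Finset.univ.nodup
    set I : Finset (Fin k) := ⟨s, hnd⟩ with hI
    have hIs : s = I.val := rfl
    rw [hIs] at h0 h1 ⊢
    have h0' : I.Nonempty ∨ K.Nonempty := by
      rcases h0 with h0 | h0
      · left
        rw [Finset.nonempty_iff_ne_empty]
        intro h
        rw [h] at h0
        simp at h0
      · exact .inr (Finset.nonempty_iff_ne_empty.2 h0)
    have h1' : I ≠ Finset.univ ∨ K ≠ Finset.univ := by
      rcases h1 with h1 | h1
      · left
        intro h
        rw [h] at h1
        simp at h1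
      · exact .inr h1
    have hval : ∀ t : IntegralPoint (connectedComponentIn (resonanceComplement k l) p),
        formSum (I.val.map fun i t => t.1.1 i) t = ∑ i ∈ I, t.1.1 i := by
      intro t
      simp [formSum]
    have hsign := fun t : IntegralPoint (connectedComponentIn (resonanceComplement k l) p) =>
      ((mem_chamber_iff hp).1 t.2).2.2 I K h0' h1'
    simp only [wallForm_toPoint] at hsign
    simp only [hval, outputs]
    rcases lt_or_ge 0 (wallForm I K p) with h2 | h2
    · right
      intro t
      have := pos_of_mul_pos_left (hsign t) h2.le
      rw [sub_pos] at this
      exact_mod_cast this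
    · left
      intro t
      have := neg_of_mul_pos_left (hsign t) h2
      rw [sub_neg] at this
      exact_mod_cast this
  · intro a ha hma
    rw [(hmem a ha).2] at hma
    rw [(hmem a ha).1]
    rcases hm hma with h | h
    · left
      simpa using h
    · right
      rw [initial, items_map]
      simpa using h

theorem colours_initial (hk : 1 ≤ k) (mark : Bool) : colours (initial C mark) = {Finset.univ} := by
  ext L
  rw [mem_colours, Finset.mem_singleton]
  constructor
  · rintro ⟨a, ha, rfl⟩
    obtain ⟨i, -, rfl⟩ := Multiset.mem_map.1 ha
    rfl
  · rintro rfl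
    exact ⟨_, Multiset.mem_map.2 ⟨⟨0, hk⟩, Finset.mem_univ_val _, rfl⟩, rfl⟩

theorem evalAt_initial (mark : Bool) (t : IntegralPoint C) :
    evalAt t (initial C mark) = Finset.univ.val.map fun i => (t.1.1 i, Finset.univ) := by
  rw [evalAt, initial, Multiset.map_map]
  rfl

theorem card_initial (mark : Bool) : (initial C mark).card = k := by
  simp [initial]

theorem markProd_initial (t : IntegralPoint C) :
    markProd (initial C true) t = ∏ i, (t.1.1 i : ℚ) := by
  rw [markProd, initial, Multiset.map_map]
  rfl

theorem markCard_initial : markCard (initial C true) = k := by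
  simp [markCard, initial, -Fin.univ_val_map]

/-- On a chamber, the counts that compute the twisted double Hurwitz numbers are differences of two
homogeneous polynomials. -/
theorem exists_hom_of_chamber (hk : 1 ≤ k) (hl : 1 ≤ l) (hC : IsChamber C) :
    ∃ A B : IntegralPoint C → ℚ, IsHom coords (k + l - 1 : ℕ) A ∧ IsHom coords (k + l - 2 : ℕ) B ∧
      (∀ t, 0 < A t) ∧ (∀ t, 0 < B t) ∧ ∀ t : IntegralPoint C,
        colCount t.1.2 (k + l - 1) (Finset.univ.val.map fun i => (t.1.1 i, Finset.univ)) =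
          (A t - B t) * ∏ i, (t.1.1 i : ℚ) := by
  have hy : ∀ j, IsHom (coords (C := C)) 1 fun t => (outputs C j t : ℚ) := fun j =>
    isHom_coord (Sum.inr j)
  by_cases hkl : 2 ≤ l ∨ 2 ≤ k
  · have hg := good_initial hk hl hC (mark := true) fun _ => hkl
    have hne : Nonempty (Fin l) := ⟨⟨0, hl⟩⟩
    have hcol : (colours (initial C true)).card = 1 := by
      rw [colours_initial hk, Finset.card_singleton]
    have hdeg : degree (initial C true) = k + l - 3 := by
      rw [degree, hcol, card_initial, markCard_initial, Fintype.card_fin]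
      push_cast
      ring
    obtain ⟨a, ⟨A, hA, hA0, rfl⟩, b, ⟨B, hB, hB0, rfl⟩, hab⟩ :=
      colCount_mem_twoPos hne hy (k + l - 1) hg (by
        rw [hcol, card_initial, Fintype.card_fin]
        omega)
    refine ⟨A, B, hA.of_eq (by rw [hdeg]; omega) rfl, hB.of_eq (by rw [hdeg]; omega) rfl, hA0, hB0,
      fun t => ?_⟩
    have := congrFun hab t
    simp only [evalAt_initial, Pi.sub_apply, Pi.mul_apply, markProd_initial] at this
    rw [sub_mul]
    exact this
  · obtain rfl : k = 1 := by omega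
    obtain rfl : l = 1 := by omega
    have hg := good_initial hk hl hC (mark := false) fun h => by simp at h
    refine ⟨fun t => (t.1.1 0 : ℚ), fun _ => 1, isHom_coord (Sum.inl 0), IsHom.const 1, fun t => ?_,
      fun _ => one_pos, fun t => ?_⟩
    · have : 0 < t.1.1 0 := hg.pos (a := ((fun t => t.1.1 0, false), Finset.univ))
        (Multiset.mem_map.2 ⟨0, Finset.mem_univ_val _, rfl⟩) t
      exact Nat.cast_pos.2 this
    · have hxy : t.1.1 0 = t.1.2 0 := by
        have h1 := hg.bal ((fun t => t.1.1 0, false), Finset.univ)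
          (Multiset.mem_map.2 ⟨0, Finset.mem_univ_val _, rfl⟩) t
        rw [forms_initial] at h1
        simpa [formSum, outputs] using h1
      have hcol : (colours (initial C false)).card = 1 := by
        rw [colours_initial hk, Finset.card_singleton]
      have h1 := colCount_succ_evalAt t.1.2 0 t (initial C false) (by
        rw [hcol, card_initial, Fintype.card_fin]
        omega)
      have h2 : initial C false = ((fun t => t.1.1 0, false), Finset.univ) ::ₘ 0 := by
        simp [initial]
      rw [evalAt_initial, h2, pickSum_cons, ← h2, evalAt_initial, pickSum_zero, add_zero] at h1
      have h3 : ((Finset.univ : Finset (Fin 1)).ssubsets.erase ∅) = ∅ := by decide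
      have h4 : (Finset.univ.val.map fun i => (t.1.1 i, (Finset.univ : Finset (Fin 1)))) =
          target t.1.2 := by
        rw [target]
        refine Multiset.map_congr rfl fun j _ => ?_
        obtain rfl : j = 0 := Subsingleton.elim _ _
        rw [hxy]
        rfl
      rw [joinSplit, joinTerms, pickSum_zero, h3, Finset.sum_empty, add_zero, zero_add] at h1
      change colCount t.1.2 (0 + 1) _ = _
      have h5 : colCount t.1.2 0 (Finset.univ.val.map fun i =>
          (t.1.1 i, (Finset.univ : Finset (Fin 1)))) = 1 := by
        simp only [colCount]
        rw [if_pos h4]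
      rw [h1, h5]
      simp
      ring

end Chambers

end TwistedHurwitz

namespace TwistedHurwitz

section Density

variable {k l : ℕ} {C : Set (Fin k ⊕ Fin l → ℝ)}

theorem eval_mul_of_isHomogeneous {σ R : Type*} [CommRing R] {Q : MvPolynomial σ R} {d : ℕ}
    (hQ : Q.IsHomogeneous d) (c : R) (z : σ → R) :
    MvPolynomial.eval (fun s => c * z s) Q = c ^ d * MvPolynomial.eval z Q := by
  rw [MvPolynomial.eval_eq, MvPolynomial.eval_eq, Finset.mul_sum]
  refine Finset.sum_congr rfl fun m hm => ?_
  have h := hQ (MvPolynomial.mem_support_iff.1 hm)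
  rw [Finsupp.weight_apply, Finsupp.sum] at h
  simp only [mul_pow, Finset.prod_mul_distrib, Finset.prod_pow_eq_pow_sum]
  simp only [Pi.one_apply, smul_eq_mul, mul_one] at h
  rw [h]
  ring

/-- An integral sequence that is asymptotic to the multiples of a point of a chamber is eventually
in that chamber. -/
theorem eventually_mem_chamber (hC : IsChamber C) {c : Fin k ⊕ Fin l → ℝ} (hc : c ∈ C)
    {z : ℕ → Fin k ⊕ Fin l → ℤ} (hsum : ∀ N, ∑ i, z N (Sum.inl i) = ∑ j, z N (Sum.inr j))
    (hlim : ∀ s, Filter.Tendsto (fun N : ℕ => (z N s : ℝ) / N) Filter.atTop (nhds (c s))) :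
    ∀ᶠ N in Filter.atTop, ∃ t : IntegralPoint C, ∀ s, coords t s = z N s := by
  obtain ⟨p, hp, rfl⟩ := hC
  obtain ⟨h1, h2, h3⟩ := (mem_chamber_iff hp).1 hc
  have hpos : ∀ᶠ N : ℕ in Filter.atTop, ∀ s, 0 < (z N s : ℝ) / N :=
    Filter.eventually_all.2 fun s => (hlim s).eventually_const_lt (h1 s)
  have hlim' : Filter.Tendsto (fun (N : ℕ) s => (z N s : ℝ) / N) Filter.atTop (nhds c) :=
    tendsto_pi_nhds.2 hlim
  have hwall : ∀ᶠ N : ℕ in Filter.atTop, ∀ (I : Finset (Fin k)) (J : Finset (Fin l)),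
      (I.Nonempty ∨ J.Nonempty) → (I ≠ Finset.univ ∨ J ≠ Finset.univ) →
        0 < wallForm I J (fun s => (z N s : ℝ) / N) * wallForm I J p := by
    refine Filter.eventually_all.2 fun I => Filter.eventually_all.2 fun J => ?_
    by_cases h0 : I.Nonempty ∨ J.Nonempty
    · by_cases h0' : I ≠ Finset.univ ∨ J ≠ Finset.univ
      · have hw := (((continuous_wallForm I J).tendsto c).comp hlim').mul_const (wallForm I J p)
        filter_upwards [hw.eventually_const_lt (h3 I J h0 h0')] with N hN _ _ using hN
      · exact Filter.Eventually.of_forall fun N _ h => absurd h h0'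
    · exact Filter.Eventually.of_forall fun N h => absurd h h0
  filter_upwards [hpos, hwall, Filter.eventually_gt_atTop 0] with N hN1 hN2 hN3
  have hN : (0 : ℝ) < N := Nat.cast_pos.2 hN3
  have hz : ∀ s, 0 < z N s := fun s => by
    have := hN1 s
    rw [div_pos_iff_of_pos_right hN] at this
    exact_mod_cast this
  let q : (Fin k → ℕ) × (Fin l → ℕ) :=
    (fun i => (z N (Sum.inl i)).toNat, fun j => (z N (Sum.inr j)).toNat)
  have hq : ∀ s, ((Sum.elim q.1 q.2 s : ℕ) : ℤ) = z N s := by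
    rintro (s | s) <;> simp [q, (hz _).le]
  have hq' : ∀ s, toPoint q s = z N s := fun s => by
    rw [toPoint, ← hq s]
    simp
  refine ⟨⟨q, (mem_chamber_iff hp).2 ⟨fun s => ?_, ?_, fun I J h0 h0' => ?_⟩⟩, fun s => ?_⟩
  · rw [hq']
    exact_mod_cast hz s
  · simp only [hq']
    exact_mod_cast hsum N
  · have := mul_pos hN (hN2 I J h0 h0')
    have heq : wallForm I J (toPoint q) = N * wallForm I J (fun s => (z N s : ℝ) / N) := by
      simp only [wallForm, hq', mul_sub, Finset.mul_sum]
      congr 1 <;> exact Finset.sum_congr rfl fun s _ => by field_simp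
    rw [heq, mul_assoc]
    exact this
  · change ((Sum.elim q.1 q.2 s : ℕ) : ℚ) = z N s
    rw [← hq s]
    simp

theorem nonempty_integralPoint (hl : 1 ≤ l) (hC : IsChamber C) : Nonempty (IntegralPoint C) := by
  classical
  obtain ⟨p, hp, hpC⟩ := hC
  have hpm : p ∈ C := hpC ▸ mem_connectedComponentIn hp
  let j₀ : Fin l := ⟨0, hl⟩
  let y : ℕ → Fin k ⊕ Fin l → ℤ := fun N s => ⌊p s * N⌋₊
  let z : ℕ → Fin k ⊕ Fin l → ℤ := fun N s =>
    if s = Sum.inr j₀ then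
      ∑ i, y N (Sum.inl i) - ∑ j ∈ Finset.univ.erase j₀, y N (Sum.inr j) else y N s
  have hy : ∀ s, Filter.Tendsto (fun N : ℕ => (y N s : ℝ) / N) Filter.atTop (nhds (p s)) := by
    intro s
    have := (tendsto_nat_floor_mul_div_atTop (hp.1 s).le).comp
      (tendsto_natCast_atTop_atTop (R := ℝ))
    simpa [y, Function.comp_def] using this
  have hsum : ∀ N, ∑ i, z N (Sum.inl i) = ∑ j, z N (Sum.inr j) := by
    intro N
    rw [← Finset.add_sum_erase _ _ (Finset.mem_univ j₀)]
    have h1 : ∑ j ∈ Finset.univ.erase j₀, z N (Sum.inr j) =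
        ∑ j ∈ Finset.univ.erase j₀, y N (Sum.inr j) :=
      Finset.sum_congr rfl fun j hj => if_neg fun h => Finset.ne_of_mem_erase hj (Sum.inr.inj h)
    rw [h1]
    simp [z]
  have hlim : ∀ s, Filter.Tendsto (fun N : ℕ => (z N s : ℝ) / N) Filter.atTop (nhds (p s)) := by
    intro s
    by_cases hs : s = Sum.inr j₀
    · subst hs
      have h1 : p (Sum.inr j₀) = ∑ i, p (Sum.inl i) - ∑ j ∈ Finset.univ.erase j₀, p (Sum.inr j) := by
        rw [hp.2.1, ← Finset.add_sum_erase _ _ (Finset.mem_univ j₀)]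
        ring
      rw [h1]
      refine ((tendsto_finsetSum _ fun i _ => hy (Sum.inl i)).sub
        (tendsto_finsetSum (Finset.univ.erase j₀) fun j _ => hy (Sum.inr j))).congr fun N => ?_
      simp only [z, if_pos, Int.cast_sub, Int.cast_sum, sub_div, Finset.sum_div]
    · simpa only [z, if_neg hs] using hy s
  obtain ⟨N, t, -⟩ := (eventually_mem_chamber ⟨p, hp, hpC⟩ hpm hsum hlim).exists
  exact ⟨t⟩

theorem eval_add_mul_eq_zero {σ : Type*} {F : MvPolynomial σ ℚ} {c v : σ → ℚ}
    (h : ∀ᶠ N : ℕ in Filter.atTop, MvPolynomial.eval (fun s => N * c s + v s) F = 0) :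
    MvPolynomial.eval v F = 0 := by
  let G : Polynomial ℚ :=
    MvPolynomial.aeval (fun s => Polynomial.C (c s) * Polynomial.X + Polynomial.C (v s)) F
  have hG : ∀ a : ℚ, G.eval a = MvPolynomial.eval (fun s => a * c s + v s) F := by
    intro a
    have h1 := MvPolynomial.comp_aeval_apply
      (fun s => Polynomial.C (c s) * Polynomial.X + Polynomial.C (v s)) (Polynomial.aeval a) F
    rw [Polynomial.coe_aeval_eq_eval] at h1
    refine h1.trans ?_
    rw [MvPolynomial.aeval_eq_eval]
    congr 2
    funext s
    simp only [Polynomial.eval_add, Polynomial.eval_mul, Polynomial.eval_C, Polynomial.eval_X]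
    ring
  have h0 : G = 0 := by
    refine Polynomial.eq_zero_of_infinite_isRoot _ ?_
    obtain ⟨N, hN⟩ := Filter.eventually_atTop.1 h
    refine ((Set.Ici_infinite N).image (f := fun n : ℕ => (n : ℚ)) Nat.cast_injective.injOn).mono ?_
    rintro _ ⟨m, hm, rfl⟩
    exact (hG m).trans (hN m hm)
  have h1 := hG 0
  rw [h0] at h1
  simpa using h1.symm

theorem eval_homogeneousComponent_eq_zero {σ : Type*} {F : MvPolynomial σ ℚ} {v : σ → ℚ}
    (h : ∀ N : ℕ, MvPolynomial.eval (fun s => N * v s) F = 0) (d : ℕ) :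
    MvPolynomial.eval v (MvPolynomial.homogeneousComponent d F) = 0 := by
  let G : Polynomial ℚ := ∑ e ∈ Finset.range (F.totalDegree + 1),
    Polynomial.monomial e (MvPolynomial.eval v (MvPolynomial.homogeneousComponent e F))
  have h0 : G = 0 := by
    refine Polynomial.eq_zero_of_infinite_isRoot _ ?_
    refine ((Set.Ici_infinite 0).image (f := fun n : ℕ => (n : ℚ)) Nat.cast_injective.injOn).mono ?_
    rintro _ ⟨m, -, rfl⟩
    have h1 := h m
    rw [← MvPolynomial.sum_homogeneousComponent F, map_sum] at h1
    rw [Set.mem_ofPred_eq, Polynomial.IsRoot.def, Polynomial.eval_finsetSum, ← h1]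
    refine Finset.sum_congr rfl fun e _ => ?_
    rw [Polynomial.eval_monomial,
      eval_mul_of_isHomogeneous (MvPolynomial.homogeneousComponent_isHomogeneous e F), mul_comm]
  by_cases hd : d ∈ Finset.range (F.totalDegree + 1)
  · have h1 := congrArg (Polynomial.coeff · d) h0
    simpa [G, Polynomial.finsetSum_coeff, Polynomial.coeff_monomial, Finset.sum_ite_eq,
      Finset.mem_range.1 hd] using h1
  · rw [MvPolynomial.homogeneousComponent_eq_zero _ _ (by simpa using hd), map_zero]

/-- The homogeneous components of a polynomial that vanishes at the integral points of a chamber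
vanish on the hyperplane. -/
theorem zeroOnHyperplane_of_forall_eval_eq_zero (hl : 1 ≤ l) (hC : IsChamber C)
    {F : MvPolynomial (Fin k ⊕ Fin l) ℚ}
    (hF : ∀ t : IntegralPoint C, MvPolynomial.eval (coords t) F = 0) (d : ℕ) :
    ZeroOnHyperplane (MvPolynomial.homogeneousComponent d F) := by
  obtain ⟨t₀⟩ := nonempty_integralPoint hl hC
  have hmain : ∀ v : Fin k ⊕ Fin l → ℤ, ∑ i, v (Sum.inl i) = ∑ j, v (Sum.inr j) →
      MvPolynomial.eval (fun s => (v s : ℚ)) F = 0 := by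
    intro v hv
    refine eval_add_mul_eq_zero (c := coords t₀) ?_
    have ht₀ : ∑ i, t₀.1.1 i = ∑ j, t₀.1.2 j := by
      obtain ⟨p, hp, rfl⟩ := hC
      exact (nonResonant_of_mem (connectedComponentIn_subset _ _ t₀.2)).2.2.1
    have hev := eventually_mem_chamber hC t₀.2
      (z := fun N s => N * ((Sum.elim t₀.1.1 t₀.1.2 s : ℕ) : ℤ) + v s) (fun N => by
        simp only [Finset.sum_add_distrib, hv, ← Finset.mul_sum, Sum.elim_inl, Sum.elim_inr]
        congr 2
        exact_mod_cast ht₀) (fun s => by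
        have h1 : Filter.Tendsto (fun N : ℕ => toPoint t₀.1 s + (v s : ℝ) / N) Filter.atTop
            (nhds (toPoint t₀.1 s + 0)) :=
          tendsto_const_nhds.add (tendsto_const_div_atTop_nhds_zero_nat _)
        rw [add_zero] at h1
        refine h1.congr' ?_
        filter_upwards [Filter.eventually_gt_atTop 0] with N hN
        have : (N : ℝ) ≠ 0 := by positivity
        simp only [toPoint]
        push_cast
        field_simp)
    filter_upwards [hev] with N ⟨t, ht⟩
    rw [← hF t]
    congr 2
    funext s
    rw [ht s]
    simp [coords]
  intro z hz
  obtain ⟨b, hb⟩ := IsLocalization.exist_integer_multiples_of_finite (nonZeroDivisors ℤ) z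
  have hb0 : (b : ℚ) ≠ 0 := by
    have := nonZeroDivisors.ne_zero b.2
    exact_mod_cast this
  choose v hv using hb
  have hv' : ∀ s, (v s : ℚ) = (b : ℚ) * z s := fun s => by
    have := hv s
    simpa using this
  have h1 : MvPolynomial.eval (fun s => (v s : ℚ)) (MvPolynomial.homogeneousComponent d F) = 0 := by
    refine eval_homogeneousComponent_eq_zero (fun N => ?_) d
    have := hmain (fun s => N * v s) (by
      rw [← Finset.mul_sum, ← Finset.mul_sum]
      congr 1
      have : ∑ i, (v (Sum.inl i) : ℚ) = ∑ j, (v (Sum.inr j) : ℚ) := by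
        simp only [hv', ← Finset.mul_sum, hz]
      exact_mod_cast this)
    simpa using this
  simp only [hv'] at h1
  rw [eval_mul_of_isHomogeneous (MvPolynomial.homogeneousComponent_isHomogeneous d F)] at h1
  exact (mul_eq_zero.1 h1).resolve_left (pow_ne_zero _ hb0)

end Density

end TwistedHurwitz

namespace TwistedHurwitz

open Equiv Equiv.Perm

theorem multiset_eq_of_sum_eq {s t : Multiset ℕ}
    (h : ∀ φ : ℕ → ℚ, (s.map φ).sum = (t.map φ).sum) : s = t := by
  have key : ∀ (s : Multiset ℕ) (m : ℕ),
      (s.map fun a => if m = a then (1 : ℚ) else 0).sum = s.count m := by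
    intro s m
    induction s using Multiset.induction_on with
    | empty => simp
    | cons a s ih =>
      rw [Multiset.map_cons, Multiset.sum_cons, ih, Multiset.count_cons]
      split_ifs <;> push_cast <;> ring
  ext m
  have := h fun a => if m = a then 1 else 0
  rw [key, key] at this
  exact_mod_cast this

theorem multiset_add_self_injective {s t : Multiset ℕ} (h : s + s = t + t) : s = t := by
  ext m
  have := congrArg (Multiset.count m) h
  simp only [Multiset.count_add] at this
  omega

theorem SameCycle.of_rel {X : Type*} [Finite X] {σ : Perm X} (r : Setoid X) (h : ∀ x, r x (σ x)) {x y : X}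
    (hxy : σ.SameCycle x y) : r x y := by
  obtain ⟨k, rfl⟩ := hxy.exists_nat_pow_eq
  clear hxy
  induction k with
  | zero => exact r.refl' x
  | succ k ih =>
    rw [pow_succ', mul_apply]
    exact r.trans' ih (h _)

theorem swap_mul_apply_sameCycle {X : Type*} [DecidableEq X] {σ : Perm X} {a b : X} (h : (swap a b * σ).SameCycle a b) (x : X) :
    (swap a b * σ).SameCycle x (σ x) := by
  have h1 : (swap a b * σ).SameCycle x (swap a b (σ x)) := by
    rw [← mul_apply, sameCycle_apply_right]
  refine h1.trans ?_
  by_cases ha : σ x = a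
  · rw [ha, swap_apply_left]
    exact h.symm
  · by_cases hb : σ x = b
    · rw [hb, swap_apply_right]
      exact h
    · rw [swap_apply_of_ne_of_ne ha hb]

theorem swap_mul_swap_mul {X : Type*} [DecidableEq X] (σ : Perm X) (a b : X) : swap a b * (swap a b * σ) = σ := by
  rw [← mul_assoc, swap_mul_self, one_mul]

section Cycles

variable {X : Type*} [Fintype X] [DecidableEq X]

/-- The cycle through `x`. -/
def cycleSet (σ : Perm X) (x : X) : Finset X := {y | σ.SameCycle x y}

/-- The length of the cycle through `x`. -/
def cycleCard (σ : Perm X) (x : X) : ℕ := (cycleSet σ x).card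

@[simp]
theorem mem_cycleSet {σ : Perm X} {x y : X} : y ∈ cycleSet σ x ↔ σ.SameCycle x y := by
  simp [cycleSet]

theorem cycleSet_eq {σ : Perm X} {x y : X} (h : σ.SameCycle x y) :
    cycleSet σ x = cycleSet σ y := by
  ext z
  rw [mem_cycleSet, mem_cycleSet]
  exact ⟨h.symm.trans, h.trans⟩

theorem cycleCard_eq {σ : Perm X} {x y : X} (h : σ.SameCycle x y) :
    cycleCard σ x = cycleCard σ y := by
  rw [cycleCard, cycleSet_eq h, cycleCard]

theorem cycleCard_pos (σ : Perm X) (x : X) : 0 < cycleCard σ x :=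
  Finset.card_pos.2 ⟨x, mem_cycleSet.2 (SameCycle.refl σ x)⟩

theorem cycleSet_inv (σ : Perm X) (x : X) : cycleSet σ⁻¹ x = cycleSet σ x := by
  ext y
  simp

theorem cycleCard_inv (σ : Perm X) (x : X) : cycleCard σ⁻¹ x = cycleCard σ x := by
  rw [cycleCard, cycleSet_inv, cycleCard]

theorem sum_cycleCard (σ : Perm X) (φ : ℕ → ℚ) :
    ∑ x, φ (cycleCard σ x) = (σ.partition.parts.map fun m : ℕ => (m : ℚ) * φ m).sum := by
  rw [parts_partition, Multiset.map_add, Multiset.sum_add, Multiset.map_replicate,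
    Multiset.sum_replicate, ← Finset.sum_add_sum_compl σ.support]
  congr 1
  · rw [← Finset.sum_fiberwise_of_maps_to (g := fun x => σ.cycleOf x) (t := σ.cycleFactorsFinset)
      (fun x hx => cycleOf_mem_cycleFactorsFinset_iff.2 hx), cycleType_def, Multiset.map_map]
    refine Finset.sum_congr rfl fun c hc => ?_
    have hfib : (σ.support.filter fun x => σ.cycleOf x = c) = c.support := by
      ext x
      rw [Finset.mem_filter]
      constructor
      · rintro ⟨hx, rfl⟩
        rw [mem_support_cycleOf_iff]
        exact ⟨SameCycle.refl _ _, hx⟩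
      · intro hx
        exact ⟨mem_cycleFactorsFinset_support_le hc hx, (cycle_is_cycleOf hx hc).symm⟩
    rw [hfib]
    have : ∀ x ∈ c.support, φ (cycleCard σ x) = φ c.support.card := by
      intro x hx
      refine congrArg (fun S : Finset X => φ S.card) ?_
      ext y
      rw [mem_cycleSet, cycle_is_cycleOf hx hc, mem_support_cycleOf_iff]
      exact ⟨fun h => ⟨h, mem_cycleFactorsFinset_support_le hc hx⟩, fun h => h.1⟩
    rw [Finset.sum_congr rfl this, Finset.sum_const, nsmul_eq_mul]
    rfl
  · have : ∀ x ∈ σ.supportᶜ, φ (cycleCard σ x) = ((1 : ℕ) : ℚ) * φ 1 := by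
      intro x hx
      have hx' : σ x = x := by simpa using hx
      have : cycleSet σ x = {x} := by
        ext y
        rw [mem_cycleSet, Finset.mem_singleton]
        exact ⟨fun h => (h.eq_of_left hx').symm, fun h => h ▸ SameCycle.refl _ _⟩
      rw [cycleCard, this, Finset.card_singleton]
      simp
    rw [Finset.sum_congr rfl this, Finset.sum_const, Finset.card_compl]

theorem sum_parts (σ : Perm X) (ψ : ℕ → ℚ) :
    (σ.partition.parts.map ψ).sum = ∑ x, ψ (cycleCard σ x) / cycleCard σ x := by
  rw [sum_cycleCard σ fun m => ψ m / m]
  congr 1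
  refine Multiset.map_congr rfl fun m hm => ?_
  have : (m : ℚ) ≠ 0 := Nat.cast_ne_zero.2 (σ.partition.parts_pos hm).ne'
  field_simp

theorem sum_cycleSet (σ : Perm X) (a : X) (ψ : ℕ → ℚ) :
    ∑ x ∈ cycleSet σ a, ψ (cycleCard σ x) / cycleCard σ x = ψ (cycleCard σ a) := by
  have h : ∀ x ∈ cycleSet σ a, ψ (cycleCard σ x) / cycleCard σ x =
      ψ (cycleCard σ a) / cycleCard σ a := fun x hx => by
    rw [cycleCard_eq (mem_cycleSet.1 hx)]
  have h0 : (cycleCard σ a : ℚ) ≠ 0 := Nat.cast_ne_zero.2 (cycleCard_pos σ a).ne'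
  rw [Finset.sum_congr rfl h, Finset.sum_const, nsmul_eq_mul, ← cycleCard]
  field_simp

theorem cycleCard_mem_parts (σ : Perm X) (x : X) : cycleCard σ x ∈ σ.partition.parts := by
  by_contra h
  have h1 := sum_cycleCard σ fun m => if m = cycleCard σ x then 1 else 0
  rw [Finset.sum_boole] at h1
  have h2 : (σ.partition.parts.map fun m : ℕ =>
      (m : ℚ) * if m = cycleCard σ x then 1 else 0).sum = 0 := by
    refine Multiset.sum_eq_zero fun a ha => ?_
    obtain ⟨m, hm, rfl⟩ := Multiset.mem_map.1 ha
    rw [if_neg (by rintro rfl; exact h hm), mul_zero]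
  rw [h2, Nat.cast_eq_zero, Finset.card_eq_zero] at h1
  exact Finset.notMem_empty x (h1 ▸ by simp)

theorem sameCycle_swap_mul_of_sameCycle {σ : Perm X} {a b : X} (h : (swap a b * σ).SameCycle a b)
    {x y : X} (hxy : σ.SameCycle x y) : (swap a b * σ).SameCycle x y :=
  SameCycle.of_rel (SameCycle.setoid (swap a b * σ)) (swap_mul_apply_sameCycle h) hxy

theorem sameCycle_swap_mul_of_not_sameCycle {σ : Perm X} {a b : X} (h : ¬ σ.SameCycle a b) :
    (swap a b * σ).SameCycle a b := by
  by_contra h'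
  have hpow : ∀ n : ℕ, ((swap a b * σ) ^ n) a = (σ ^ n) a ∧
      ((swap a b * σ) ^ (n + 1)) a = (σ ^ (n + 1)) a := by
    intro n
    induction n with
    | zero =>
      refine ⟨rfl, ?_⟩
      rw [zero_add, pow_one, pow_one, mul_apply]
      have h1 : σ a ≠ b := fun hb => h ⟨1, by simpa using hb⟩
      by_cases h2 : σ a = a
      · exfalso
        refine h' ⟨1, ?_⟩
        rw [zpow_one, mul_apply, h2, swap_apply_left]
      · rw [swap_apply_of_ne_of_ne h2 h1]
    | succ n ih =>
      refine ⟨ih.2, ?_⟩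
      rw [pow_succ', pow_succ' σ, mul_apply, mul_apply, mul_apply, ih.2]
      have h1 : σ ((σ ^ (n + 1)) a) ≠ b := fun hb => h ⟨(n + 1 + 1 : ℕ), by
        rw [zpow_natCast, pow_succ', mul_apply, hb]⟩
      by_cases h2 : σ ((σ ^ (n + 1)) a) = a
      · exfalso
        refine h' ⟨(n + 1 + 1 : ℕ), ?_⟩
        rw [zpow_natCast, pow_succ', mul_apply, mul_apply, ih.2, h2, swap_apply_left]
      · rw [swap_apply_of_ne_of_ne h2 h1]
  have h1 := (hpow (orderOf σ - 1)).2
  rw [Nat.sub_add_cancel (orderOf_pos σ), pow_orderOf_eq_one] at h1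
  have h2 := (hpow (orderOf σ - 1)).1
  have h3 : ((swap a b * σ) ^ (orderOf σ - 1 + 1)) a = b := by
    rw [pow_succ', mul_apply, mul_apply, h2, ← mul_apply σ, ← pow_succ',
      Nat.sub_add_cancel (orderOf_pos σ), pow_orderOf_eq_one, one_apply, swap_apply_left]
  rw [Nat.sub_add_cancel (orderOf_pos σ)] at h3
  exact h ⟨0, by rw [← h3, h1]; simp⟩

theorem sameCycle_swap_mul_iff {σ : Perm X} {a b : X} (h : ¬ σ.SameCycle a b) {x y : X} :
    (swap a b * σ).SameCycle x y ↔ σ.SameCycle x y ∨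
      (σ.SameCycle a x ∨ σ.SameCycle b x) ∧ (σ.SameCycle a y ∨ σ.SameCycle b y) := by
  have hab := sameCycle_swap_mul_of_not_sameCycle h
  have hle : ∀ {x y}, σ.SameCycle x y → (swap a b * σ).SameCycle x y :=
    sameCycle_swap_mul_of_sameCycle hab
  constructor
  · let r : Setoid X :=
      { r := fun x y => σ.SameCycle x y ∨
          (σ.SameCycle a x ∨ σ.SameCycle b x) ∧ (σ.SameCycle a y ∨ σ.SameCycle b y)
        iseqv :=
          { refl := fun x => .inl (SameCycle.refl _ _)
            symm := fun {x y} hxy => hxy.elim (fun h => .inl h.symm) fun h => .inr ⟨h.2, h.1⟩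
            trans := by
              rintro x y z (h1 | ⟨h1, h2⟩) (h3 | ⟨h3, h4⟩)
              · exact .inl (h1.trans h3)
              · exact .inr ⟨h3.imp (fun h => h.trans h1.symm) fun h => h.trans h1.symm, h4⟩
              · exact .inr ⟨h1, h2.imp (fun h => h.trans h3) fun h => h.trans h3⟩
              · exact .inr ⟨h1, h4⟩ } }
    refine fun hxy => SameCycle.of_rel r (fun x => ?_) hxy
    change σ.SameCycle x (swap a b (σ x)) ∨ (σ.SameCycle a x ∨ σ.SameCycle b x) ∧
      (σ.SameCycle a (swap a b (σ x)) ∨ σ.SameCycle b (swap a b (σ x)))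
    have hx : σ.SameCycle (σ x) x := by
      rw [sameCycle_apply_left]
    by_cases ha : σ x = a
    · rw [ha, swap_apply_left]
      exact .inr ⟨.inl (ha ▸ hx), .inr (SameCycle.refl _ _)⟩
    · by_cases hb : σ x = b
      · rw [hb, swap_apply_right]
        exact .inr ⟨.inr (hb ▸ hx), .inl (SameCycle.refl _ _)⟩
      · rw [swap_apply_of_ne_of_ne ha hb]
        exact .inl hx.symm
  · rintro (h1 | ⟨h1, h2⟩)
    · exact hle h1
    · have key : ∀ {z}, (σ.SameCycle a z ∨ σ.SameCycle b z) → (swap a b * σ).SameCycle a z :=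
        fun hz => hz.elim hle fun hz => hab.trans (hle hz)
      exact (key h1).symm.trans (key h2)

theorem cycleSet_swap_mul {σ : Perm X} {a b : X} (h : ¬ σ.SameCycle a b) :
    cycleSet (swap a b * σ) a = cycleSet σ a ∪ cycleSet σ b := by
  ext y
  rw [mem_cycleSet, sameCycle_swap_mul_iff h, Finset.mem_union, mem_cycleSet, mem_cycleSet]
  have := SameCycle.refl σ a
  tauto

theorem disjoint_cycleSet {σ : Perm X} {a b : X} (h : ¬ σ.SameCycle a b) :
    Disjoint (cycleSet σ a) (cycleSet σ b) := by
  rw [Finset.disjoint_left]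
  intro y h1 h2
  rw [mem_cycleSet] at h1 h2
  exact h (h1.trans h2.symm)

theorem cycleCard_swap_mul {σ : Perm X} {a b : X} (h : ¬ σ.SameCycle a b) :
    cycleCard (swap a b * σ) a = cycleCard σ a + cycleCard σ b := by
  rw [cycleCard, cycleSet_swap_mul h, Finset.card_union_of_disjoint (disjoint_cycleSet h)]
  rfl

theorem cycleSet_swap_mul_of_not {σ : Perm X} {a b x : X} (h : ¬ σ.SameCycle a b)
    (ha : ¬ σ.SameCycle a x) (hb : ¬ σ.SameCycle b x) :
    cycleSet (swap a b * σ) x = cycleSet σ x := by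
  ext y
  rw [mem_cycleSet, sameCycle_swap_mul_iff h, mem_cycleSet]
  tauto

/-- Multiplication with a transposition of elements of different cycles joins these cycles. -/
theorem parts_swap_mul_of_not_sameCycle {σ : Perm X} {a b : X} (h : ¬ σ.SameCycle a b) :
    (swap a b * σ).partition.parts + {cycleCard σ a, cycleCard σ b} =
      σ.partition.parts + {cycleCard σ a + cycleCard σ b} := by
  refine multiset_eq_of_sum_eq fun ψ => ?_
  simp only [Multiset.map_add, Multiset.sum_add, Multiset.insert_eq_cons, Multiset.map_cons,
    Multiset.map_singleton, Multiset.sum_cons, Multiset.sum_singleton, sum_parts]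
  rw [← Finset.sum_add_sum_compl (cycleSet σ a ∪ cycleSet σ b),
    ← Finset.sum_add_sum_compl (cycleSet σ a ∪ cycleSet σ b) fun x =>
      ψ (cycleCard σ x) / cycleCard σ x, ← cycleSet_swap_mul h, sum_cycleSet,
    cycleSet_swap_mul h, Finset.sum_union (disjoint_cycleSet h), sum_cycleSet, sum_cycleSet,
    cycleCard_swap_mul h]
  have : ∑ x ∈ (cycleSet σ a ∪ cycleSet σ b)ᶜ,
        ψ (cycleCard (swap a b * σ) x) / cycleCard (swap a b * σ) x =
      ∑ x ∈ (cycleSet σ a ∪ cycleSet σ b)ᶜ, ψ (cycleCard σ x) / cycleCard σ x := by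
    refine Finset.sum_congr rfl fun x hx => ?_
    simp only [Finset.mem_compl, Finset.mem_union, mem_cycleSet, not_or] at hx
    rw [cycleCard, cycleSet_swap_mul_of_not h hx.1 hx.2, ← cycleCard]
  rw [this]
  ring

theorem isCycleOn_cycleSet (σ : Perm X) (a : X) : σ.IsCycleOn (cycleSet σ a : Set X) := by
  refine ⟨⟨fun x hx => ?_, σ.injective.injOn, fun y hy => ⟨σ⁻¹ y, ?_, by simp⟩⟩,
    fun x hx y hy => ?_⟩
  · rw [Finset.mem_coe, mem_cycleSet] at hx ⊢
    rwa [sameCycle_apply_right]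
  · rw [Finset.mem_coe, mem_cycleSet] at hy ⊢
    rwa [← sameCycle_apply_right, ← mul_apply, mul_inv_cancel, one_apply]
  · rw [Finset.mem_coe, mem_cycleSet] at hx hy
    exact hx.symm.trans hy

theorem pow_apply_injOn (σ : Perm X) (a : X) {p q : ℕ} (hp : p < cycleCard σ a)
    (hq : q < cycleCard σ a) (h : (σ ^ p) a = (σ ^ q) a) : p = q := by
  rw [(isCycleOn_cycleSet σ a).pow_apply_eq_pow_apply (mem_cycleSet.2 (SameCycle.refl _ _))] at h
  exact Nat.ModEq.eq_of_lt_of_lt h hp hq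

theorem exists_pow_apply_eq {σ : Perm X} {a b : X} (h : σ.SameCycle a b) :
    ∃ p < cycleCard σ a, (σ ^ p) a = b :=
  (isCycleOn_cycleSet σ a).exists_pow_eq (mem_cycleSet.2 (SameCycle.refl _ _)) (mem_cycleSet.2 h)

theorem cycleSet_swap_pow_mul (σ : Perm X) (a : X) {p : ℕ} (h0 : 0 < p) (hp : p < cycleCard σ a) :
    cycleSet (swap a ((σ ^ p) a) * σ) a = (Finset.range p).image fun q => (σ ^ q) a := by
  have hstep : ∀ q, q + 1 < p → (swap a ((σ ^ p) a) * σ) ((σ ^ q) a) = (σ ^ (q + 1)) a := by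
    intro q hq
    rw [mul_apply, ← mul_apply σ, ← pow_succ']
    refine swap_apply_of_ne_of_ne (fun h => ?_) (fun h => ?_)
    · have := pow_apply_injOn σ a (p := q + 1) (q := 0) (by omega) (by omega) (by simpa using h)
      omega
    · have := pow_apply_injOn σ a (p := q + 1) (q := p) (by omega) (by omega) h
      omega
  have hlast : (swap a ((σ ^ p) a) * σ) ((σ ^ (p - 1)) a) = a := by
    rw [mul_apply, ← mul_apply σ, ← pow_succ', Nat.sub_add_cancel h0, swap_apply_right]
  have hpow : ∀ q < p, ((swap a ((σ ^ p) a) * σ) ^ q) a = (σ ^ q) a := by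
    intro q hq
    induction q with
    | zero => rfl
    | succ q ih => rw [pow_succ', mul_apply, ih (by omega), hstep q hq]
  ext y
  rw [mem_cycleSet, Finset.mem_image]
  constructor
  · intro h
    obtain ⟨m, rfl⟩ := h.exists_nat_pow_eq
    clear h
    induction m with
    | zero => exact ⟨0, Finset.mem_range.2 h0, rfl⟩
    | succ m ih =>
      obtain ⟨q, hq, he⟩ := ih
      rw [Finset.mem_range] at hq
      rw [pow_succ', mul_apply, ← he]
      by_cases hq' : q + 1 < p
      · exact ⟨q + 1, Finset.mem_range.2 hq', (hstep q hq').symm⟩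
      · obtain rfl : q = p - 1 := by omega
        exact ⟨0, Finset.mem_range.2 h0, by rw [hlast]; rfl⟩
  · rintro ⟨q, hq, rfl⟩
    rw [← hpow q (Finset.mem_range.1 hq), sameCycle_pow_right]

theorem cycleCard_swap_pow_mul (σ : Perm X) (a : X) {p : ℕ} (h0 : 0 < p)
    (hp : p < cycleCard σ a) : cycleCard (swap a ((σ ^ p) a) * σ) a = p := by
  rw [cycleCard, cycleSet_swap_pow_mul σ a h0 hp, Finset.card_image_of_injOn, Finset.card_range]
  intro q hq r hr h
  rw [Finset.mem_coe, Finset.mem_range] at hq hr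
  exact pow_apply_injOn σ a (hq.trans hp) (hr.trans hp) h

theorem not_sameCycle_swap_pow_mul (σ : Perm X) (a : X) {p : ℕ} (h0 : 0 < p)
    (hp : p < cycleCard σ a) : ¬ (swap a ((σ ^ p) a) * σ).SameCycle a ((σ ^ p) a) := by
  rw [← mem_cycleSet, cycleSet_swap_pow_mul σ a h0 hp, Finset.mem_image]
  rintro ⟨q, hq, h⟩
  rw [Finset.mem_range] at hq
  have := pow_apply_injOn σ a (hq.trans hp) hp h
  omega

theorem not_sameCycle_swap_mul {σ : Perm X} {a b : X} (hab : a ≠ b) (h : σ.SameCycle a b) :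
    ¬ (swap a b * σ).SameCycle a b := by
  obtain ⟨p, hp, rfl⟩ := exists_pow_apply_eq h
  refine not_sameCycle_swap_pow_mul σ a (Nat.pos_of_ne_zero ?_) hp
  rintro rfl
  exact hab rfl

/-- Multiplication with a transposition of elements of the same cycle cuts this cycle. -/
theorem parts_swap_mul_of_sameCycle {σ : Perm X} {a b : X} (hab : a ≠ b) (h : σ.SameCycle a b) :
    cycleCard (swap a b * σ) a + cycleCard (swap a b * σ) b = cycleCard σ a ∧
    σ.partition.parts + {cycleCard (swap a b * σ) a, cycleCard (swap a b * σ) b} =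
      (swap a b * σ).partition.parts + {cycleCard σ a} := by
  have h1 := not_sameCycle_swap_mul hab h
  have h2 := parts_swap_mul_of_not_sameCycle h1
  have h3 := cycleCard_swap_mul h1
  rw [swap_mul_swap_mul] at h2 h3
  rw [h3]
  exact ⟨rfl, h2⟩

/-- Multiplication with a transposition of two elements whose distance on a cycle is `p` cuts off
`p` elements. -/
theorem parts_swap_pow_mul (σ : Perm X) (a : X) {p : ℕ} (h0 : 0 < p) (hp : p < cycleCard σ a) :
    σ.partition.parts + {p, cycleCard σ a - p} =
      (swap a ((σ ^ p) a) * σ).partition.parts + {cycleCard σ a} := by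
  have hne : a ≠ (σ ^ p) a := fun h => by
    have := pow_apply_injOn σ a (p := 0) (q := p) (cycleCard_pos σ a) hp (by simpa using h)
    omega
  obtain ⟨h1, h2⟩ := parts_swap_mul_of_sameCycle (σ := σ) hne ⟨p, by simp⟩
  rw [cycleCard_swap_pow_mul σ a h0 hp] at h1 h2
  rw [← h2, ← h1, Nat.add_sub_cancel_left]

theorem sameCycle_swap_mul_iff_of_not {σ : Perm X} {a b x y : X} (hab : σ.SameCycle a b)
    (ha : ¬ σ.SameCycle a x) : (swap a b * σ).SameCycle x y ↔ σ.SameCycle x y := by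
  rcases eq_or_ne a b with rfl | hne
  · rw [swap_self, ← Perm.one_def, one_mul]
  have h1 := not_sameCycle_swap_mul hne hab
  have h2 := sameCycle_swap_mul_iff (x := x) (y := y) h1
  have h3 := sameCycle_swap_mul_iff (x := a) (y := x) h1
  rw [swap_mul_swap_mul] at h2 h3
  have := SameCycle.refl (swap a b * σ) a
  tauto

theorem parts_inv (σ : Perm X) : σ⁻¹.partition.parts = σ.partition.parts :=
  multiset_eq_of_sum_eq fun ψ => by simp only [sum_parts, cycleCard_inv]

end Cycles

end TwistedHurwitz

namespace TwistedHurwitz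

open Equiv Equiv.Perm

section Transversals

variable {Q : Type*} [Fintype Q] [DecidableEq Q] {t : Q → Q}

/-- The sets that contain exactly one element of each orbit of the involution `t`. -/
def transversals (t : Q → Q) : Finset (Finset Q) := {H | ∀ q, q ∈ H ↔ t q ∉ H}

theorem mem_transversals {H : Finset Q} : H ∈ transversals t ↔ ∀ q, q ∈ H ↔ t q ∉ H := by
  simp [transversals]

theorem exists_mem_transversals (ht : Function.Involutive t) (h0 : ∀ q, t q ≠ q) :
    ∃ H, H ∈ transversals t := by
  let e := Fintype.equivFin Q
  refine ⟨Finset.univ.filter fun q => e q < e (t q), mem_transversals.2 fun q => ?_⟩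
  rw [Finset.mem_filter, Finset.mem_filter, ht q]
  have : e (t q) ≠ e q := fun h => h0 q (e.injective h)
  simp only [Finset.mem_univ, true_and]
  omega

theorem compl_eq_image_of_mem_transversals (ht : Function.Involutive t) {H : Finset Q}
    (hH : H ∈ transversals t) : Hᶜ = H.image t := by
  rw [mem_transversals] at hH
  ext q
  rw [Finset.mem_compl, Finset.mem_image]
  constructor
  · intro hq
    refine ⟨t q, ?_, ht q⟩
    rw [hH, ht q]
    exact hq
  · rintro ⟨r, hr, rfl⟩
    exact (hH r).1 hr

theorem sum_eq_two_mul_of_mem_transversals (ht : Function.Involutive t) {H : Finset Q}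
    (hH : H ∈ transversals t) (F : Q → ℚ) (hF : ∀ q, F (t q) = F q) :
    ∑ q, F q = 2 * ∑ q ∈ H, F q := by
  rw [← Finset.sum_add_sum_compl H, compl_eq_image_of_mem_transversals ht hH,
    Finset.sum_image fun a _ b _ h => ht.injective h]
  simp only [hF]
  ring

theorem card_eq_two_mul_of_mem_transversals (ht : Function.Involutive t) {H : Finset Q}
    (hH : H ∈ transversals t) : Fintype.card Q = 2 * H.card := by
  have := sum_eq_two_mul_of_mem_transversals ht hH (fun _ => 1) fun _ => rfl
  simp only [Finset.sum_const, Finset.card_univ, nsmul_eq_mul, mul_one] at this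
  exact_mod_cast this

theorem card_transversals {m : ℕ} (ht : Function.Involutive t) (h0 : ∀ q, t q ≠ q)
    (hm : Fintype.card Q = 2 * m) : (transversals t).card = 2 ^ m := by
  obtain ⟨K, hK⟩ := exists_mem_transversals ht h0
  have hKm : K.card = m := by
    have := card_eq_two_mul_of_mem_transversals ht hK
    omega
  rw [mem_transversals] at hK
  rw [← hKm, ← Finset.card_powerset]
  refine Finset.card_nbij' (fun H => H ∩ K)
    (fun A => Finset.univ.filter fun q => q ∈ A ∨ (q ∉ K ∧ t q ∉ A)) ?_ ?_ ?_ ?_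
  · intro H _
    exact Finset.mem_coe.2 (Finset.mem_powerset.2 Finset.inter_subset_right)
  · intro A hA
    rw [Finset.mem_coe, Finset.mem_powerset] at hA
    rw [Finset.mem_coe, mem_transversals]
    intro q
    simp only [Finset.mem_filter, Finset.mem_univ, true_and, ht q]
    have h1 := hK q
    have h2 : q ∈ A → q ∈ K := fun h => hA h
    have h3 : t q ∈ A → t q ∈ K := fun h => hA h
    tauto
  · intro H hH
    rw [Finset.mem_coe, mem_transversals] at hH
    ext q
    simp only [Finset.mem_filter, Finset.mem_univ, true_and, Finset.mem_inter]
    have h1 := hK q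
    have h2 := hH q
    tauto
  · intro A hA
    rw [Finset.mem_coe, Finset.mem_powerset] at hA
    ext q
    simp only [Finset.mem_filter, Finset.mem_univ, true_and, Finset.mem_inter]
    have h2 : q ∈ A → q ∈ K := fun h => hA h
    tauto

end Transversals

section Classes

variable {X : Type*} [Fintype X] [DecidableEq X] (σ : Perm X)

/-- The cycles of a permutation, fixed points included. -/
abbrev Cycle (σ : Perm X) := Quotient (SameCycle.setoid σ)

instance : DecidableRel (SameCycle.setoid σ).r :=
  inferInstanceAs (DecidableRel σ.SameCycle)

/-- The length of a cycle. -/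
def cycleSize (q : Cycle σ) : ℕ := Quotient.lift (cycleCard σ) (fun _ _ h => cycleCard_eq h) q

theorem sum_div_cycleCard (G : Cycle σ → ℚ) :
    ∑ x, G (Quotient.mk _ x) / cycleCard σ x = ∑ q, G q := by
  classical
  rw [← Finset.sum_fiberwise (s := Finset.univ) fun x => (Quotient.mk _ x : Cycle σ)]
  refine Finset.sum_congr rfl fun q _ => ?_
  induction q using Quotient.inductionOn with
  | h a =>
    have hS : (Finset.univ.filter fun x => (Quotient.mk _ x : Cycle σ) = Quotient.mk _ a) =
        cycleSet σ a := by
      ext x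
      rw [Finset.mem_filter, mem_cycleSet, Quotient.eq]
      exact ⟨fun h => h.2.symm, fun h => ⟨Finset.mem_univ _, h.symm⟩⟩
    rw [hS]
    have h : ∀ x ∈ cycleSet σ a, G (Quotient.mk _ x) / cycleCard σ x =
        G (Quotient.mk _ a) / cycleCard σ a := fun x hx => by
      rw [mem_cycleSet] at hx
      rw [cycleCard_eq hx, Quotient.sound (s := SameCycle.setoid σ) hx.symm]
    have h0 : (cycleCard σ a : ℚ) ≠ 0 := Nat.cast_ne_zero.2 (cycleCard_pos σ a).ne'
    rw [Finset.sum_congr rfl h, Finset.sum_const, nsmul_eq_mul, ← cycleCard]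
    field_simp

theorem parts_eq_map_cycleSize :
    σ.partition.parts = (Finset.univ : Finset (Cycle σ)).val.map (cycleSize σ) := by
  refine multiset_eq_of_sum_eq fun ψ => ?_
  rw [sum_parts, Multiset.map_map]
  exact sum_div_cycleCard σ fun q => ψ (cycleSize σ q)

theorem card_cycle : Fintype.card (Cycle σ) = σ.partition.parts.card := by
  rw [parts_eq_map_cycleSize, Multiset.card_map]
  rfl

theorem sum_apply_mk (G : Cycle σ → ℚ) :
    ∑ x, G (Quotient.mk _ x) = ∑ q, cycleSize σ q * G q := by
  rw [← sum_div_cycleCard]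
  refine Finset.sum_congr rfl fun x _ => ?_
  have h0 : (cycleCard σ x : ℚ) ≠ 0 := Nat.cast_ne_zero.2 (cycleCard_pos σ x).ne'
  change _ = (cycleCard σ x : ℚ) * _ / _
  field_simp

end Classes

/-- `σ` is conjugated to its inverse by `τ`, and `σ τ` has no fixed point. -/
def IsTwisted {X : Type*} (τ σ : Perm X) : Prop := τ * σ * τ = σ⁻¹ ∧ ∀ x, σ x ≠ τ x

/-- The twisted conjugation by `η`. -/
def twist {X : Type*} (τ η σ : Perm X) : Perm X := η * σ * (τ * η * τ)

section Twisted

variable {X : Type*} {τ σ : Perm X}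

theorem IsTwisted.comm (h : IsTwisted τ σ) (hτ : τ * τ = 1) : τ * σ = σ⁻¹ * τ := by
  rw [← h.1, mul_assoc, hτ, mul_one]

theorem IsTwisted.comm_zpow (h : IsTwisted τ σ) (hτ : τ * τ = 1) (k : ℤ) :
    τ * σ ^ k = σ ^ (-k) * τ := by
  have : SemiconjBy τ σ σ⁻¹ := h.comm hτ
  have := this.zpow_right k
  rw [inv_zpow, ← zpow_neg] at this
  exact this

theorem IsTwisted.apply_zpow (h : IsTwisted τ σ) (hτ : τ * τ = 1) (k : ℤ) (x : X) :
    τ ((σ ^ k) x) = (σ ^ (-k)) (τ x) := by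
  rw [← mul_apply, h.comm_zpow hτ, mul_apply]

theorem involutive_of_mul_self (hτ : τ * τ = 1) : Function.Involutive τ := fun x => by
  rw [← mul_apply, hτ, one_apply]

theorem IsTwisted.sameCycle_apply (h : IsTwisted τ σ) (hτ : τ * τ = 1) {x y : X} :
    σ.SameCycle (τ x) (τ y) ↔ σ.SameCycle x y := by
  have key : ∀ {x y}, σ.SameCycle x y → σ.SameCycle (τ x) (τ y) := by
    rintro x _ ⟨k, rfl⟩
    exact ⟨-k, (h.apply_zpow hτ k x).symm⟩
  refine ⟨fun h' => ?_, key⟩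
  have := key h'
  rwa [involutive_of_mul_self hτ x, involutive_of_mul_self hτ y] at this

/-- The cycles of a twisted permutation are not self-symmetric. -/
theorem IsTwisted.not_sameCycle (h : IsTwisted τ σ) (hτ : τ * τ = 1) (h0 : ∀ x, τ x ≠ x) (x : X) :
    ¬ σ.SameCycle x (τ x) := by
  rintro ⟨k, hk⟩
  obtain ⟨m, hm⟩ := Int.even_or_odd' k
  have h1 : τ ((σ ^ m) x) = (σ ^ (k - m)) x := by
    rw [h.apply_zpow hτ, ← hk, ← mul_apply, ← zpow_add, neg_add_eq_sub]
  rcases hm with rfl | rfl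
  · refine h0 ((σ ^ m) x) ?_
    rw [h1]
    congr 2
    ring
  · refine h.2 ((σ ^ m) x) ?_
    rw [h1, ← mul_apply, ← zpow_one_add]
    congr 2
    ring

theorem isTwisted_twist (h : IsTwisted τ σ) (hτ : τ * τ = 1) {η : Perm X} (hη : η * η = 1) :
    IsTwisted τ (twist τ η σ) := by
  have hinv : τ⁻¹ = τ := inv_eq_of_mul_eq_one_left hτ
  have hinv' : η⁻¹ = η := inv_eq_of_mul_eq_one_left hη
  refine ⟨?_, fun x hx => ?_⟩
  · rw [twist, mul_inv_rev, mul_inv_rev, mul_inv_rev, mul_inv_rev, hinv, hinv', ← h.1]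
    calc τ * (η * σ * (τ * η * τ)) * τ = τ * η * σ * τ * η * (τ * τ) := by
          simp only [mul_assoc]
      _ = τ * (η * τ) * (τ * σ * τ * η) := by
          rw [hτ, mul_one]
          calc τ * η * σ * τ * η = τ * η * 1 * σ * τ * η := by rw [mul_one]
            _ = _ := by rw [← hτ]; simp only [mul_assoc]
  · have h1 : η (σ (τ (η (τ x)))) = τ x := hx
    refine h.2 (τ (η (τ x))) (η.injective ?_)
    rw [h1, involutive_of_mul_self hτ, ← mul_apply η, hη, one_apply]

/-- The involution on the cycles of a twisted permutation. -/
def IsTwisted.onCycles (h : IsTwisted τ σ) (hτ : τ * τ = 1) : Cycle σ → Cycle σ :=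
  Quotient.map τ fun _ _ hxy => (h.sameCycle_apply hτ).2 hxy

theorem IsTwisted.onCycles_involutive (h : IsTwisted τ σ) (hτ : τ * τ = 1) :
    Function.Involutive (h.onCycles hτ) := fun q => by
  induction q using Quotient.inductionOn with
  | h x => exact congrArg _ (involutive_of_mul_self hτ x)

theorem IsTwisted.onCycles_ne (h : IsTwisted τ σ) (hτ : τ * τ = 1) (h0 : ∀ x, τ x ≠ x)
    (q : Cycle σ) : h.onCycles hτ q ≠ q := by
  induction q using Quotient.inductionOn with
  | h x => exact fun h' => h.not_sameCycle hτ h0 x (Quotient.exact h').symm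

variable [Fintype X] [DecidableEq X]

theorem IsTwisted.cycleCard_apply (h : IsTwisted τ σ) (hτ : τ * τ = 1) (x : X) :
    cycleCard σ (τ x) = cycleCard σ x := by
  have : cycleSet σ (τ x) = (cycleSet σ x).map τ.toEmbedding := by
    ext y
    rw [mem_cycleSet, Finset.mem_map_equiv, mem_cycleSet, ← h.sameCycle_apply hτ,
      involutive_of_mul_self hτ x]
    have : τ y = τ.symm y := by
      rw [Equiv.eq_symm_apply]
      exact involutive_of_mul_self hτ y
    rw [this]
  rw [cycleCard, this, Finset.card_map, ← cycleCard]

theorem IsTwisted.cycleSize_onCycles (h : IsTwisted τ σ) (hτ : τ * τ = 1) (q : Cycle σ) :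
    cycleSize σ (h.onCycles hτ q) = cycleSize σ q := by
  induction q using Quotient.inductionOn with
  | h x => exact h.cycleCard_apply hτ x

theorem IsTwisted.parts_of_mem_transversals (h : IsTwisted τ σ) (hτ : τ * τ = 1)
    {H : Finset (Cycle σ)} (hH : H ∈ transversals (h.onCycles hτ)) :
    σ.partition.parts = H.val.map (cycleSize σ) + H.val.map (cycleSize σ) := by
  refine multiset_eq_of_sum_eq fun φ => ?_
  have := sum_eq_two_mul_of_mem_transversals (h.onCycles_involutive hτ) hH
    (fun q => φ (cycleSize σ q)) fun q => by rw [h.cycleSize_onCycles hτ]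
  rw [parts_eq_map_cycleSize, Multiset.map_add, Multiset.sum_add, Multiset.map_map,
    Multiset.map_map]
  refine this.trans ?_
  rw [two_mul]
  rfl

/-- The cycle type of a twisted permutation is doubled. -/
theorem IsTwisted.exists_parts (h : IsTwisted τ σ) (hτ : τ * τ = 1) (h0 : ∀ x, τ x ≠ x) :
    ∃ s, σ.partition.parts = s + s := by
  obtain ⟨H, hH⟩ := exists_mem_transversals (h.onCycles_involutive hτ) (h.onCycles_ne hτ h0)
  exact ⟨_, h.parts_of_mem_transversals hτ hH⟩

/-- An invariant set consists of pairs of exchanged cycles. -/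
theorem IsTwisted.exists_card_eq (h : IsTwisted τ σ) (hτ : τ * τ = 1) (h0 : ∀ x, τ x ≠ x)
    {s : Multiset ℕ} (hs : σ.partition.parts = s + s) {U : Finset X}
    (hU : ∀ x, x ∈ U ↔ σ x ∈ U) (hU' : ∀ x, x ∈ U ↔ τ x ∈ U) : ∃ Z ≤ s, U.card = 2 * Z.sum := by
  classical
  obtain ⟨H, hH⟩ := exists_mem_transversals (h.onCycles_involutive hτ) (h.onCycles_ne hτ h0)
  have hsH := h.parts_of_mem_transversals hτ hH
  rw [hs] at hsH
  rw [multiset_add_self_injective hsH]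
  have hc : ∀ x y, σ.SameCycle x y → (x ∈ U ↔ y ∈ U) := fun x y hxy =>
    SameCycle.of_rel ⟨fun x y => x ∈ U ↔ y ∈ U, fun _ => Iff.rfl, Iff.symm, Iff.trans⟩ hU hxy
  let P : Cycle σ → Prop := Quotient.lift (· ∈ U) fun x y hxy => propext (hc x y hxy)
  have hP : ∀ q, P (h.onCycles hτ q) ↔ P q := by
    intro q
    induction q using Quotient.inductionOn with
    | h x => exact (hU' x).symm
  refine ⟨(H.filter P).val.map (cycleSize σ),
    Multiset.map_le_map (Finset.val_le_iff.2 (Finset.filter_subset _ _)), ?_⟩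
  have h1 := sum_apply_mk σ fun q => if P q then 1 else 0
  have h2 := sum_eq_two_mul_of_mem_transversals (h.onCycles_involutive hτ) hH
    (fun q => (cycleSize σ q : ℚ) * if P q then 1 else 0) fun q => by
      simp only [h.cycleSize_onCycles hτ, hP]
  rw [h2] at h1
  have h3 : ∑ x : X, (if P (Quotient.mk _ x) then (1 : ℚ) else 0) = U.card := by
    rw [Finset.sum_boole]
    congr 2
    ext x
    rw [Finset.mem_filter]
    exact and_iff_right (Finset.mem_univ _)
  rw [h3] at h1
  simp only [mul_ite, mul_one, mul_zero] at h1
  rw [← Finset.sum_filter] at h1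
  change U.card = 2 * ∑ q ∈ H.filter P, cycleSize σ q
  exact_mod_cast h1

/-- The transversals of `τ` that are invariant under `σ`. -/
def invariantTransversals (τ σ : Perm X) : Finset (Finset X) :=
  (transversals τ).filter fun H => ∀ x, x ∈ H ↔ σ x ∈ H

theorem IsTwisted.card_invariantTransversals (h : IsTwisted τ σ) (hτ : τ * τ = 1)
    (h0 : ∀ x, τ x ≠ x) {s : Multiset ℕ} (hs : σ.partition.parts = s + s) :
    (invariantTransversals τ σ).card = 2 ^ s.card := by
  classical
  rw [← card_transversals (h.onCycles_involutive hτ) (h.onCycles_ne hτ h0) (m := s.card) (by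
    rw [card_cycle, hs, Multiset.card_add, two_mul])]
  symm
  refine Finset.card_bij
    (fun K _ => Finset.univ.filter fun x => (Quotient.mk _ x : Cycle σ) ∈ K) ?_ ?_ ?_
  · intro K hK
    rw [mem_transversals] at hK
    rw [invariantTransversals, Finset.mem_filter, mem_transversals]
    simp only [Finset.mem_filter, Finset.mem_univ, true_and]
    refine ⟨fun x => hK (Quotient.mk _ x), fun x => ?_⟩
    have : (Quotient.mk _ (σ x) : Cycle σ) = Quotient.mk _ x :=
      Quotient.sound (sameCycle_apply_left.2 (SameCycle.refl σ x))
    rw [this]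
  · intro K _ K' _ hKK
    ext q
    induction q using Quotient.inductionOn with
    | h x =>
      have := congrArg (x ∈ ·) hKK
      simpa using this
  · intro H hH
    rw [invariantTransversals, Finset.mem_filter, mem_transversals] at hH
    have hc : ∀ x y, σ.SameCycle x y → (x ∈ H ↔ y ∈ H) := fun x y hxy =>
      SameCycle.of_rel ⟨fun x y => x ∈ H ↔ y ∈ H, fun _ => Iff.rfl, Iff.symm, Iff.trans⟩ hH.2 hxy
    refine ⟨Finset.univ.filter fun q =>
      Quotient.lift (· ∈ H) (fun x y hxy => propext (hc x y hxy)) q, ?_, ?_⟩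
    · rw [mem_transversals]
      intro q
      induction q using Quotient.inductionOn with
      | h x =>
        simp only [Finset.mem_filter, Finset.mem_univ, true_and]
        exact hH.1 x
    · ext x
      simp

end Twisted

section Counting

open scoped Nat

theorem autCard_eq {k : ℕ} (x : Fin k → ℕ) :
    autCard x = ∏ v ∈ (Finset.univ.val.map x).toFinset, ((Finset.univ.val.map x).count v)! := by
  have h := DomMulAct.stabilizer_card' x
  have h1 : autCard x = Fintype.card {g : Perm (Fin k) // x ∘ g = x} := Nat.card_eq_fintype_card
  rw [h1, h]
  refine Finset.prod_congr rfl fun v _ => ?_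
  rw [Multiset.count_map, Fintype.card_subtype]
  congr 2
  simp only [eq_comm]
  rfl

theorem parts_eq_iff {Y : Type*} [Fintype Y] [DecidableEq Y] {s : Multiset ℕ}
    (h0 : ∀ m ∈ s, 0 < m) (hs : s.sum = Fintype.card Y) (ρ : Perm Y) :
    ρ.partition.parts = s ↔ ρ.cycleType = s.filter (2 ≤ ·) := by
  constructor
  · rintro rfl
    exact filter_parts_partition_eq_cycleType.symm
  · intro h
    have h1 : s.filter (fun m => ¬ 2 ≤ m) =
        Multiset.replicate (s.filter fun m => ¬ 2 ≤ m).card 1 := by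
      refine Multiset.eq_replicate_card.2 fun m hm => ?_
      rw [Multiset.mem_filter] at hm
      have := h0 m hm.1
      omega
    have h2 := Multiset.filter_add_not (2 ≤ ·) s
    have h3 := congrArg Multiset.sum h2
    rw [Multiset.sum_add, h1, Multiset.sum_replicate, hs, ← h, sum_cycleType, smul_eq_mul,
      mul_one] at h3
    rw [parts_partition, ← h2, h, h1, ← h3, Nat.add_sub_cancel_left]

theorem card_parts_mul {Y : Type*} [Fintype Y] [DecidableEq Y] {k : ℕ} {x : Fin k → ℕ}
    (hx : ∀ i, 0 < x i) (hsum : ∑ i, x i = Fintype.card Y) :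
    (Finset.univ.filter fun ρ : Perm Y => ρ.partition.parts = Finset.univ.val.map x).card *
      (autCard x * ∏ i, x i) = (Fintype.card Y)! := by
  set s : Multiset ℕ := Finset.univ.val.map x with hs
  have h0 : ∀ m ∈ s, 0 < m := by
    intro m hm
    obtain ⟨i, -, rfl⟩ := Multiset.mem_map.1 hm
    exact hx i
  have hs' : s.sum = Fintype.card Y := hsum
  have hprod : ∏ i, x i = s.prod := rfl
  set m := s.filter (2 ≤ ·) with hm
  set c := (s.filter fun m => ¬ 2 ≤ m).card with hc
  have h1 : s.filter (fun m => ¬ 2 ≤ m) = Multiset.replicate c 1 := by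
    refine Multiset.eq_replicate_card.2 fun m hm => ?_
    rw [Multiset.mem_filter] at hm
    have := h0 m hm.1
    omega
  have h2 : m + Multiset.replicate c 1 = s := by
    rw [← h1]
    exact Multiset.filter_add_not _ s
  have h3 : m.sum + c = Fintype.card Y := by
    rw [← hs', ← h2, Multiset.sum_add, Multiset.sum_replicate, smul_eq_mul, mul_one]
  have hm1 : 1 ∉ m := fun h => by
    have := (Multiset.mem_filter.1 h).2
    omega
  have h4 : m.prod = s.prod := by
    rw [← h2, Multiset.prod_add, Multiset.prod_replicate, one_pow, mul_one]
  have h5 : c ! * ∏ v ∈ m.toFinset, (m.count v)! = autCard x := by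
    rw [autCard_eq, ← hs, ← h2]
    rcases Nat.eq_zero_or_pos c with hc0 | hc0
    · simp [hc0]
    · rw [Multiset.toFinset_add, Multiset.toFinset_replicate, if_neg hc0.ne', Finset.union_comm,
        ← Finset.insert_eq, Finset.prod_insert (by simpa using hm1)]
      congr 1
      · rw [Multiset.count_add, Multiset.count_replicate_self, Multiset.count_eq_zero_of_notMem hm1,
          zero_add]
      · refine Finset.prod_congr rfl fun v hv => ?_
        have : v ≠ 1 := by
          rintro rfl
          exact hm1 (Multiset.mem_toFinset.1 hv)
        rw [Multiset.count_add, Multiset.count_eq_zero_of_notMem (a := v) (s := Multiset.replicate c 1)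
          (fun h => this (Multiset.eq_of_mem_replicate h)), add_zero]
  have h6 := card_of_cycleType_mul_eq Y m
  rw [if_pos ⟨by omega, fun a ha => (Multiset.mem_filter.1 ha).2⟩,
    show Fintype.card Y - m.sum = c by omega] at h6
  rw [hprod, ← h4, ← h5, ← h6]
  have h7 : (Finset.univ.filter fun ρ : Perm Y => ρ.partition.parts = s) =
      Finset.univ.filter fun ρ : Perm Y => ρ.cycleType = m :=
    Finset.filter_congr fun ρ _ => parts_eq_iff h0 hs' ρ
  rw [h7]
  ring

end Counting

section Restriction

variable {X : Type*} [Fintype X] [DecidableEq X] {τ σ : Perm X} {H : Finset X}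

theorem cycleCard_subtypePerm (hH : ∀ x, σ x ∈ H ↔ x ∈ H) (x : H) :
    cycleCard (σ.subtypePerm hH) x = cycleCard σ x := by
  rw [cycleCard, cycleCard, ← Finset.card_map (Function.Embedding.subtype (· ∈ H))]
  congr 1
  ext y
  rw [Finset.mem_map]
  constructor
  · rintro ⟨z, hz, rfl⟩
    rw [mem_cycleSet] at hz ⊢
    exact sameCycle_subtypePerm.1 hz
  · intro hy
    rw [mem_cycleSet] at hy
    have hyH : y ∈ H := (SameCycle.of_rel
      ⟨fun x y => x ∈ H ↔ y ∈ H, fun _ => Iff.rfl, Iff.symm, Iff.trans⟩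
      (fun x => (hH x).symm) hy).1 x.2
    exact ⟨⟨y, hyH⟩, mem_cycleSet.2 (sameCycle_subtypePerm.2 hy), rfl⟩

theorem IsTwisted.parts_eq_subtypePerm (h : IsTwisted τ σ) (hτ : τ * τ = 1)
    (hH : H ∈ transversals τ) (hH' : ∀ x, σ x ∈ H ↔ x ∈ H) :
    σ.partition.parts =
      (σ.subtypePerm hH').partition.parts + (σ.subtypePerm hH').partition.parts := by
  refine multiset_eq_of_sum_eq fun ψ => ?_
  rw [Multiset.map_add, Multiset.sum_add, sum_parts, sum_parts,
    sum_eq_two_mul_of_mem_transversals (involutive_of_mul_self hτ) hH _ fun x => by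
      rw [h.cycleCard_apply hτ], two_mul]
  simp only [cycleCard_subtypePerm]
  rw [← Finset.sum_coe_sort H]

/-- The twisted permutation with given restriction to a transversal. -/
def twistedExtension (τ : Perm X) (ρ : Perm H) : Perm X :=
  ofSubtype ρ * (τ * (ofSubtype ρ)⁻¹ * τ)

theorem twistedExtension_apply (hτ : τ * τ = 1) (hH : H ∈ transversals τ) (ρ : Perm H) (x : H) :
    twistedExtension τ ρ x = ρ x := by
  rw [mem_transversals] at hH
  have h1 : (ofSubtype ρ)⁻¹ (τ x) = τ x := by
    rw [inv_eq_iff_eq]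
    exact (ofSubtype_apply_of_not_mem ρ ((hH x).1 x.2)).symm
  rw [twistedExtension, mul_apply, mul_apply, mul_apply, h1, involutive_of_mul_self hτ,
    ofSubtype_apply_coe]

theorem twistedExtension_mem (hτ : τ * τ = 1) (hH : H ∈ transversals τ) (ρ : Perm H) (x : X) :
    twistedExtension τ ρ x ∈ H ↔ x ∈ H := by
  have key : ∀ x ∈ H, twistedExtension τ ρ x ∈ H := fun x hx => by
    rw [twistedExtension_apply hτ hH ρ ⟨x, hx⟩]
    exact (ρ ⟨x, hx⟩).2
  refine ⟨fun h => ?_, key x⟩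
  have hinj : Set.SurjOn (twistedExtension τ ρ) H H :=
    Finset.surjOn_of_injOn_of_card_le _ key (twistedExtension τ ρ).injective.injOn le_rfl
  obtain ⟨y, hy, hyx⟩ := hinj h
  rwa [← (twistedExtension τ ρ).injective hyx]

theorem isTwisted_twistedExtension (hτ : τ * τ = 1) (hH : H ∈ transversals τ) (ρ : Perm H) :
    IsTwisted τ (twistedExtension τ ρ) := by
  have hinv : τ⁻¹ = τ := inv_eq_of_mul_eq_one_left hτ
  refine ⟨?_, fun x hx => ?_⟩
  · rw [twistedExtension, mul_inv_rev, mul_inv_rev, mul_inv_rev, inv_inv, hinv]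
    calc τ * (ofSubtype ρ * (τ * (ofSubtype ρ)⁻¹ * τ)) * τ =
        τ * ofSubtype ρ * τ * (ofSubtype ρ)⁻¹ * (τ * τ) := by simp only [mul_assoc]
      _ = _ := by rw [hτ, mul_one]; simp only [mul_assoc]
  · have h1 := twistedExtension_mem hτ hH ρ x
    rw [hx] at h1
    rw [mem_transversals] at hH
    have := hH x
    tauto

theorem card_isTwisted_of_transversal (hτ : τ * τ = 1) (hH : H ∈ transversals τ)
    (s : Multiset ℕ) [DecidablePred (IsTwisted τ)] :
    (Finset.univ.filter fun σ : Perm X => IsTwisted τ σ ∧ σ.partition.parts = s + s ∧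
      ∀ x, x ∈ H ↔ σ x ∈ H).card =
      (Finset.univ.filter fun ρ : Perm H => ρ.partition.parts = s).card := by
  symm
  refine Finset.card_bij (fun ρ _ => twistedExtension τ ρ) ?_ ?_ ?_
  · intro ρ hρ
    rw [Finset.mem_filter] at hρ ⊢
    have h1 := isTwisted_twistedExtension hτ hH ρ
    refine ⟨Finset.mem_univ _, h1, ?_, fun x => (twistedExtension_mem hτ hH ρ x).symm⟩
    rw [h1.parts_eq_subtypePerm hτ hH (twistedExtension_mem hτ hH ρ), ← hρ.2]
    have : (twistedExtension τ ρ).subtypePerm (twistedExtension_mem hτ hH ρ) = ρ := by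
      ext x
      exact twistedExtension_apply hτ hH ρ x
    rw [this]
  · intro ρ _ ρ' _ h
    ext x
    rw [← twistedExtension_apply hτ hH ρ x, ← twistedExtension_apply hτ hH ρ' x, h]
  · intro σ hσ
    rw [Finset.mem_filter] at hσ
    obtain ⟨-, h1, h2, h3⟩ := hσ
    have h3' : ∀ x, σ x ∈ H ↔ x ∈ H := fun x => (h3 x).symm
    refine ⟨σ.subtypePerm h3', ?_, ?_⟩
    · rw [Finset.mem_filter]
      refine ⟨Finset.mem_univ _, multiset_add_self_injective ?_⟩
      rw [← h1.parts_eq_subtypePerm hτ hH h3', h2]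
    · have h4 := isTwisted_twistedExtension hτ hH (σ.subtypePerm h3')
      have h5 : ∀ x ∈ H, twistedExtension τ (σ.subtypePerm h3') x = σ x := fun x hx =>
        twistedExtension_apply hτ hH _ ⟨x, hx⟩
      have h6 : ∀ x ∈ H, (twistedExtension τ (σ.subtypePerm h3'))⁻¹ x = σ⁻¹ x := fun x hx => by
        rw [inv_eq_iff_eq, h5 _ ((h3 _).2 (by simpa using hx))]
        simp
      ext x
      by_cases hx : x ∈ H
      · exact h5 x hx
      · have hx' : τ x ∈ H := by
          have := mem_transversals.1 hH x
          tauto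
        have h7 := congrArg (fun π : Perm X => π (τ x)) h4.1
        have h8 := congrArg (fun π : Perm X => π (τ x)) h1.1
        simp only [mul_apply, involutive_of_mul_self hτ x] at h7 h8
        rw [h6 _ hx', ← h8] at h7
        exact τ.injective h7

theorem card_isTwisted_mul (hτ : τ * τ = 1) (h0 : ∀ x, τ x ≠ x) {n k : ℕ}
    (hn : Fintype.card X = 2 * n) {x : Fin k → ℕ} (hx : ∀ i, 0 < x i) (hsum : ∑ i, x i = n)
    [DecidablePred (IsTwisted τ)] :
    (Finset.univ.filter fun σ : Perm X => IsTwisted τ σ ∧ σ.partition.parts =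
      Finset.univ.val.map x + Finset.univ.val.map x).card * 2 ^ k *
        (autCard x * ∏ i, x i) = 2 ^ n * n.factorial := by
  set s : Multiset ℕ := Finset.univ.val.map x with hs
  have hcard : s.card = k := by rw [hs, Multiset.card_map, Finset.card_val, Finset.card_fin]
  have h1 : ∑ σ ∈ Finset.univ.filter fun σ : Perm X => IsTwisted τ σ ∧ σ.partition.parts = s + s,
      (invariantTransversals τ σ).card = ∑ H ∈ transversals τ,
        (Finset.univ.filter fun σ : Perm X => IsTwisted τ σ ∧ σ.partition.parts = s + s ∧
          ∀ x, x ∈ H ↔ σ x ∈ H).card := by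
    simp only [invariantTransversals, Finset.card_filter (fun H => ∀ x, x ∈ H ↔ _ ∈ H)]
    rw [Finset.sum_comm]
    refine Finset.sum_congr rfl fun H _ => ?_
    rw [← Finset.card_filter, Finset.filter_filter]
    simp only [and_assoc]
  rw [Finset.sum_congr rfl fun σ hσ => IsTwisted.card_invariantTransversals
      (Finset.mem_filter.1 hσ).2.1 hτ h0 (Finset.mem_filter.1 hσ).2.2,
    Finset.sum_const, smul_eq_mul, hcard] at h1
  rw [h1, Finset.sum_mul, ← card_transversals (involutive_of_mul_self hτ) h0 hn]
  refine Finset.sum_const_nat fun H hH => ?_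
  have hHn : Fintype.card H = n := by
    have := card_eq_two_mul_of_mem_transversals (involutive_of_mul_self hτ) hH
    rw [Fintype.card_coe]
    omega
  rw [card_isTwisted_of_transversal hτ hH s, ← hHn,
    ← card_parts_mul hx (Y := H) (by rw [hsum, hHn])]

end Restriction

end TwistedHurwitz

namespace TwistedHurwitz

open Equiv Equiv.Perm

theorem pickSum_eq_sum (g : ℕ → Multiset ℕ → ℚ) (s : Multiset ℕ) :
    pickSum g s = (s.map fun a => g a (s.erase a)).sum := by
  simp only [pickSum]
  convert rfl

theorem conj_swap {X : Type*} [DecidableEq X] {τ : Perm X} (hτ : τ * τ = 1) (a b : X) : τ * swap a b * τ = swap (τ a) (τ b) := by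
  rw [mul_swap_eq_swap_mul, mul_assoc, hτ, mul_one]

theorem IsTwisted.sameCycle_apply_comm {X : Type*} {τ σ : Perm X} {a b : X} (h : IsTwisted τ σ) (hτ : τ * τ = 1) :
    σ.SameCycle a (τ b) ↔ σ.SameCycle b (τ a) := by
  rw [← h.sameCycle_apply hτ, involutive_of_mul_self hτ b, sameCycle_comm]

theorem swap_mul_pow_apply {X : Type*} [DecidableEq X] {σ : Perm X} {a b : X} (h1 : σ.SameCycle a b) {x : X} (hx : ¬ σ.SameCycle a x) (q : ℕ) :
    ((swap a b * σ) ^ q) x = (σ ^ q) x := by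
  induction q with
  | zero => rfl
  | succ q ih =>
    rw [pow_succ', pow_succ', mul_apply, ih, mul_apply, mul_apply]
    have h2 : ¬ σ.SameCycle a (σ ((σ ^ q) x)) := by
      rwa [sameCycle_apply_right, sameCycle_pow_right]
    exact swap_apply_of_ne_of_ne (fun h => h2 (h.symm ▸ SameCycle.refl _ _)) fun h => h2 (h ▸ h1)

/-- The result of successive twisted conjugations. -/
def iterTwist {X : Type*} (τ σ : Perm X) {m : ℕ} (η : Fin m → Perm X) : Perm X :=
  (List.ofFn η).reverse.prod * σ * (List.ofFn fun i => τ * η i * τ).prod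

theorem iterTwist_zero {X : Type*} {τ σ : Perm X} (η : Fin 0 → Perm X) : iterTwist τ σ η = σ := by
  simp [iterTwist]

theorem iterTwist_cons {X : Type*} {τ σ : Perm X} {m : ℕ} (η₀ : Perm X) (η : Fin m → Perm X) :
    iterTwist τ σ (Fin.cons η₀ η : Fin (m + 1) → Perm X) = iterTwist τ (twist τ η₀ σ) η := by
  simp only [iterTwist, twist, List.ofFn_succ, List.reverse_cons, List.prod_append, List.prod_cons,
    List.prod_nil, Fin.cons_zero, Fin.cons_succ, mul_one, mul_assoc]

theorem twist_swap_inv {X : Type*} [DecidableEq X] {τ σ : Perm X} {a b : X} (hτ : τ * τ = 1) :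
    (twist τ (swap a b) σ)⁻¹ = swap (τ a) (τ b) * (swap a b * σ)⁻¹ := by
  rw [twist, conj_swap hτ, mul_inv_rev, swap_inv]

/-- The transpositions that do not commute with `τ`. -/
def Allowed {X : Type*} [DecidableEq X] (τ η : Perm X) : Prop := η.IsSwap ∧ η ≠ τ * η * τ

theorem allowed_swap_iff {X : Type*} [DecidableEq X] {τ : Perm X} {a b : X} (hτ : τ * τ = 1) (h0 : ∀ x, τ x ≠ x) (hab : a ≠ b) :
    Allowed τ (swap a b) ↔ b ≠ τ a := by
  rw [Allowed, conj_swap hτ]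
  constructor
  · rintro ⟨-, h⟩ rfl
    refine h ?_
    rw [involutive_of_mul_self hτ, swap_comm]
  · refine fun h => ⟨⟨a, b, hab, rfl⟩, fun h' => ?_⟩
    have h1 := congrArg (fun π : Perm X => π a) h'
    simp only [swap_apply_left] at h1
    by_cases h2 : a = τ b
    · refine h ?_
      rw [h2, involutive_of_mul_self hτ]
    · rw [swap_apply_of_ne_of_ne (h0 a).symm h2] at h1
      exact hab h1.symm

section Step

variable {X : Type*} [Fintype X] [DecidableEq X] {τ σ : Perm X} {a b : X} {s : Multiset ℕ}

theorem parts_twist_swap (hτ : τ * τ = 1) :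
    (twist τ (swap a b) σ).partition.parts =
      (swap (τ a) (τ b) * (swap a b * σ)⁻¹).partition.parts := by
  rw [← twist_swap_inv hτ, parts_inv]

theorem parts_twist_join_aux (h : IsTwisted τ σ) (hτ : τ * τ = 1) (h0 : ∀ x, τ x ≠ x)
    (h1 : ¬ σ.SameCycle a b) (h2 : ¬ σ.SameCycle (τ a) b) :
    (twist τ (swap a b) σ).partition.parts + {cycleCard σ a, cycleCard σ b} +
      {cycleCard σ a, cycleCard σ b} = σ.partition.parts + {cycleCard σ a + cycleCard σ b} +
        {cycleCard σ a + cycleCard σ b} := by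
  have hau := h.not_sameCycle hτ h0 a
  have hbv := h.not_sameCycle hτ h0 b
  have hbu : ¬ σ.SameCycle b (τ a) := fun h' => h2 h'.symm
  have hav : ¬ σ.SameCycle a (τ b) := by rwa [h.sameCycle_apply_comm hτ]
  have hu : cycleCard (swap a b * σ) (τ a) = cycleCard σ (τ a) :=
    congrArg Finset.card (cycleSet_swap_mul_of_not h1 hau hbu)
  have hv : cycleCard (swap a b * σ) (τ b) = cycleCard σ (τ b) :=
    congrArg Finset.card (cycleSet_swap_mul_of_not h1 hav hbv)
  have huv : ¬ (swap a b * σ)⁻¹.SameCycle (τ a) (τ b) := by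
    rw [sameCycle_inv, ← mem_cycleSet, cycleSet_swap_mul_of_not h1 hau hbu, mem_cycleSet,
      h.sameCycle_apply hτ]
    exact h1
  have key := parts_swap_mul_of_not_sameCycle huv
  rw [← parts_twist_swap hτ, cycleCard_inv, cycleCard_inv, parts_inv, hu, hv,
    h.cycleCard_apply hτ, h.cycleCard_apply hτ] at key
  rw [key, add_right_comm, parts_swap_mul_of_not_sameCycle h1]

theorem IsTwisted.parts_twist_join (h : IsTwisted τ σ) (hτ : τ * τ = 1) (h0 : ∀ x, τ x ≠ x)
    (hs : σ.partition.parts = s + s) (h1 : ¬ σ.SameCycle a b) (h2 : ¬ σ.SameCycle (τ a) b) :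
    (twist τ (swap a b) σ).partition.parts =
      (cycleCard σ a + cycleCard σ b) ::ₘ (s.erase (cycleCard σ a)).erase (cycleCard σ b) +
      (cycleCard σ a + cycleCard σ b) ::ₘ (s.erase (cycleCard σ a)).erase (cycleCard σ b) := by
  obtain ⟨t, ht⟩ := (isTwisted_twist h hτ (swap_mul_self a b)).exists_parts hτ h0
  have key := parts_twist_join_aux h hτ h0 h1 h2
  rw [ht, hs] at key
  set i := cycleCard σ a
  set j := cycleCard σ b
  have hi : 0 < i := cycleCard_pos _ _
  have hj : 0 < j := cycleCard_pos _ _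
  have key' : t + {i, j} = s + {i + j} := by
    refine multiset_add_self_injective ?_
    calc t + {i, j} + (t + {i, j}) = t + t + {i, j} + {i, j} := by abel
      _ = _ := by rw [key]; abel
  have his : i ∈ s := by
    have : i ∈ s + {i + j} := key' ▸ by simp
    rcases Multiset.mem_add.1 this with h | h
    · exact h
    · rw [Multiset.mem_singleton] at h
      omega
  obtain ⟨r, rfl⟩ := Multiset.exists_cons_of_mem his
  have key2 : t + {j} = r + {i + j} := by
    rw [Multiset.insert_eq_cons, Multiset.add_cons, Multiset.cons_add] at key'
    exact (Multiset.cons_inj_right i).1 key'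
  have hjr : j ∈ r := by
    have : j ∈ r + {i + j} := key2 ▸ by simp
    rcases Multiset.mem_add.1 this with h | h
    · exact h
    · rw [Multiset.mem_singleton] at h
      omega
  obtain ⟨r', rfl⟩ := Multiset.exists_cons_of_mem hjr
  have key3 : t = (i + j) ::ₘ r' := by
    rw [← Multiset.singleton_add, add_comm t, add_assoc] at key2
    rw [add_left_cancel key2, add_comm, Multiset.singleton_add]
  rw [ht, Multiset.erase_cons_head, Multiset.erase_cons_head, key3]

theorem IsTwisted.parts_twist_cut (h : IsTwisted τ σ) (hτ : τ * τ = 1) (h0 : ∀ x, τ x ≠ x)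
    (hs : σ.partition.parts = s + s) {p : ℕ} (hp0 : 0 < p) (hp : p < cycleCard σ a) :
    (twist τ (swap a ((σ ^ p) a)) σ).partition.parts =
      p ::ₘ (cycleCard σ a - p) ::ₘ s.erase (cycleCard σ a) +
        p ::ₘ (cycleCard σ a - p) ::ₘ s.erase (cycleCard σ a) := by
  obtain ⟨t, ht⟩ := (isTwisted_twist h hτ (swap_mul_self a ((σ ^ p) a))).exists_parts hτ h0
  have hau := h.not_sameCycle hτ h0 a
  have hab : σ.SameCycle a ((σ ^ p) a) := ⟨p, by simp⟩
  have hav : ¬ σ.SameCycle a (τ ((σ ^ p) a)) := by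
    rw [h.sameCycle_apply_comm hτ, sameCycle_pow_left]
    exact hau
  have hcard : cycleCard (swap a ((σ ^ p) a) * σ)⁻¹ (τ a) = cycleCard σ a := by
    rw [cycleCard_inv, ← h.cycleCard_apply hτ]
    refine congrArg Finset.card ?_
    ext y
    rw [mem_cycleSet, mem_cycleSet, sameCycle_swap_mul_iff_of_not hab hau]
  have hv : ((swap a ((σ ^ p) a) * σ)⁻¹ ^ p) (τ a) = τ ((σ ^ p) a) := by
    rw [inv_pow, inv_eq_iff_eq, swap_mul_pow_apply hab hav]
    have := h.apply_zpow hτ p a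
    rw [zpow_natCast] at this
    rw [this, zpow_neg, zpow_natCast, ← mul_apply, mul_inv_cancel, one_apply]
  have key1 := parts_swap_pow_mul σ a hp0 hp
  have key2 := parts_swap_pow_mul (swap a ((σ ^ p) a) * σ)⁻¹ (τ a) hp0 (by rwa [hcard])
  rw [hcard, hv, ← parts_twist_swap hτ, parts_inv, ht] at key2
  rw [hs] at key1
  set i := cycleCard σ a
  have key' : t + {i} = s + {p, i - p} := by
    refine multiset_add_self_injective ?_
    calc t + {i} + (t + {i}) = t + t + {i} + {i} := by abel
      _ = _ := by
        rw [← key2, add_right_comm, ← key1]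
        abel
  have his : i ∈ s := by
    have : i ∈ s + {p, i - p} := key' ▸ by simp
    rcases Multiset.mem_add.1 this with h | h
    · exact h
    · simp only [Multiset.insert_eq_cons, Multiset.mem_cons, Multiset.mem_singleton] at h
      omega
  obtain ⟨r, rfl⟩ := Multiset.exists_cons_of_mem his
  have key3 : t = p ::ₘ (i - p) ::ₘ r := by
    rw [← Multiset.singleton_add, add_comm t, add_assoc] at key'
    rw [add_left_cancel key', Multiset.insert_eq_cons, Multiset.add_cons, add_comm,
      Multiset.singleton_add]
  rw [ht, Multiset.erase_cons_head, key3]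

theorem IsTwisted.parts_twist_stay (h : IsTwisted τ σ) (hτ : τ * τ = 1) (h0 : ∀ x, τ x ≠ x)
    (h1 : σ.SameCycle (τ a) b) : (twist τ (swap a b) σ).partition.parts = σ.partition.parts := by
  obtain ⟨s, hs⟩ := h.exists_parts hτ h0
  obtain ⟨t, ht⟩ := (isTwisted_twist h hτ (swap_mul_self a b)).exists_parts hτ h0
  have hau := h.not_sameCycle hτ h0 a
  have hab : ¬ σ.SameCycle a b := fun h' => hau (h'.trans h1.symm)
  have hav : σ.SameCycle a (τ b) := by
    rw [h.sameCycle_apply_comm hτ]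
    exact h1.symm
  have hne : τ a ≠ τ b := fun h' => hab (τ.injective h' ▸ SameCycle.refl _ _)
  have hji : cycleCard σ b = cycleCard σ a := by
    rw [← cycleCard_eq h1, h.cycleCard_apply hτ]
  have huv : (swap a b * σ)⁻¹.SameCycle (τ a) (τ b) := by
    rw [sameCycle_inv, sameCycle_swap_mul_iff hab]
    exact .inr ⟨.inr h1.symm, .inl hav⟩
  have hcard : cycleCard (swap a b * σ)⁻¹ (τ a) = cycleCard σ a + cycleCard σ a := by
    have : (swap a b * σ).SameCycle (τ a) a := by
      rw [sameCycle_swap_mul_iff hab]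
      exact .inr ⟨.inr h1.symm, .inl (SameCycle.refl _ _)⟩
    rw [cycleCard_inv, cycleCard_eq this, cycleCard_swap_mul hab, hji]
  have key1 := parts_swap_mul_of_not_sameCycle hab
  obtain ⟨hq, key2⟩ := parts_swap_mul_of_sameCycle hne huv
  rw [← parts_twist_swap hτ, parts_inv, hcard, ht] at key2
  rw [hji, hs] at key1
  rw [hcard] at hq
  set i := cycleCard σ a
  set q := cycleCard (swap (τ a) (τ b) * (swap a b * σ)⁻¹) (τ a)
  set q' := cycleCard (swap (τ a) (τ b) * (swap a b * σ)⁻¹) (τ b)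
  have key : s + s + {q, q'} = t + t + {i, i} := by
    refine add_right_cancel (b := {i + i}) ?_
    rw [add_right_comm, ← key1, add_right_comm, key2]
    abel
  have hqq : q = q' := by
    by_contra hne'
    have := congrArg (Multiset.count q) key
    simp only [Multiset.count_add, Multiset.insert_eq_cons, Multiset.count_cons,
      Multiset.count_singleton, if_neg hne', if_true] at this
    split_ifs at this <;> omega
  have hqi : q = i := by omega
  rw [← hqq, hqi] at key
  rw [ht, hs, add_right_cancel key]

theorem sum_allowed [DecidablePred (Allowed τ)] (hτ : τ * τ = 1) (h0 : ∀ x, τ x ≠ x)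
    (G : Perm X → ℚ) :
    ∑ a, ∑ b ∈ Finset.univ.filter fun b => b ≠ a ∧ b ≠ τ a, G (swap a b) =
      2 * ∑ η ∈ Finset.univ.filter (Allowed τ), G η := by
  rw [Finset.sum_sigma', ← Finset.sum_fiberwise_of_maps_to (t := Finset.univ.filter (Allowed τ))
    (g := fun q : Σ _ : X, X => swap q.1 q.2) ?_, Finset.mul_sum]
  · refine Finset.sum_congr rfl fun η hη => ?_
    have hη' := (Finset.mem_filter.1 hη).2
    obtain ⟨a, b, hab, rfl⟩ := hη'.1
    rw [allowed_swap_iff hτ h0 hab] at hη'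
    have hba : a ≠ τ b := fun h => hη' (by rw [h, involutive_of_mul_self hτ])
    have hfib : ((Finset.univ.sigma fun a => Finset.univ.filter fun b => b ≠ a ∧ b ≠ τ a).filter
        fun q : Σ _ : X, X => swap q.1 q.2 = swap a b) = {⟨a, b⟩, ⟨b, a⟩} := by
      ext ⟨c, d⟩
      simp only [Finset.mem_filter, Finset.mem_sigma, Finset.mem_univ, true_and, Finset.mem_insert,
        Finset.mem_singleton, Sigma.mk.injEq, heq_eq_eq]
      constructor
      · rintro ⟨⟨hdc, -⟩, h⟩
        have h1 := congrArg (fun π : Perm X => π c) h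
        simp only [swap_apply_left] at h1
        by_cases hca : c = a
        · subst hca
          rw [swap_apply_left] at h1
          exact .inl ⟨rfl, h1⟩
        · by_cases hcb : c = b
          · subst hcb
            rw [swap_apply_right] at h1
            exact .inr ⟨rfl, h1⟩
          · rw [swap_apply_of_ne_of_ne hca hcb] at h1
            exact absurd h1 hdc
      · rintro (⟨rfl, rfl⟩ | ⟨rfl, rfl⟩)
        · exact ⟨⟨hab.symm, hη'⟩, rfl⟩
        · exact ⟨⟨hab, hba⟩, swap_comm _ _⟩
    rw [hfib, Finset.sum_pair (by simp [hab]), swap_comm b a]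
    ring
  · rintro ⟨a, b⟩ h
    simp only [Finset.mem_sigma, Finset.mem_filter, Finset.mem_univ, true_and] at h ⊢
    exact (allowed_swap_iff hτ h0 h.1.symm).2 h.2

theorem sum_cycleSet_erase (σ : Perm X) (a : X) (F : X → ℚ) :
    ∑ b ∈ (cycleSet σ a).erase a, F b = ∑ p ∈ Finset.Ioo 0 (cycleCard σ a), F ((σ ^ p) a) := by
  symm
  refine Finset.sum_bij (fun p _ => (σ ^ p) a) ?_ ?_ ?_ fun _ _ => rfl
  · intro p hp
    rw [Finset.mem_Ioo] at hp
    rw [Finset.mem_erase, mem_cycleSet]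
    refine ⟨fun h => ?_, ⟨p, by simp⟩⟩
    have := pow_apply_injOn σ a hp.2 (cycleCard_pos σ a) h
    omega
  · intro p hp q hq h
    exact pow_apply_injOn σ a (Finset.mem_Ioo.1 hp).2 (Finset.mem_Ioo.1 hq).2 h
  · intro b hb
    rw [Finset.mem_erase, mem_cycleSet] at hb
    obtain ⟨p, hp, rfl⟩ := exists_pow_apply_eq hb.2
    refine ⟨p, Finset.mem_Ioo.2 ⟨Nat.pos_of_ne_zero ?_, hp⟩, rfl⟩
    rintro rfl
    exact hb.1 rfl

theorem sum_cycleSet_const (σ : Perm X) (a : X) (φ : ℕ → ℚ) :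
    ∑ b ∈ cycleSet σ a, φ (cycleCard σ b) = cycleCard σ a * φ (cycleCard σ a) := by
  rw [Finset.sum_congr rfl fun b hb => by rw [← cycleCard_eq (mem_cycleSet.1 hb)],
    Finset.sum_const, nsmul_eq_mul, ← cycleCard]

theorem IsTwisted.sum_twist_swap (h : IsTwisted τ σ) (hτ : τ * τ = 1) (h0 : ∀ x, τ x ≠ x)
    (hs : σ.partition.parts = s + s) {f : Multiset ℕ → ℚ} {G : Perm X → ℚ}
    (hG : ∀ σ, IsTwisted τ σ → ∀ t, σ.partition.parts = t + t → G σ = f t) (a : X) :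
    ∑ b ∈ Finset.univ.filter fun b => b ≠ a ∧ b ≠ τ a, G (twist τ (swap a b) σ) =
      pickSum (fun j r => 2 * j * f ((cycleCard σ a + j) ::ₘ r)) (s.erase (cycleCard σ a)) +
      ∑ p ∈ Finset.Ioo 0 (cycleCard σ a),
        f (p ::ₘ (cycleCard σ a - p) ::ₘ s.erase (cycleCard σ a)) +
      ((cycleCard σ a : ℚ) - 1) * f (cycleCard σ a ::ₘ s.erase (cycleCard σ a)) := by
  have hau := h.not_sameCycle hτ h0 a
  have hGt : ∀ {b : X} {t : Multiset ℕ}, (twist τ (swap a b) σ).partition.parts = t + t →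
      G (twist τ (swap a b) σ) = f t := fun {b} {t} ht => hG _ (isTwisted_twist h hτ (swap_mul_self a b)) t ht
  have hdisj := disjoint_cycleSet hau
  have hmem : cycleCard σ a ∈ s := by
    have := cycleCard_mem_parts σ a
    rw [hs, Multiset.mem_add, or_self] at this
    exact this
  have hset : (Finset.univ.filter fun b => b ≠ a ∧ b ≠ τ a) =
      ((cycleSet σ a ∪ cycleSet σ (τ a))ᶜ ∪ (cycleSet σ a).erase a) ∪
        (cycleSet σ (τ a)).erase (τ a) := by
    ext b
    simp only [Finset.mem_filter, Finset.mem_univ, true_and, Finset.mem_union, Finset.mem_compl,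
      Finset.mem_erase]
    have h1 : b ∈ cycleSet σ a → b ≠ τ a := fun hb hb' => hau (mem_cycleSet.1 (hb' ▸ hb))
    have h2 : b ∈ cycleSet σ (τ a) → b ≠ a := fun hb hb' => hau (mem_cycleSet.1 (hb' ▸ hb)).symm
    have h3 : b = a → b ∈ cycleSet σ a := fun hb => mem_cycleSet.2 (hb ▸ SameCycle.refl _ _)
    have h4 : b = τ a → b ∈ cycleSet σ (τ a) := fun hb => mem_cycleSet.2 (hb ▸ SameCycle.refl _ _)
    tauto
  have hd1 : Disjoint (cycleSet σ a ∪ cycleSet σ (τ a))ᶜ ((cycleSet σ a).erase a) := by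
    rw [Finset.disjoint_left]
    intro b hb hb'
    rw [Finset.mem_compl, Finset.mem_union] at hb
    exact hb (.inl (Finset.mem_of_mem_erase hb'))
  have hd2 : Disjoint ((cycleSet σ a ∪ cycleSet σ (τ a))ᶜ ∪ (cycleSet σ a).erase a)
      ((cycleSet σ (τ a)).erase (τ a)) := by
    rw [Finset.disjoint_left]
    intro b hb hb'
    have hb2 := Finset.mem_of_mem_erase hb'
    rw [Finset.mem_union, Finset.mem_compl, Finset.mem_union] at hb
    rcases hb with hb | hb
    · exact hb (.inr hb2)
    · exact Finset.disjoint_left.1 hdisj (Finset.mem_of_mem_erase hb) hb2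
  rw [hset, Finset.sum_union hd2, Finset.sum_union hd1]
  congr 1
  · congr 1
    · let φ : ℕ → ℚ := fun j =>
        f ((cycleCard σ a + j) ::ₘ (s.erase (cycleCard σ a)).erase j)
      have h1 : ∑ b ∈ (cycleSet σ a ∪ cycleSet σ (τ a))ᶜ, G (twist τ (swap a b) σ) =
          ∑ b ∈ (cycleSet σ a ∪ cycleSet σ (τ a))ᶜ, φ (cycleCard σ b) := by
        refine Finset.sum_congr rfl fun b hb => ?_
        rw [Finset.mem_compl, Finset.mem_union, mem_cycleSet, mem_cycleSet, not_or] at hb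
        exact hGt (h.parts_twist_join hτ h0 hs hb.1 hb.2)
      have h2 := Finset.sum_add_sum_compl (cycleSet σ a ∪ cycleSet σ (τ a))
        fun b => φ (cycleCard σ b)
      rw [sum_cycleCard, hs, Finset.sum_union hdisj, sum_cycleSet_const, sum_cycleSet_const,
        h.cycleCard_apply hτ, Multiset.map_add, Multiset.sum_add, ← Multiset.cons_erase hmem,
        Multiset.map_cons, Multiset.sum_cons] at h2
      rw [h1, pickSum_eq_sum]
      have h3 : ((s.erase (cycleCard σ a)).map fun j : ℕ => 2 * (j : ℚ) *
          f ((cycleCard σ a + j) ::ₘ (s.erase (cycleCard σ a)).erase j)).sum =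
          2 * ((s.erase (cycleCard σ a)).map fun j : ℕ => (j : ℚ) * φ j).sum := by
        rw [← Multiset.sum_map_mul_left]
        simp only [φ, mul_assoc]
      rw [h3]
      linarith
    · rw [sum_cycleSet_erase]
      refine Finset.sum_congr rfl fun p hp => ?_
      rw [Finset.mem_Ioo] at hp
      exact hGt (h.parts_twist_cut hτ h0 hs hp.1 hp.2)
  · rw [Multiset.cons_erase hmem]
    have h1 : ∀ b ∈ (cycleSet σ (τ a)).erase (τ a), G (twist τ (swap a b) σ) = f s := by
      intro b hb
      have hb' := mem_cycleSet.1 (Finset.mem_of_mem_erase hb)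
      exact hGt (by rw [h.parts_twist_stay hτ h0 hb', hs])
    rw [Finset.sum_congr rfl h1, Finset.sum_const, Finset.card_erase_of_mem
      (mem_cycleSet.2 (SameCycle.refl _ _)), nsmul_eq_mul, ← cycleCard, h.cycleCard_apply hτ,
      Nat.cast_sub (cycleCard_pos σ a), Nat.cast_one]

/-- The cut-and-join operator describes the effect of a twisted conjugation on cycle types. -/
theorem IsTwisted.sum_twist [DecidablePred (Allowed τ)] (h : IsTwisted τ σ) (hτ : τ * τ = 1)
    (h0 : ∀ x, τ x ≠ x) (hs : σ.partition.parts = s + s) {f : Multiset ℕ → ℚ} {G : Perm X → ℚ}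
    (hG : ∀ σ, IsTwisted τ σ → ∀ t, σ.partition.parts = t + t → G σ = f t) :
    ∑ η ∈ Finset.univ.filter (Allowed τ), G (twist τ η σ) = cutJoin f s := by
  have h1 := sum_allowed hτ h0 fun η => G (twist τ η σ)
  simp only [h.sum_twist_swap hτ h0 hs hG] at h1
  rw [sum_cycleCard σ fun i => pickSum (fun j r => 2 * j * f ((i + j) ::ₘ r)) (s.erase i) +
      ∑ p ∈ Finset.Ioo 0 i, f (p ::ₘ (i - p) ::ₘ s.erase i) +
      ((i : ℚ) - 1) * f (i ::ₘ s.erase i), hs, Multiset.map_add, Multiset.sum_add] at h1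
  rw [cutJoin, pickSum_eq_sum]
  linarith

theorem IsTwisted.sum_iterTwist (hτ : τ * τ = 1) (h0 : ∀ x, τ x ≠ x) {f : Multiset ℕ → ℚ}
    {G : Perm X → ℚ} (hG : ∀ σ, IsTwisted τ σ → ∀ t, σ.partition.parts = t + t → G σ = f t)
    [DecidablePred (Allowed τ)] (m : ℕ) (h : IsTwisted τ σ) (hs : σ.partition.parts = s + s) :
    ∑ η : Fin m → Perm X, (if ∀ i, Allowed τ (η i) then G (iterTwist τ σ η) else 0) =
      (cutJoin^[m] f) s := by
  induction m generalizing σ s with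
  | zero => simp [iterTwist_zero, hG σ h s hs]
  | succ m ih =>
    rw [sum_fin_succ_fun, Function.iterate_succ_apply', ← h.sum_twist hτ h0 hs
      (G := fun σ => ∑ η : Fin m → Perm X,
        if ∀ i, Allowed τ (η i) then G (iterTwist τ σ η) else 0)
      (fun σ' h' t ht => ih h' ht), Finset.sum_filter]
    refine Finset.sum_congr rfl fun η₀ _ => ?_
    simp only [Fin.forall_fin_succ, Fin.cons_zero, Fin.cons_succ, iterTwist_cons]
    by_cases h1 : Allowed τ η₀
    · simp [h1]
    · simp [h1]

end Step

end TwistedHurwitz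

namespace TwistedHurwitz

open Equiv Equiv.Perm

theorem isTwisted_iterTwist {X : Type*} [DecidableEq X] {τ σ : Perm X} (hτ : τ * τ = 1) {m : ℕ} {η : Fin m → Perm X}
    (hη : ∀ i, Allowed τ (η i)) (h : IsTwisted τ σ) : IsTwisted τ (iterTwist τ σ η) := by
  induction m generalizing σ with
  | zero => rwa [iterTwist_zero]
  | succ m ih =>
    rw [← Fin.cons_self_tail η, iterTwist_cons]
    refine ih (fun i => hη i.succ) (isTwisted_twist h hτ ?_)
    obtain ⟨a, b, -, hab⟩ := (hη 0).1
    rw [hab, swap_mul_self]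

theorem iterTwist_mem {X : Type*} {τ σ : Perm X} {G : Subgroup (Perm X)} {m : ℕ} {η : Fin m → Perm X} (hσ : σ ∈ G)
    (hη : ∀ i, η i ∈ G) (hη' : ∀ i, τ * η i * τ ∈ G) : iterTwist τ σ η ∈ G := by
  rw [iterTwist]
  refine G.mul_mem (G.mul_mem (Subgroup.list_prod_mem _ fun g hg => ?_) hσ)
    (Subgroup.list_prod_mem _ fun g hg => ?_)
  · rw [List.mem_reverse, List.mem_ofFn] at hg
    obtain ⟨i, rfl⟩ := hg
    exact hη i
  · rw [List.mem_ofFn] at hg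
    obtain ⟨i, rfl⟩ := hg
    exact hη' i

section Transitivity

variable {X : Type*} [Fintype X] [DecidableEq X] {τ σ : Perm X}

/-- If no element of `G` maps a point to its image under `τ`, every twisted conjugation changes the
parity of the number of cycle pairs. -/
theorem even_card_of_forall_ne (hτ : τ * τ = 1) (h0 : ∀ x, τ x ≠ x) {G : Subgroup (Perm X)}
    (hG : ∀ g ∈ G, ∀ a, g a ≠ τ a) {m : ℕ} {η : Fin m → Perm X}
    (hη : ∀ i, Allowed τ (η i)) (hηG : ∀ i, η i ∈ G) (hηG' : ∀ i, τ * η i * τ ∈ G)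
    (h : IsTwisted τ σ) (hσ : σ ∈ G) {s t : Multiset ℕ} (hs : σ.partition.parts = s + s)
    (ht : (iterTwist τ σ η).partition.parts = t + t) : Even (s.card + t.card + m) := by
  induction m generalizing σ s with
  | zero =>
    rw [iterTwist_zero, hs] at ht
    rw [multiset_add_self_injective ht, add_zero]
    exact Even.add_self _
  | succ m ih =>
    rw [← Fin.cons_self_tail η, iterTwist_cons] at ht
    obtain ⟨⟨a, b, hab, hη0⟩, -⟩ := id (hη 0)
    have htw : IsTwisted τ (twist τ (η 0) σ) :=
      isTwisted_twist h hτ (by rw [hη0, swap_mul_self])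
    have hmem : twist τ (η 0) σ ∈ G := G.mul_mem (G.mul_mem (hηG 0) hσ) (hηG' 0)
    have key : ∀ r : Multiset ℕ, (twist τ (η 0) σ).partition.parts = r + r →
        Even (r.card + t.card + m) := fun r hr =>
      ih (fun i => hη i.succ) (fun i => hηG i.succ) (fun i => hηG' i.succ) htw hmem hr ht
    have hstay : ¬ σ.SameCycle (τ a) b := by
      rintro ⟨k, hk⟩
      refine hG (η 0 * σ ^ k) (G.mul_mem (hηG 0) (G.zpow_mem hσ k)) (τ a) ?_
      rw [mul_apply, hk, hη0, swap_apply_right, involutive_of_mul_self hτ]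
    rw [hη0] at key
    have hcard : ∀ {x : X}, cycleCard σ x ∈ s := fun {x} => by
      have := cycleCard_mem_parts σ x
      rwa [hs, Multiset.mem_add, or_self] at this
    by_cases h1 : σ.SameCycle a b
    · obtain ⟨p, hp, rfl⟩ := exists_pow_apply_eq h1
      have hp0 : 0 < p := Nat.pos_of_ne_zero (by rintro rfl; exact hab rfl)
      have h2 := key _ (h.parts_twist_cut hτ h0 hs hp0 hp)
      rw [Multiset.card_cons, Multiset.card_cons, Multiset.card_erase_add_one hcard] at h2
      rw [Nat.even_iff] at h2 ⊢
      omega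
    · have h2 := key _ (h.parts_twist_join hτ h0 hs h1 hstay)
      have h3 := parts_twist_join_aux h hτ h0 h1 hstay
      rw [h.parts_twist_join hτ h0 hs h1 hstay, hs] at h3
      have h4 := congrArg Multiset.card h3
      simp only [Multiset.card_add, Multiset.card_cons, Multiset.insert_eq_cons,
        Multiset.card_singleton] at h4
      rw [Multiset.card_cons] at h2
      rw [Nat.even_iff] at h2 ⊢
      omega

theorem isPretransitive_of_nonResonant (hτ : τ * τ = 1) (h0 : ∀ x, τ x ≠ x) {k l m : ℕ}
    {x : Fin k → ℕ} {y : Fin l → ℕ} (hxy : NonResonant x y) (hm : ¬ Even (k + l + m))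
    (hX : Fintype.card X = 2 * ∑ i, x i) {G : Subgroup (Perm X)}
    (hGτ : ∀ g ∈ G, τ * g * τ ∈ G) {η : Fin m → Perm X}
    (hη : ∀ i, Allowed τ (η i)) (hηG : ∀ i, η i ∈ G) (h : IsTwisted τ σ) (hσ : σ ∈ G)
    (hs : σ.partition.parts = Finset.univ.val.map x + Finset.univ.val.map x)
    (ht : (iterTwist τ σ η).partition.parts = Finset.univ.val.map y + Finset.univ.val.map y) :
    MulAction.IsPretransitive G X := by
  classical
  have hηG' : ∀ i, τ * η i * τ ∈ G := fun i => hGτ _ (hηG i)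
  obtain ⟨a, g, hg, hga⟩ : ∃ a, ∃ g ∈ G, g a = τ a := by
    by_contra! hne
    have := even_card_of_forall_ne hτ h0 (fun g hg a => hne a g hg) hη hηG hηG' h hσ hs ht
    rw [Multiset.card_map, Multiset.card_map, Finset.card_val, Finset.card_val, Finset.card_fin,
      Finset.card_fin] at this
    exact hm this
  let O : X → Prop := fun z => ∃ g ∈ G, g a = z
  have hO : ∀ g ∈ G, ∀ z, O (g z) ↔ O z := by
    intro g hg z
    constructor
    · rintro ⟨g', hg', h'⟩
      exact ⟨g⁻¹ * g', G.mul_mem (G.inv_mem hg) hg', by rw [mul_apply, h']; simp⟩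
    · rintro ⟨g', hg', rfl⟩
      exact ⟨g * g', G.mul_mem hg hg', rfl⟩
  let U : Finset X := Finset.univ.filter fun z => O z ∨ O (τ z)
  have hUτ : ∀ z, z ∈ U ↔ τ z ∈ U := by
    intro z
    simp only [U, Finset.mem_filter, Finset.mem_univ, true_and, involutive_of_mul_self hτ z]
    exact or_comm
  have hUσ : ∀ σ' ∈ G, IsTwisted τ σ' → ∀ z, z ∈ U ↔ σ' z ∈ U := by
    intro σ' hσ' h' z
    simp only [U, Finset.mem_filter, Finset.mem_univ, true_and]
    have : τ (σ' z) = σ'⁻¹ (τ z) := by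
      have := h'.apply_zpow hτ 1 z
      rwa [zpow_one, zpow_neg_one] at this
    rw [this, hO _ hσ', hO _ (G.inv_mem hσ')]
  have ha : a ∈ U := by
    simp only [U, Finset.mem_filter, Finset.mem_univ, true_and]
    exact .inl ⟨1, G.one_mem, rfl⟩
  have hpos : 0 < U.card := Finset.card_pos.2 ⟨a, ha⟩
  have hfin := isTwisted_iterTwist hτ hη h
  obtain ⟨Z, hZ, hUZ⟩ := h.exists_card_eq hτ h0 hs (hUσ σ hσ h) hUτ
  obtain ⟨Z', hZ', hUZ'⟩ := hfin.exists_card_eq hτ h0 ht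
    (hUσ _ (iterTwist_mem hσ hηG hηG') hfin) hUτ
  obtain ⟨I, hI, rfl⟩ := exists_finset_of_le_map hZ
  obtain ⟨J, hJ, rfl⟩ := exists_finset_of_le_map hZ'
  have hIn : I.Nodup := Multiset.nodup_of_le hI Finset.univ.nodup
  have hJn : J.Nodup := Multiset.nodup_of_le hJ Finset.univ.nodup
  have hI0 : (⟨I, hIn⟩ : Finset (Fin k)).Nonempty := by
    rw [Finset.nonempty_iff_ne_empty]
    intro h'
    have : I = 0 := congrArg Finset.val h'
    rw [this] at hUZ
    simp only [Multiset.map_zero, Multiset.sum_zero] at hUZ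
    omega
  have hJ0 : (⟨J, hJn⟩ : Finset (Fin l)).Nonempty := by
    rw [Finset.nonempty_iff_ne_empty]
    intro h'
    have : J = 0 := congrArg Finset.val h'
    rw [this] at hUZ'
    simp only [Multiset.map_zero, Multiset.sum_zero] at hUZ'
    omega
  have hIJ : ∑ i ∈ (⟨I, hIn⟩ : Finset (Fin k)), x i = ∑ j ∈ (⟨J, hJn⟩ : Finset (Fin l)), y j := by
    change (I.map x).sum = (J.map y).sum
    omega
  have hIu : I = Finset.univ.val := congrArg Finset.val (hxy.eq_univ hI0 hJ0 hIJ).1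
  have hU : U = Finset.univ := by
    rw [← Finset.card_eq_iff_eq_univ, hUZ, hX, hIu]
    rfl
  have hall : ∀ z, O z := by
    intro z
    have hz : z ∈ U := hU ▸ Finset.mem_univ z
    simp only [U, Finset.mem_filter, Finset.mem_univ, true_and] at hz
    rcases hz with hz | ⟨g', hg', hz⟩
    · exact hz
    · refine ⟨τ * g' * τ * g, G.mul_mem (hGτ _ hg') hg, ?_⟩
      rw [mul_apply, hga, mul_apply, mul_apply, involutive_of_mul_self hτ, hz,
        involutive_of_mul_self hτ]
  refine ⟨fun z w => ?_⟩
  obtain ⟨g₁, hg₁, rfl⟩ := hall z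
  obtain ⟨g₂, hg₂, rfl⟩ := hall w
  refine ⟨⟨g₂ * g₁⁻¹, G.mul_mem hg₂ (G.inv_mem hg₁)⟩, ?_⟩
  change (g₂ * g₁⁻¹) (g₁ a) = g₂ a
  rw [mul_apply, ← mul_apply g₁⁻¹, inv_mul_cancel, one_apply]

end Transitivity

section Hurwitz

theorem tauPerm_mul_self (n : ℕ) : tauPerm n * tauPerm n = 1 := by
  ext (x | x) <;> rfl

theorem tauPerm_ne (n : ℕ) (x : Fin n ⊕ Fin n) : tauPerm n x ≠ x := by
  rcases x with x | x <;> simp [tauPerm]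

theorem mem_BTilde_iff {n : ℕ} {σ : Perm (Fin n ⊕ Fin n)} :
    σ ∈ BTilde n ↔ IsTwisted (tauPerm n) σ := by
  constructor
  · rintro ⟨h1, h2⟩
    exact ⟨h1, fun x hx => h2 x ⟨1, by rw [zpow_one, hx]⟩⟩
  · exact fun h => ⟨h.1, fun x => h.not_sameCycle (tauPerm_mul_self n) (tauPerm_ne n) x⟩

variable {n k l : ℕ} {μ ν : n.Partition} {x : Fin k → ℕ} {y : Fin l → ℕ}

open Classical in
theorem ncard_twistedFactorisations (hμ : μ.parts = Finset.univ.val.map x)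
    (hν : ν.parts = Finset.univ.val.map y) (hxy : NonResonant x y) (hk : 1 ≤ k) :
    ((twistedFactorisations 0 μ ν).ncard : ℚ) =
      ∑ σ ∈ Finset.univ.filter fun σ : Perm (Fin n ⊕ Fin n) => IsTwisted (tauPerm n) σ ∧
          σ.partition.parts = Finset.univ.val.map x + Finset.univ.val.map x,
        ∑ η : Fin (branchNumber 0 μ ν) → Perm (Fin n ⊕ Fin n),
          if ∀ i, Allowed (tauPerm n) (η i) then
            (if (iterTwist (tauPerm n) σ η).partition.parts =
              Finset.univ.val.map y + Finset.univ.val.map y then (1 : ℚ) else 0) else 0 := by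
  have hb : branchNumber 0 μ ν = k + l - 1 := by
    rw [branchNumber, hμ, hν, Multiset.card_map, Multiset.card_map, Finset.card_val,
      Finset.card_val, Finset.card_fin, Finset.card_fin, zero_add]
  have hsum : ∑ i, x i = n := by
    have := μ.parts_sum
    rwa [hμ] at this
  let T : Finset (Perm (Fin n ⊕ Fin n) × (Fin (branchNumber 0 μ ν) → Perm (Fin n ⊕ Fin n))) :=
    Finset.univ.filter fun q => (IsTwisted (tauPerm n) q.1 ∧
      q.1.partition.parts = Finset.univ.val.map x + Finset.univ.val.map x) ∧
      (∀ i, Allowed (tauPerm n) (q.2 i)) ∧ (iterTwist (tauPerm n) q.1 q.2).partition.parts =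
        Finset.univ.val.map y + Finset.univ.val.map y
  have hset : twistedFactorisations 0 μ ν =
      (fun q : Perm (Fin n ⊕ Fin n) × (Fin (branchNumber 0 μ ν) → Perm (Fin n ⊕ Fin n)) =>
        (q.1, q.2, iterTwist (tauPerm n) q.1 q.2)) '' (T : Set _) := by
    ext ⟨σ, η, σ'⟩
    simp only [Set.mem_image, Finset.mem_coe, T, Finset.mem_filter, Finset.mem_univ, true_and,
      Prod.mk.injEq, Prod.exists]
    constructor
    · rintro ⟨h1, h2, h3, h4, -⟩
      refine ⟨σ, η, ⟨⟨mem_BTilde_iff.1 h1.1, ?_⟩, h3, ?_⟩, rfl, rfl, h4⟩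
      · rw [← hμ]
        exact h1.2
      · rw [← hν]
        exact (congrArg (fun π : Perm (Fin n ⊕ Fin n) => π.partition.parts) h4).trans h2
    · rintro ⟨_, _, ⟨⟨h1, h2⟩, h3, h4⟩, rfl, rfl, rfl⟩
      refine ⟨⟨mem_BTilde_iff.2 h1, by rw [hμ]; exact h2⟩, by rw [hν]; exact h4, h3, rfl, ?_⟩
      have hσ'' := isTwisted_iterTwist (tauPerm_mul_self n) h3 h1
      refine isPretransitive_of_nonResonant (tauPerm_mul_self n) (tauPerm_ne n) hxy ?_ ?_ ?_ h3 ?_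
        h1 ?_ h2 h4
      · rw [hb, Nat.even_iff]
        omega
      · rw [hsum, Fintype.card_sum, Fintype.card_fin, two_mul]
      · set S := _ ∪ Set.range _ with hS
        have hτi : (tauPerm n)⁻¹ = tauPerm n := inv_eq_of_mul_eq_one_left (tauPerm_mul_self n)
        have hle : Subgroup.closure S ≤
            (Subgroup.closure S).comap (MulAut.conj (tauPerm n)).toMonoidHom := by
          rw [Subgroup.closure_le]
          intro g hg
          have hconj : (MulAut.conj (tauPerm n)).toMonoidHom g = tauPerm n * g * tauPerm n := by
            change tauPerm n * g * (tauPerm n)⁻¹ = _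
            rw [hτi]
          rw [SetLike.mem_coe, Subgroup.mem_comap, hconj]
          rcases hg with (hg | ⟨i, rfl⟩) | ⟨i, rfl⟩
          · rcases hg with rfl | rfl
            · rw [h1.1]
              exact Subgroup.inv_mem _ (Subgroup.subset_closure (.inl (.inl (.inl rfl))))
            · change tauPerm n * iterTwist _ _ _ * tauPerm n ∈ _
              rw [hσ''.1]
              exact Subgroup.inv_mem _ (Subgroup.subset_closure (.inl (.inl (.inr rfl))))
          · exact Subgroup.subset_closure (.inr ⟨i, rfl⟩)
          · have : ∀ g : Perm (Fin n ⊕ Fin n),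
                tauPerm n * (tauPerm n * g * tauPerm n) * tauPerm n = g := fun g => by
              calc tauPerm n * (tauPerm n * g * tauPerm n) * tauPerm n =
                  (tauPerm n * tauPerm n) * g * (tauPerm n * tauPerm n) := by simp only [mul_assoc]
                _ = g := by rw [tauPerm_mul_self, one_mul, mul_one]
            rw [this]
            exact Subgroup.subset_closure (.inl (.inr ⟨i, rfl⟩))
        intro g hg
        have := hle hg
        rw [Subgroup.mem_comap] at this
        change tauPerm n * g * (tauPerm n)⁻¹ ∈ _ at this
        rwa [hτi] at this
      · exact fun i => Subgroup.subset_closure (.inl (.inr ⟨i, rfl⟩))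
      · exact Subgroup.subset_closure (.inl (.inl (.inl rfl)))
  rw [hset, Set.ncard_image_of_injective _ fun q q' h => by
    simp only [Prod.mk.injEq] at h
    exact Prod.ext h.1 h.2.1, Set.ncard_coe_finset, Finset.natCast_card_filter, Fintype.sum_prod_type,
    Finset.sum_filter]
  refine Finset.sum_congr rfl fun σ _ => ?_
  split_ifs with h
  · refine Finset.sum_congr rfl fun η _ => ?_
    simp only [h, true_and, and_self, ite_and]
  · exact Finset.sum_eq_zero fun η _ => if_neg fun h' => h h'.1

/-- The twisted double Hurwitz numbers of nonresonant partitions in terms of coloured counts. -/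
theorem autCard_mul_twistedHurwitz (hμ : μ.parts = Finset.univ.val.map x)
    (hν : ν.parts = Finset.univ.val.map y) (hxy : NonResonant x y) (hk : 1 ≤ k) :
    (autCard x : ℚ) * (autCard y : ℚ) * twistedHurwitz 0 μ ν * (2 ^ k * ∏ i, (x i : ℚ)) =
      colCount y (k + l - 1) (Finset.univ.val.map fun i => (x i, Finset.univ)) := by
  classical
  have hb : branchNumber 0 μ ν = k + l - 1 := by
    rw [branchNumber, hμ, hν, Multiset.card_map, Multiset.card_map, Finset.card_val,
      Finset.card_val, Finset.card_fin, Finset.card_fin, zero_add]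
  have hsum : ∑ i, x i = n := by
    have := μ.parts_sum
    rwa [hμ] at this
  have h1 := ncard_twistedFactorisations hμ hν hxy hk
  have h2 : (autCard y : ℚ) * (twistedFactorisations 0 μ ν).ncard =
      (Finset.univ.filter fun σ : Perm (Fin n ⊕ Fin n) => IsTwisted (tauPerm n) σ ∧
        σ.partition.parts = Finset.univ.val.map x + Finset.univ.val.map x).card *
      colCount y (k + l - 1) (Finset.univ.val.map fun i => (x i, Finset.univ)) := by
    rw [h1, Finset.mul_sum, ← nsmul_eq_mul, ← Finset.sum_const]
    refine Finset.sum_congr rfl fun σ hσ => ?_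
    have hσ' := (Finset.mem_filter.1 hσ).2
    rw [← autCard_mul_cutJoin_iterate hxy, ← hb, ← IsTwisted.sum_iterTwist (tauPerm_mul_self n)
      (tauPerm_ne n) (G := fun σ => if σ.partition.parts =
        Finset.univ.val.map y + Finset.univ.val.map y then (autCard y : ℚ) else 0) ?_ _ hσ'.1 hσ'.2,
      Finset.mul_sum]
    · refine Finset.sum_congr rfl fun η _ => ?_
      simp only [mul_ite, mul_one, mul_zero]
    · intro σ _ t ht
      have : t + t = Finset.univ.val.map y + Finset.univ.val.map y ↔ t = Finset.univ.val.map y :=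
        ⟨multiset_add_self_injective, fun h => by rw [h]⟩
      simp only [ht, this]
  have h3 := card_isTwisted_mul (tauPerm_mul_self n) (tauPerm_ne n) (n := n) (by
    rw [Fintype.card_sum, Fintype.card_fin, two_mul]) hxy.1 hsum
  have h4 : ((2 * n).doubleFactorial : ℚ) ≠ 0 := by
    rw [Nat.doubleFactorial_two_mul]
    positivity
  rw [← Nat.doubleFactorial_two_mul] at h3
  have h5 := congrArg (Nat.cast (R := ℚ)) h3
  push_cast at h5
  rw [twistedHurwitz]
  field_simp
  rw [← h5]
  linear_combination (autCard x : ℚ) * 2 ^ k * (∏ i, (x i : ℚ)) * h2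

end Hurwitz

end TwistedHurwitz

namespace TwistedHurwitz

section Polynomiality

variable {k l : ℕ} {C : Set (Fin k ⊕ Fin l → ℝ)}

theorem IsHom.exists_polynomial {T σ : Type*} {ev : T → σ → ℚ} {d : ℕ} {F : T → ℚ}
    (hF : IsHom ev d F) (h0 : F ≠ 0) :
    ∃ Q : MvPolynomial σ ℚ, Q.IsHomogeneous d ∧ ∀ t, F t = MvPolynomial.eval (ev t) Q := by
  rcases hF with h | ⟨e, he, Q, hQ, hF⟩
  · exact absurd h h0
  · obtain rfl : e = d := by exact_mod_cast he
    exact ⟨Q, hQ, hF⟩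

/-- The partition with given parts. -/
def partitionOf (x : Fin k → ℕ) (hx : ∀ i, 0 < x i) {n : ℕ} (hn : ∑ i, x i = n) : n.Partition where
  parts := Finset.univ.val.map x
  parts_pos := fun {m} hm => by
    obtain ⟨i, -, rfl⟩ := Multiset.mem_map.1 hm
    exact hx i
  parts_sum := hn

/-- On every chamber, the twisted double Hurwitz numbers in genus zero are given by the difference
of two homogeneous polynomials of consecutive degrees. -/
theorem exists_computesOn (hk : 1 ≤ k) (hl : 1 ≤ l) (hC : IsChamber C) :
    ∃ QA QB : MvPolynomial (Fin k ⊕ Fin l) ℚ, QA.IsHomogeneous (k + l - 1) ∧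
      QB.IsHomogeneous (k + l - 2) ∧ (∀ t : IntegralPoint C, 0 < MvPolynomial.eval (coords t) QA) ∧
      (∀ t : IntegralPoint C, 0 < MvPolynomial.eval (coords t) QB) ∧
      ComputesOn 0 C (MvPolynomial.C (2 ^ k)⁻¹ * (QA - QB)) := by
  obtain ⟨A, B, hA, hB, hA0, hB0, hAB⟩ := exists_hom_of_chamber hk hl hC
  obtain ⟨t₀⟩ := nonempty_integralPoint hl hC
  obtain ⟨QA, hQA, hA'⟩ := hA.exists_polynomial fun h => (hA0 t₀).ne' (congrFun h t₀)
  obtain ⟨QB, hQB, hB'⟩ := hB.exists_polynomial fun h => (hB0 t₀).ne' (congrFun h t₀)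
  refine ⟨QA, QB, hQA, hQB, fun t => hA' t ▸ hA0 t, fun t => hB' t ▸ hB0 t, ?_⟩
  intro n μ ν x y hμ hν hxy
  let t : IntegralPoint C := ⟨(x, y), hxy⟩
  have hnr : NonResonant x y := by
    obtain ⟨p, hp, rfl⟩ := hC
    exact nonResonant_of_mem (q := (x, y)) (connectedComponentIn_subset _ _ t.2)
  have h1 := autCard_mul_twistedHurwitz hμ hν hnr hk
  rw [hAB t] at h1
  have hprod : (∏ i, (x i : ℚ)) ≠ 0 :=
    Finset.prod_ne_zero_iff.2 fun i _ => Nat.cast_ne_zero.2 (hnr.1 i).ne'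
  change _ = MvPolynomial.eval (coords t) _
  rw [map_mul, MvPolynomial.eval_C, map_sub, ← hA', ← hB', inv_mul_eq_div, eq_div_iff (by positivity)]
  refine mul_right_cancel₀ hprod ?_
  rw [mul_assoc, h1]

theorem eval_eq_of_computesOn (hC : IsChamber C) {P P' : MvPolynomial (Fin k ⊕ Fin l) ℚ}
    (hP : ComputesOn 0 C P) (hP' : ComputesOn 0 C P') (t : IntegralPoint C) :
    MvPolynomial.eval (coords t) P = MvPolynomial.eval (coords t) P' := by
  have hnr : NonResonant t.1.1 t.1.2 := by
    obtain ⟨p, hp, rfl⟩ := hC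
    exact nonResonant_of_mem (connectedComponentIn_subset _ _ t.2)
  exact (hP _ (partitionOf t.1.1 hnr.1 rfl) (partitionOf t.1.2 hnr.2.1 hnr.2.2.1.symm) _ _ rfl rfl
    t.2).symm.trans (hP' _ _ _ _ _ rfl rfl t.2)

theorem not_zeroOnHyperplane_iff (hk : 1 ≤ k) (hl : 1 ≤ l) (hC : IsChamber C)
    {P : MvPolynomial (Fin k ⊕ Fin l) ℚ} (hP : ComputesOn 0 C P) (d : ℕ) :
    ¬ ZeroOnHyperplane (MvPolynomial.homogeneousComponent d P) ↔
      d = k + l - 1 ∨ d = k + l - 2 := by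
  obtain ⟨QA, QB, hQA, hQB, hA, hB, hAB⟩ := exists_computesOn hk hl hC
  obtain ⟨t₀⟩ := nonempty_integralPoint hl hC
  have ht₀ : ∑ i, coords t₀ (Sum.inl i) = ∑ j, coords t₀ (Sum.inr j) := by
    obtain ⟨p, hp, rfl⟩ := hC
    have := (nonResonant_of_mem (connectedComponentIn_subset _ _ t₀.2)).2.2.1
    simp only [coords, Sum.elim_inl, Sum.elim_inr]
    exact_mod_cast this
  have hF := zeroOnHyperplane_of_forall_eval_eq_zero hl hC
    (F := P - MvPolynomial.C (2 ^ k)⁻¹ * (QA - QB)) (fun t => by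
      rw [map_sub, eval_eq_of_computesOn hC hP hAB, sub_self]) d
  have hcomp : ∀ z : Fin k ⊕ Fin l → ℚ, ∑ i, z (Sum.inl i) = ∑ j, z (Sum.inr j) →
      MvPolynomial.eval z (MvPolynomial.homogeneousComponent d P) = (2 ^ k)⁻¹ *
        ((if d = k + l - 1 then MvPolynomial.eval z QA else 0) -
          if d = k + l - 2 then MvPolynomial.eval z QB else 0) := by
    intro z hz
    have h1 := hF z hz
    rw [map_sub, map_sub, sub_eq_zero, MvPolynomial.homogeneousComponent_C_mul, map_sub,
      MvPolynomial.homogeneousComponent_of_mem hQA,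
      MvPolynomial.homogeneousComponent_of_mem hQB] at h1
    rw [h1, map_mul, MvPolynomial.eval_C, map_sub]
    have he : ∀ (Q : MvPolynomial (Fin k ⊕ Fin l) ℚ) (p : Prop) [Decidable p],
        MvPolynomial.eval z (if p then Q else 0) = if p then MvPolynomial.eval z Q else 0 := by
      intro Q p _
      split_ifs
      · rfl
      · exact map_zero _
    rw [he, he]
  have h2 : ((2 : ℚ) ^ k)⁻¹ ≠ 0 := by positivity
  constructor
  · intro h
    by_contra! hd
    refine h fun z hz => ?_
    rw [hcomp z hz, if_neg hd.1, if_neg hd.2, sub_zero, mul_zero]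
  · rintro (rfl | rfl) h
    · have h3 := h _ ht₀
      rw [hcomp _ ht₀, if_pos rfl, if_neg (by omega), sub_zero] at h3
      exact (mul_ne_zero h2 (hA t₀).ne') h3
    · have h3 := h _ ht₀
      rw [hcomp _ ht₀, if_pos rfl, if_neg (by omega), zero_sub] at h3
      exact (mul_ne_zero h2 (neg_ne_zero.2 (hB t₀).ne')) h3

end Polynomiality

end TwistedHurwitz

namespace TwistedHurwitz

section Graphs

variable {n : ℕ} {μ ν : n.Partition} (Γ : TwistedMonodromyGraph 0 μ ν)

/-- The positions of the vertices, i.e. the vertices of the quotient by the involution. -/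
def positions : Finset ℕ := Finset.univ.image Γ.level

theorem level_mem_positions (v : Γ.V) : Γ.level v ∈ positions Γ :=
  Finset.mem_image_of_mem _ (Finset.mem_univ v)

/-- The quotient of the graph by the involution. -/
def quotientGraph : SimpleGraph (positions Γ) :=
  SimpleGraph.fromRel fun i j => ∃ e, Γ.level (Γ.tail e) = i ∧ Γ.level (Γ.head e) = j

theorem connected_quotientGraph : (quotientGraph Γ).Connected := by
  let f : Γ.skeleton →g quotientGraph Γ :=
    { toFun := fun v => ⟨Γ.level v, level_mem_positions Γ v⟩
      map_rel' := by
        intro v w h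
        rw [EndedDigraph.skeleton, SimpleGraph.fromRel_adj] at h
        rw [quotientGraph, SimpleGraph.fromRel_adj]
        rcases h.2 with ⟨e, rfl, rfl⟩ | ⟨e, rfl, rfl⟩
        · exact ⟨fun h' => (Γ.level_lt e).ne (congrArg Subtype.val h'), .inl ⟨e, rfl, rfl⟩⟩
        · exact ⟨fun h' => (Γ.level_lt e).ne' (congrArg Subtype.val h'), .inr ⟨e, rfl, rfl⟩⟩ }
  refine Γ.connected.map f ?_
  rintro ⟨i, hi⟩
  obtain ⟨v, -, rfl⟩ := Finset.mem_image.1 hi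
  exact ⟨v, rfl⟩

theorem level_iota (v : Γ.V) : Γ.level (Γ.iotaV v) = Γ.level v :=
  ((Γ.level_eq v (Γ.iotaV v)).2 (.inr rfl)).symm

theorem two_mul_card_positions :
    2 * (positions Γ).card = Fintype.card Γ.V + Γ.fourValent.card := by
  rw [← Finset.card_univ, Finset.card_eq_sum_card_image Γ.level Finset.univ,
    Finset.card_eq_sum_card_fiberwise (f := Γ.level) (s := Γ.fourValent) (t := positions Γ)
      (fun v _ => level_mem_positions Γ v), mul_comm, ← smul_eq_mul, ← Finset.sum_const,
    positions, ← Finset.sum_add_distrib]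
  refine Finset.sum_congr rfl fun i hi => ?_
  obtain ⟨v, -, rfl⟩ := Finset.mem_image.1 hi
  have h1 : (Finset.univ.filter fun w => Γ.level w = Γ.level v) = {v, Γ.iotaV v} := by
    ext w
    rw [Finset.mem_filter, Finset.mem_insert, Finset.mem_singleton, eq_comm, Γ.level_eq]
    exact and_iff_right (Finset.mem_univ _)
  have h2 : (Γ.fourValent.filter fun w => Γ.level w = Γ.level v) =
      ({v, Γ.iotaV v} : Finset Γ.V).filter fun w => Γ.iotaV w = w := by
    rw [← h1]
    ext w
    simp only [EndedDigraph.fourValent, Finset.mem_filter, Finset.mem_univ, true_and, Γ.iotaV_fixed,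
      and_comm]
  rw [h1, h2]
  by_cases h : Γ.iotaV v = v
  · rw [h, Finset.pair_eq_singleton, Finset.filter_singleton, if_pos h]
    rfl
  · have h3 : ({v, Γ.iotaV v} : Finset Γ.V).filter (fun w => Γ.iotaV w = w) = ∅ := by
      refine Finset.filter_eq_empty_iff.2 fun w hw => ?_
      rw [Finset.mem_insert, Finset.mem_singleton] at hw
      rcases hw with rfl | rfl
      · exact h
      · rw [Γ.iotaV_invol v]
        exact fun h' => h h'.symm
    rw [h3, Finset.card_pair fun h' => h h'.symm, Finset.card_empty]

theorem card_edgeSet_quotientGraph_le [DecidableEq Γ.E] {H : Finset Γ.E}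
    (hH : H ∈ transversals Γ.iotaE) : Nat.card (quotientGraph Γ).edgeSet ≤ H.card := by
  let F : Γ.E → Sym2 (positions Γ) := fun e =>
    s(⟨Γ.level (Γ.tail e), level_mem_positions Γ _⟩, ⟨Γ.level (Γ.head e), level_mem_positions Γ _⟩)
  have hF : ∀ e, F (Γ.iotaE e) = F e := by
    intro e
    simp only [F, Γ.tail_iota, Γ.head_iota, level_iota]
  have hsub : (quotientGraph Γ).edgeSet ⊆ F '' H := by
    intro q hq
    have hex : ∃ e, F e = q := by
      induction q using Sym2.ind with
      | h i j =>
        rw [SimpleGraph.mem_edgeSet, quotientGraph, SimpleGraph.fromRel_adj] at hq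
        rcases hq.2 with ⟨e, h1, h2⟩ | ⟨e, h1, h2⟩
        · refine ⟨e, ?_⟩
          simp only [F, h1, h2]
        · refine ⟨e, ?_⟩
          simp only [F, h1, h2]
          exact Sym2.eq_swap
    obtain ⟨e, rfl⟩ := hex
    by_cases he : e ∈ H
    · exact ⟨e, he, rfl⟩
    · refine ⟨Γ.iotaE e, ?_, hF e⟩
      rw [Finset.mem_coe, mem_transversals.1 hH, Γ.iotaE_invol e]
      exact he
  rw [Nat.card_coe_set_eq]
  refine (Set.ncard_le_ncard hsub (H.finite_toSet.image F)).trans ?_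
  refine (Set.ncard_image_le H.finite_toSet).trans ?_
  rw [Set.ncard_coe_finset]

/-- A twisted monodromy graph of genus zero has exactly one 4-valent vertex. -/
theorem card_fourValent : Γ.fourValent.card = 1 := by
  classical
  obtain ⟨H, hH⟩ := exists_mem_transversals Γ.iotaE_invol Γ.iotaE_ne
  have h1 := card_eq_two_mul_of_mem_transversals Γ.iotaE_invol hH
  have h2 := (connected_quotientGraph Γ).card_vert_le_card_edgeSet_add_one
  have h3 := card_edgeSet_quotientGraph_le Γ hH
  have h4 := two_mul_card_positions Γ
  have h5 := Γ.genus
  rw [Nat.card_eq_fintype_card, Fintype.card_coe] at h2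
  push_cast at h5
  omega

end Graphs

end TwistedHurwitz

theorem proposition6 :
    (∀ (k l : ℕ), 1 ≤ k → 1 ≤ l → ∀ C : Set (Fin k ⊕ Fin l → ℝ), IsChamber C →
      (∃ P : MvPolynomial (Fin k ⊕ Fin l) ℚ, ComputesOn 0 C P) ∧
      (∀ P : MvPolynomial (Fin k ⊕ Fin l) ℚ, ComputesOn 0 C P →
        ∀ d : ℕ, ¬ ZeroOnHyperplane (MvPolynomial.homogeneousComponent d P) ↔
          d = k + l - 1 ∨ d = k + l - 2)) ∧
    (∀ (n : ℕ), 0 < n → ∀ (μ ν : n.Partition) (Γ : TwistedMonodromyGraph 0 μ ν),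
      Γ.fourValent.card = 1) := by
  refine ⟨fun k l hk hl C hC => ⟨?_, fun P hP d => ?_⟩, fun n _ μ ν Γ => ?_⟩
  · obtain ⟨QA, QB, -, -, -, -, h⟩ := TwistedHurwitz.exists_computesOn hk hl hC
    exact ⟨_, h⟩
  · exact TwistedHurwitz.not_zeroOnHyperplane_iff hk hl hC hP d
  · exact TwistedHurwitz.card_fourValent Γ
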